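/- Let $(P_t)_{t\ge 0}$ be a Markov semigroup on a measurable space $E$, given by Markov kernels, $P_tf(x)=\int f(y)\,P_t(x,dy)$, with $P_0=\mathrm{id}$ and $P_{s+t}=P_sP_t$. Let $L=\partial_tP_t|_{t=0^+}$ be its infinitesimal generator, $\Gamma(f,g)=\frac12\big(L(fg)-fLg-gLf\big)$, $\Gamma(f)=\Gamma(f,f)$ and $\Gamma_2(f)=\frac12\big(L\Gamma(f)-2\Gamma(f,Lf)\big)$. Let $\mathcal A$ be an algebra of bounded measurable functions on $E$ that contains the constants, is contained in the domain of $L$ (that is, $(P_tf-f)/t\to Lf$ uniformly on $E$ as $t\to0^+$ for $f\in\mathcal A$), and is stable under $L$, under each $P_t$ and under composition with functions in $\mathcal C^\infty(\mathbb R)$. Assume that $L$ is a diffusion operator on $\mathcal A$: $L\phi(f)=\phi'(f)Lf+\phi''(f)\Gamma(f)$ for all $f\in\mathcal A$ and $\phi\in\mathcal C^\infty(\mathbb R)$. For $f\in\mathcal A$ and $t>0$ let $Q_tf$ be the (vanishing viscosity) solution at time $t$ of the Hamilton–Jacobi equation $\partial_tv+\frac12\Gamma(v)=0$, $v_0=f$,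 that is $$Q_tf(x)=\liminf_{\varepsilon\to0^+}v^\varepsilon_t(x),\qquad v^\varepsilon_t=-2\varepsilon\log P_{\varepsilon t}\big(e^{-f/(2\varepsilon)}\big),$$ where $v^\varepsilon$ solves $\partial_tv^\varepsilon+\frac12\Gamma(v^\varepsilon)-\varepsilon Lv^\varepsilon=0$, $v^\varepsilon_0=f$. Let $n\ge1$ be a real number. Then the following assertions are equivalent: (i) the semigroup satisfies the $CD(0,n)$ criterion: $\Gamma_2(f)\ge\frac1n(Lf)^2$ on $E$ for all $f\in\mathcal A$; (ii) for all $q_1>q_2>0$, $u_1,u_2>0$ and $t>0$ with $t=2(u_1q_1-u_2q_2)$, and for all $f\in\mathcal A$, $$P_{u_1}\big(e^{q_1Q_tf}\big)^{1/q_1}\le P_{u_2}\big(e^{q_2f}\big)^{1/q_2}\left[\frac{u_1^{1/q_2}}{u_2^{1/q_1}}\left(\frac{q_1-q_2}{u_1q_1-u_2q_2}\right)^{1/q_2-1/q_1}\right]^{n/2}\quad\text{on }E.$$ -/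

import Mathlib

open MeasureTheory ProbabilityTheory Filter Topology Set
open scoped ContDiff

/-- A Markov semigroup `(P_t)_{t ≥ 0}` on a measurable space, given by its transition kernels
`P_t(x, dy)`.  Only the times `t ≥ 0` are meaningful. -/
structure MarkovSemigroup (E : Type*) [MeasurableSpace E] where
  kernel : ℝ → Kernel E E
  isMarkov : ∀ t, 0 ≤ t → IsMarkovKernel (kernel t)
  kernel_zero : kernel 0 = Kernel.id
  kernel_add : ∀ s t, 0 ≤ s → 0 ≤ t → kernel (s + t) = kernel t ∘ₖ kernel s

namespace MarkovSemigroup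

variable {E : Type*} [MeasurableSpace E]

/-- The operator `P_t f (x) = ∫ f(y) P_t(x, dy)`. -/
noncomputable def op (P : MarkovSemigroup E) (t : ℝ) (f : E → ℝ) (x : E) : ℝ :=
  ∫ y, f y ∂(P.kernel t x)

/-- The infinitesimal generator `L f = ∂_t P_t f` at `t = 0⁺`. -/
noncomputable def gen (P : MarkovSemigroup E) (f : E → ℝ) (x : E) : ℝ :=
  derivWithin (fun t => P.op t f x) (Ici 0) 0

/-- The carré du champ `Γ(f, g) = (L(fg) - f L g - g L f) / 2`. -/
noncomputable def carre (P : MarkovSemigroup E) (f g : E → ℝ) (x : E) : ℝ :=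
  (1 / 2) * (P.gen (fun y => f y * g y) x - f x * P.gen g x - g x * P.gen f x)

/-- The iterated carré du champ `Γ₂(f) = (L Γ(f) - 2 Γ(f, L f)) / 2`. -/
noncomputable def carre2 (P : MarkovSemigroup E) (f : E → ℝ) (x : E) : ℝ :=
  (1 / 2) * (P.gen (P.carre f f) x - 2 * P.carre f (P.gen f) x)

/-- `A` is an algebra of bounded measurable functions (containing the constants) in the domain of
the generator `L`, stable under `L`, under the semigroup and under composition with smooth
functions, and `L` is a diffusion operator on `A`.  Since `A` is stable under `L` and made of
bounded functions, the uniform convergence in `tendsto_gen` amounts to pointwise convergence of the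
difference quotients with a uniform bound on them. -/
structure IsDiffusionAlgebra (P : MarkovSemigroup E) (A : Subalgebra ℝ (E → ℝ)) : Prop where
  measurable : ∀ f ∈ A, Measurable f
  bounded : ∀ f ∈ A, ∃ C : ℝ, ∀ x, |f x| ≤ C
  tendsto_gen : ∀ f ∈ A,
    TendstoUniformly (fun (t : ℝ) x => (P.op t f x - f x) / t) (P.gen f) (𝓝[>] 0)
  gen_mem : ∀ f ∈ A, P.gen f ∈ A
  op_mem : ∀ f ∈ A, ∀ t, 0 ≤ t → P.op t f ∈ A
  comp_mem : ∀ f ∈ A, ∀ φ : ℝ → ℝ, ContDiff ℝ ∞ φ → (fun x => φ (f x)) ∈ A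
  diffusion : ∀ f ∈ A, ∀ φ : ℝ → ℝ, ContDiff ℝ ∞ φ → ∀ x,
    P.gen (fun y => φ (f y)) x
      = deriv φ (f x) * P.gen f x + deriv (deriv φ) (f x) * P.carre f f x

/-- The curvature-dimension criterion `CD(ρ, n)`: `Γ₂(f) ≥ ρ Γ(f) + (L f)² / n` for `f ∈ A`. -/
def CurvatureDimension (P : MarkovSemigroup E) (A : Subalgebra ℝ (E → ℝ)) (ρ n : ℝ) : Prop :=
  ∀ f ∈ A, ∀ x, ρ * P.carre f f x + (1 / n) * (P.gen f x) ^ 2 ≤ P.carre2 f x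

/-- The solution `v^ε_t = -2ε log P_{εt}(e^{-f/(2ε)})` of the viscous Hamilton–Jacobi equation
`∂_t v + Γ(v)/2 - ε L v = 0` with initial value `f`. -/
noncomputable def viscousHJ (P : MarkovSemigroup E) (ε t : ℝ) (f : E → ℝ) (x : E) : ℝ :=
  -2 * ε * Real.log (P.op (ε * t) (fun y => Real.exp (-f y / (2 * ε))) x)

/-- The Hamilton–Jacobi semigroup: `Q_t f` is the vanishing viscosity solution at time `t` of
`∂_t v + Γ(v)/2 = 0`, `v_0 = f`, i.e. the limit of `v^ε_t` as `ε → 0⁺` (the lower limit, so that it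
always makes sense for bounded `f`).  It agrees with every classical solution, as shown in
`IsClassicalHJSolution.eq_hamiltonJacobi` below. -/
noncomputable def hamiltonJacobi (P : MarkovSemigroup E) (t : ℝ) (f : E → ℝ) (x : E) : ℝ :=
  liminf (fun ε => P.viscousHJ ε t f x) (𝓝[>] 0)

/-! ### Consistency of `hamiltonJacobi` with the Hamilton–Jacobi equation -/

/-- A classical solution `v` on `[0, T]`, with values in `A`, of the Hamilton–Jacobi equation
`∂_t v + Γ(v)/2 = 0` with initial value `f`. -/
structure IsClassicalHJSolution (P : MarkovSemigroup E) (A : Subalgebra ℝ (E → ℝ)) (T : ℝ)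
    (f : E → ℝ) (v : ℝ → E → ℝ) : Prop where
  init : v 0 = f
  mem : ∀ s ∈ Icc 0 T, v s ∈ A
  hasDeriv : ∀ s ∈ Icc 0 T, TendstoUniformly (fun r x => (v r x - v s x) / (r - s))
    (fun x => -(1 / 2) * P.carre (v s) (v s) x) (𝓝[Icc 0 T \ {s}] s)
  gen_bounded : ∃ K : ℝ, ∀ s ∈ Icc 0 T, ∀ x, |P.gen (v s) x| ≤ K

variable {P : MarkovSemigroup E} {A : Subalgebra ℝ (E → ℝ)}

lemma IsDiffusionAlgebra.integrable (hA : P.IsDiffusionAlgebra A) {f : E → ℝ} (hf : f ∈ A)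
    {t : ℝ} (ht : 0 ≤ t) (x : E) : Integrable f (P.kernel t x) := by
  have := P.isMarkov t ht
  obtain ⟨C, hC⟩ := hA.bounded f hf
  exact Integrable.of_bound (hA.measurable f hf).aestronglyMeasurable C
    (Eventually.of_forall hC)

lemma op_le_of_le (P : MarkovSemigroup E) {f : E → ℝ} {t C : ℝ} (ht : 0 ≤ t) (x : E)
    (h : ∀ y, |f y| ≤ C) : |P.op t f x| ≤ C := by
  have := P.isMarkov t ht
  have := norm_integral_le_of_norm_le_const (μ := P.kernel t x) (f := f) (C := C)
    (Eventually.of_forall h)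
  simpa [op] using this

lemma op_zero (hA : P.IsDiffusionAlgebra A) {f : E → ℝ} (hf : f ∈ A) : P.op 0 f = f := by
  ext x
  simp only [op, P.kernel_zero, Kernel.id_apply]
  exact integral_dirac' f x (hA.measurable f hf).stronglyMeasurable

lemma op_add (hA : P.IsDiffusionAlgebra A) {f : E → ℝ} (hf : f ∈ A) {s t : ℝ} (hs : 0 ≤ s)
    (ht : 0 ≤ t) (x : E) : P.op (s + t) f x = P.op s (P.op t f) x := by
  simp only [op]
  rw [P.kernel_add s t hs ht, Kernel.integral_comp]
  rw [← P.kernel_add s t hs ht]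
  exact hA.integrable hf (add_nonneg hs ht) x

lemma op_sub (hA : P.IsDiffusionAlgebra A) {f g : E → ℝ} (hf : f ∈ A) (hg : g ∈ A) {t : ℝ}
    (ht : 0 ≤ t) (x : E) : P.op t (fun y => f y - g y) x = P.op t f x - P.op t g x :=
  integral_sub (hA.integrable hf ht x) (hA.integrable hg ht x)

lemma op_smul (P : MarkovSemigroup E) (c : ℝ) (f : E → ℝ) (t : ℝ) (x : E) :
    P.op t (fun y => c * f y) x = c * P.op t f x := integral_const_mul c f

/-- Forward increments of the semigroup, uniformly in space. -/
lemma incr_small (hA : P.IsDiffusionAlgebra A) {f : E → ℝ} (hf : f ∈ A) {δ : ℝ} (hδ : 0 < δ) :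
    ∀ᶠ h in 𝓝[≥] (0 : ℝ), ∀ x, |P.op h f x - f x - h * P.gen f x| ≤ δ * h := by
  have h1 := Metric.tendstoUniformly_iff.1 (hA.tendsto_gen f hf) δ hδ
  rw [← Ioi_insert, nhdsWithin_insert, eventually_sup]
  refine ⟨by simp [op_zero hA hf], ?_⟩
  filter_upwards [h1, self_mem_nhdsWithin] with h hh h0 x
  have h0 : 0 < h := h0
  have := (hh x).le
  rw [Real.dist_eq, abs_sub_comm] at this
  have e : P.op h f x - f x - h * P.gen f x = ((P.op h f x - f x) / h - P.gen f x) * h := by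
    field_simp
  rw [e, abs_mul, abs_of_pos h0]
  gcongr

lemma incr_cont (hA : P.IsDiffusionAlgebra A) {f : E → ℝ} (hf : f ∈ A) {δ : ℝ} (hδ : 0 < δ) :
    ∀ᶠ h in 𝓝[≥] (0 : ℝ), ∀ x, |P.op h f x - f x| ≤ δ := by
  obtain ⟨C, hC⟩ := hA.bounded _ (hA.gen_mem f hf)
  have h2 : ∀ᶠ h in 𝓝[≥] (0 : ℝ), (1 + |C|) * h < δ := by
    have : Tendsto (fun h : ℝ => (1 + |C|) * h) (𝓝[≥] 0) (𝓝 ((1 + |C|) * 0)) :=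
      (continuous_const.mul continuous_id).continuousWithinAt
    rw [mul_zero] at this
    exact this.eventually (gt_mem_nhds hδ)
  filter_upwards [incr_small hA hf one_pos, h2, self_mem_nhdsWithin] with h h1 h2 h0 x
  have h0 : (0 : ℝ) ≤ h := h0
  have e := abs_add_le (P.op h f x - f x - h * P.gen f x) (h * P.gen f x)
  rw [sub_add_cancel, abs_mul, abs_of_nonneg h0] at e
  have := mul_le_mul_of_nonneg_left ((hC x).trans (le_abs_self C)) h0
  linarith [h1 x]

lemma tendsto_abs_sub (s : ℝ) (S : Set ℝ) :
    Tendsto (fun r : ℝ => |r - s|) (𝓝[S] s) (𝓝[≥] 0) := by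
  refine tendsto_nhdsWithin_iff.2 ⟨?_, Eventually.of_forall fun r => mem_Ici.2 (abs_nonneg _)⟩
  have : Continuous fun r : ℝ => |r - s| := by fun_prop
  exact (this.tendsto' s 0 (by simp)).mono_left nhdsWithin_le_nhds

/-- The heat equation `∂_s P_s f = P_s L f`. -/
lemma hasDerivWithinAt_op (hA : P.IsDiffusionAlgebra A) {f : E → ℝ} (hf : f ∈ A) {s : ℝ}
    (hs : 0 ≤ s) (x : E) :
    HasDerivWithinAt (fun r => P.op r f x) (P.op s (P.gen f) x) (Ici 0) s := by
  rw [hasDerivWithinAt_iff_isLittleO, Asymptotics.isLittleO_iff]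
  intro c hc
  have hL := hA.gen_mem f hf
  filter_upwards [(tendsto_abs_sub s (Ici 0)).eventually (incr_small hA hf (half_pos hc)),
    (tendsto_abs_sub s (Ici 0)).eventually (incr_cont hA hL (half_pos hc)),
    self_mem_nhdsWithin] with r h1 h2 hr
  have hr : (0 : ℝ) ≤ r := hr
  simp only [smul_eq_mul, Real.norm_eq_abs]
  have key : ∀ a, 0 ≤ a → ∀ h, 0 ≤ h →
      P.op (a + h) f x - P.op a f x - h * P.op a (P.gen f) x
        = P.op a (fun y => P.op h f y - f y - h * P.gen f y) x := by
    intro a ha h hh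
    have hm := hA.op_mem f hf h hh
    have e1 := op_sub hA (A.sub_mem hm hf) (A.smul_mem hL h) ha x
    have e2 := op_sub hA hm hf ha x
    have e3 := P.op_smul h (P.gen f) a x
    simp only [Pi.sub_apply, Pi.smul_apply, smul_eq_mul] at e1
    change _ = P.op a (fun y => P.op h f y - f y) x - P.op a (fun y => h * P.gen f y) x at e1
    rw [e1, e3, e2, op_add hA hf ha hh]
  rcases le_total s r with hsr | hsr
  · rw [abs_of_nonneg (sub_nonneg.2 hsr)] at *
    have := key s hs (r - s) (sub_nonneg.2 hsr)
    rw [add_sub_cancel] at this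
    rw [this]
    refine (P.op_le_of_le hs x h1).trans ?_
    have := sub_nonneg.2 hsr
    nlinarith
  · rw [abs_sub_comm r s, abs_of_nonneg (sub_nonneg.2 hsr)] at *
    set h := s - r with hh
    have h0 : 0 ≤ h := sub_nonneg.2 hsr
    have hk := key r hr h h0
    have hs' : r + h = s := by rw [hh]; ring
    rw [hs'] at hk
    have b1 := P.op_le_of_le hr x h1
    rw [← hk] at b1
    have b2 := P.op_le_of_le hr x h2
    have e2 := op_sub hA (hA.op_mem _ hL h h0) hL hr x
    rw [e2, ← op_add hA hL hr h0, hs'] at b2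
    have b3 : |h * (P.op s (P.gen f) x - P.op r (P.gen f) x)| ≤ h * (c / 2) := by
      rw [abs_mul, abs_of_nonneg h0]; gcongr
    have e : P.op r f x - P.op s f x - (r - s) * P.op s (P.gen f) x
        = -(P.op s f x - P.op r f x - h * P.op r (P.gen f) x)
          + h * (P.op s (P.gen f) x - P.op r (P.gen f) x) := by rw [hh]; ring
    rw [e]
    refine (abs_add_le _ _).trans ?_
    rw [abs_neg]
    linarith

lemma carre_mem (hA : P.IsDiffusionAlgebra A) {f g : E → ℝ} (hf : f ∈ A) (hg : g ∈ A) :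
    P.carre f g ∈ A :=
  A.smul_mem (A.sub_mem (A.sub_mem (hA.gen_mem _ (A.mul_mem hf hg))
    (A.mul_mem hf (hA.gen_mem g hg))) (A.mul_mem hg (hA.gen_mem f hf))) (1 / 2)

lemma exp_affine_mem (hA : P.IsDiffusionAlgebra A) {f : E → ℝ} (hf : f ∈ A) (a b : ℝ) :
    (fun y => Real.exp (a * f y + b)) ∈ A :=
  hA.comp_mem f hf (fun z => Real.exp (a * z + b)) (by fun_prop)

lemma gen_exp_affine (hA : P.IsDiffusionAlgebra A) {f : E → ℝ} (hf : f ∈ A) (a b : ℝ) (x : E) :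
    P.gen (fun y => Real.exp (a * f y + b)) x
      = Real.exp (a * f x + b) * (a * P.gen f x + a ^ 2 * P.carre f f x) := by
  have h1 : ∀ c : ℝ, deriv (fun z : ℝ => c * Real.exp (a * z + b))
      = fun z => c * a * Real.exp (a * z + b) := by
    intro c
    ext z
    have : HasDerivAt (fun z : ℝ => c * Real.exp (a * z + b))
        (c * (Real.exp (a * z + b) * (a * 1))) z :=
      ((((hasDerivAt_id z).const_mul a).add_const b).exp).const_mul c
    rw [this.deriv]; ring
  have h2 := h1 1
  simp only [one_mul] at h2
  rw [hA.diffusion f hf (fun z => Real.exp (a * z + b)) (by fun_prop) x, h2, h1 a]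
  ring

/-- Differentiation of `P_{ε(t - r)} W_r` along an `A`-valued curve `W` with uniform derivative
`D` at `r`. -/
lemma hasDerivWithinAt_interp (hA : P.IsDiffusionAlgebra A) {W : ℝ → E → ℝ} {D : E → ℝ}
    {ε t r : ℝ} (hε : 0 < ε) (hr : r ∈ Icc 0 t) (hW : ∀ s ∈ Icc 0 t, W s ∈ A) (hD : D ∈ A)
    (hWD : ∀ δ > 0, ∀ᶠ s in 𝓝[Icc 0 t] r, ∀ y, |W s y - W r y - (s - r) * D y| ≤ δ * |s - r|)
    (x : E) :
    HasDerivWithinAt (fun s => P.op (ε * (t - s)) (W s) x)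
      (P.op (ε * (t - r)) D x - ε * P.op (ε * (t - r)) (P.gen (W r)) x) (Icc 0 t) r := by
  have hmaps : MapsTo (fun s : ℝ => ε * (t - s)) (Icc 0 t) (Ici 0) := fun s hs =>
    mem_Ici.2 (mul_nonneg hε.le (sub_nonneg.2 hs.2))
  have hin : HasDerivWithinAt (fun s : ℝ => ε * (t - s)) (ε * (0 - 1)) (Icc 0 t) r :=
    ((hasDerivWithinAt_const r _ t).sub (hasDerivWithinAt_id r _)).const_mul ε
  have h3 := (hasDerivWithinAt_op hA (hW r hr) (hmaps hr) x).comp r hin hmaps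
  have hc := ((hasDerivWithinAt_op hA hD (hmaps hr) x).comp r hin hmaps).continuousWithinAt
  rw [hasDerivWithinAt_iff_isLittleO, Asymptotics.isLittleO_iff] at h3 ⊢
  intro c hc0
  have hc3 : 0 < c / 3 := by positivity
  filter_upwards [h3 hc3, (Metric.tendsto_nhds.1 hc) (c / 3) hc3, hWD (c / 3) hc3,
    self_mem_nhdsWithin] with s a1 a2 a3 hs
  simp only [Function.comp, smul_eq_mul, Real.norm_eq_abs, Real.dist_eq] at a1 a2 ⊢
  have hs0 : 0 ≤ ε * (t - s) := hmaps hs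
  have b1 := P.op_le_of_le hs0 x a3
  have e1 := op_sub hA (A.sub_mem (hW s hs) (hW r hr)) (A.smul_mem hD (s - r)) hs0 x
  have e2 := op_sub hA (hW s hs) (hW r hr) hs0 x
  have e3 := P.op_smul (s - r) D (ε * (t - s)) x
  simp only [Pi.sub_apply, Pi.smul_apply, smul_eq_mul] at e1
  change _ = P.op _ (fun y => W s y - W r y) x - P.op _ (fun y => (s - r) * D y) x at e1
  rw [e1, e2, e3] at b1
  have b2 : |(s - r) * (P.op (ε * (t - s)) D x - P.op (ε * (t - r)) D x)|
      ≤ |s - r| * (c / 3) := by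
    rw [abs_mul]; gcongr
  have e : P.op (ε * (t - s)) (W s) x - P.op (ε * (t - r)) (W r) x
      - (s - r) * (P.op (ε * (t - r)) D x - ε * P.op (ε * (t - r)) (P.gen (W r)) x)
      = (P.op (ε * (t - s)) (W s) x - P.op (ε * (t - s)) (W r) x
          - (s - r) * P.op (ε * (t - s)) D x)
        + ((s - r) * (P.op (ε * (t - s)) D x - P.op (ε * (t - r)) D x)
        + (P.op (ε * (t - s)) (W r) x - P.op (ε * (t - r)) (W r) x
          - (s - r) * (P.op (ε * (t - r)) (P.gen (W r)) x * (ε * (0 - 1))))) := by ring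
  rw [e]
  refine (abs_add_le _ _).trans ?_
  have := abs_add_le ((s - r) * (P.op (ε * (t - s)) D x - P.op (ε * (t - r)) D x))
    (P.op (ε * (t - s)) (W r) x - P.op (ε * (t - r)) (W r) x
          - (s - r) * (P.op (ε * (t - r)) (P.gen (W r)) x * (ε * (0 - 1))))
  exact (add_le_add b1 (this.trans (add_le_add b2 a1))).trans (le_of_eq (by ring))

lemma exp_increment {y d k η : ℝ} {B : ℝ} (hd : |d| ≤ B) (hη1 : η ≤ 1)
    (h : |y - k * d| ≤ η * |k|) (hk : (B + 1) * |k| ≤ 1) (hk2 : (B + 1) ^ 2 * |k| ≤ η) :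
    |Real.exp y - 1 - k * d| ≤ 2 * η * |k| := by
  have hB : 0 ≤ B := (abs_nonneg d).trans hd
  have hy : |y| ≤ (B + 1) * |k| := by
    have := abs_add_le (y - k * d) (k * d)
    rw [sub_add_cancel, abs_mul] at this
    have h1 : |k| * |d| ≤ |k| * B := by gcongr
    have h2 : η * |k| ≤ 1 * |k| := by gcongr
    linarith
  have h1 := Real.abs_exp_sub_one_sub_id_le (hy.trans hk)
  have h2 : y ^ 2 ≤ η * |k| := by
    have : |y| ^ 2 ≤ ((B + 1) * |k|) ^ 2 := by gcongr
    rw [sq_abs] at this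
    have h3 : (B + 1) ^ 2 * |k| * |k| ≤ η * |k| := by gcongr
    nlinarith
  have := abs_add_le (Real.exp y - 1 - y) (y - k * d)
  rw [show Real.exp y - 1 - y + (y - k * d) = Real.exp y - 1 - k * d by ring] at this
  linarith

/-- Comparison of a classical solution with the viscous approximations. -/
lemma IsClassicalHJSolution.hasDerivWithinAt_exp_interp (hA : P.IsDiffusionAlgebra A) {T t ε c : ℝ}
    {f : E → ℝ} {v : ℝ → E → ℝ} (hv : P.IsClassicalHJSolution A T f v) (ht : t ∈ Icc 0 T)
    (hε : 0 < ε) (x : E) (r : ℝ) (hr : r ∈ Icc 0 t) :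
    HasDerivWithinAt
      (fun s => P.op (ε * (t - s)) (fun y => Real.exp (-1 / (2 * ε) * v s y + c / 2 * s)) x)
      (P.op (ε * (t - r)) (fun y => Real.exp (-1 / (2 * ε) * v r y + c / 2 * r)
        * ((c + P.gen (v r) y) / 2)) x) (Icc 0 t) r := by
  have hsub : Icc 0 t ⊆ Icc 0 T := Icc_subset_Icc_right ht.2
  have hvr := hv.mem r (hsub hr)
  set W : ℝ → E → ℝ := fun s y => Real.exp (-1 / (2 * ε) * v s y + c / 2 * s) with hWdef
  have hW : ∀ s ∈ Icc 0 t, W s ∈ A := fun s hs =>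
    exp_affine_mem hA (hv.mem s (hsub hs)) _ _
  have hG := carre_mem hA hvr hvr
  set d : E → ℝ := fun y => 1 / (4 * ε) * P.carre (v r) (v r) y + c / 2 with hd
  have hdA : d ∈ A := hA.comp_mem _ hG (fun z => 1 / (4 * ε) * z + c / 2) (by fun_prop)
  set D : E → ℝ := fun y => W r y * d y with hDdef
  have hDA : D ∈ A := A.mul_mem (hW r hr) hdA
  have hWD : ∀ δ > 0, ∀ᶠ s in 𝓝[Icc 0 t] r, ∀ y,
      |W s y - W r y - (s - r) * D y| ≤ δ * |s - r| := by
    intro δ hδ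
    obtain ⟨B, hB⟩ := hA.bounded d hdA
    obtain ⟨M, hM⟩ := hA.bounded _ (hW r hr)
    set M' := |M| + 1 with hM'
    have hM0 : 0 < M' := by positivity
    set η := min 1 (δ / (2 * M')) with hη
    have hη0 : 0 < η := lt_min one_pos (by positivity)
    have hη1 : η ≤ 1 := min_le_left _ _
    have hη2 : 2 * η * M' ≤ δ := by
      have : η ≤ δ / (2 * M') := min_le_right _ _
      rw [le_div_iff₀ (by positivity)] at this
      linarith
    have hq := Metric.tendstoUniformly_iff.1 (hv.hasDeriv r (hsub hr)) (2 * ε * η)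
      (by positivity)
    have hq' := hq.filter_mono (nhdsWithin_mono r (sdiff_subset_sdiff_left hsub))
    have small : ∀ a : ℝ, ∀ b > 0, ∀ᶠ s in 𝓝[Icc 0 t] r, a * |s - r| ≤ b := by
      intro a b hb
      have hcont : Continuous fun s : ℝ => a * |s - r| := by fun_prop
      have := hcont.continuousWithinAt (s := Icc 0 t) (x := r)
      have h0 : a * |r - r| < b := by simpa using hb
      exact (this.eventually (gt_mem_nhds h0)).mono fun s hs => hs.le
    have hq2 : ∀ᶠ s in 𝓝[Icc 0 t] r, s ≠ r → ∀ y,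
        |(v s y - v r y) / (s - r) + 1 / 2 * P.carre (v r) (v r) y| < 2 * ε * η := by
      rw [nhdsWithin, eventually_inf_principal] at hq' ⊢
      filter_upwards [hq'] with s h1 hs hne y
      have := h1 ⟨hs, hne⟩ y
      rw [Real.dist_eq, abs_sub_comm] at this
      convert this using 2
      ring
    filter_upwards [hq2, small (B + 1) 1 one_pos, small ((B + 1) ^ 2) η hη0] with s h1 h2 h3 y
    rcases eq_or_ne s r with rfl | hne
    · simp
    have hsr : s - r ≠ 0 := sub_ne_zero.2 hne
    have key := exp_increment (y := -1 / (2 * ε) * (v s y - v r y) + c / 2 * (s - r))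
      (d := d y) (k := s - r) (hB y) hη1 (by
        have e : -1 / (2 * ε) * (v s y - v r y) + c / 2 * (s - r) - (s - r) * d y
            = -1 / (2 * ε) * ((v s y - v r y) / (s - r)
              + 1 / 2 * P.carre (v r) (v r) y) * (s - r) := by
          simp only [hd]; field_simp; ring
        rw [e, abs_mul, abs_mul, abs_div, abs_neg, abs_one, abs_of_pos (by positivity : 0 < 2 * ε)]
        have := (h1 hne y).le
        gcongr
        rw [one_div, inv_mul_le_iff₀ (by positivity)]
        exact this) h2 h3
    have e : W s y - W r y - (s - r) * D y = W r y * (Real.exp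
        (-1 / (2 * ε) * (v s y - v r y) + c / 2 * (s - r)) - 1 - (s - r) * d y) := by
      have : W s y = W r y * Real.exp
          (-1 / (2 * ε) * (v s y - v r y) + c / 2 * (s - r)) := by
        simp only [hWdef]; rw [← Real.exp_add]; congr 1; ring
      rw [this, hDdef]; ring
    rw [e, abs_mul]
    have hWM : |W r y| ≤ M' := (hM y).trans ((le_abs_self M).trans (by simp [hM']))
    calc |W r y| * _ ≤ M' * (2 * η * |s - r|) := by gcongr
      _ = 2 * η * M' * |s - r| := by ring
      _ ≤ δ * |s - r| := by gcongr
  have main := hasDerivWithinAt_interp hA hε hr hW hDA hWD x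
  have hs0 : 0 ≤ ε * (t - r) := mul_nonneg hε.le (sub_nonneg.2 hr.2)
  have e4 := op_sub hA hDA (A.smul_mem (hA.gen_mem _ (hW r hr)) ε) hs0 x
  have e5 := P.op_smul ε (P.gen (W r)) (ε * (t - r)) x
  simp only [Pi.smul_apply, smul_eq_mul] at e4
  change _ = _ - P.op _ (fun y => ε * P.gen (W r) y) x at e4
  rw [← e5, ← e4] at main
  convert main using 2
  ext y
  have := gen_exp_affine hA hvr (-1 / (2 * ε)) (c / 2 * r) y
  change P.gen (W r) y = W r y * _ at this
  rw [this]
  simp only [hDdef, hd]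
  change W r y * _ = _
  field_simp
  ring

/-- A classical solution of the Hamilton–Jacobi equation is given by `Q_t`. -/
lemma IsClassicalHJSolution.eq_hamiltonJacobi (hA : P.IsDiffusionAlgebra A) {T t : ℝ}
    {f : E → ℝ} {v : ℝ → E → ℝ} (hv : P.IsClassicalHJSolution A T f v) (ht : t ∈ Icc 0 T)
    (x : E) : P.hamiltonJacobi t f x = v t x := by
  obtain ⟨K, hK⟩ := hv.gen_bounded
  have h0t : (0 : ℝ) ∈ Icc 0 t := ⟨le_rfl, ht.1⟩
  have htt : t ∈ Icc 0 t := ⟨ht.1, le_rfl⟩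
  have hsub : Icc 0 t ⊆ Icc 0 T := Icc_subset_Icc_right ht.2
  have hf : f ∈ A := hv.init ▸ hv.mem 0 (hsub h0t)
  have ends : ∀ ε > 0, ∀ c : ℝ,
      (P.op (ε * (t - 0)) (fun y => Real.exp (-1 / (2 * ε) * v 0 y + c / 2 * 0)) x
        = P.op (ε * t) (fun y => Real.exp (-f y / (2 * ε))) x) ∧
      (P.op (ε * (t - t)) (fun y => Real.exp (-1 / (2 * ε) * v t y + c / 2 * t)) x
        = Real.exp (-1 / (2 * ε) * v t x + c / 2 * t)) := by
    intro ε hε c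
    constructor
    · rw [sub_zero, hv.init]
      congr 1
      ext y
      congr 1
      ring
    · rw [sub_self, mul_zero, op_zero hA (exp_affine_mem hA (hv.mem t ht) _ _)]
  have bound : ∀ ε > 0, |P.viscousHJ ε t f x - v t x| ≤ ε * (K * t) := by
    intro ε hε
    have up : P.op (ε * t) (fun y => Real.exp (-f y / (2 * ε))) x
        ≤ Real.exp (-1 / (2 * ε) * v t x + K / 2 * t) := by
      have hd := fun r hr => hv.hasDerivWithinAt_exp_interp (c := K) hA ht hε x r hr
      have hm := monotoneOn_of_hasDerivWithinAt_nonneg (convex_Icc 0 t)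
        (fun r hr => (hd r hr).continuousWithinAt)
        (fun r hr => (hd r (interior_subset hr)).mono interior_subset)
        (fun r hr => integral_nonneg fun y => by
          have := neg_abs_le (P.gen (v r) y)
          have := hK r (hsub (interior_subset hr)) y
          have : 0 ≤ (K + P.gen (v r) y) / 2 := by linarith
          positivity)
      have := hm h0t htt ht.1
      simp only [] at this
      rwa [(ends ε hε K).1, (ends ε hε K).2] at this
    have lo : Real.exp (-1 / (2 * ε) * v t x + (-K) / 2 * t)
        ≤ P.op (ε * t) (fun y => Real.exp (-f y / (2 * ε))) x := by
      have hd := fun r hr => hv.hasDerivWithinAt_exp_interp (c := -K) hA ht hε x r hr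
      have hm := antitoneOn_of_hasDerivWithinAt_nonpos (convex_Icc 0 t)
        (fun r hr => (hd r hr).continuousWithinAt)
        (fun r hr => (hd r (interior_subset hr)).mono interior_subset)
        (fun r hr => integral_nonpos fun y => by
          have := le_abs_self (P.gen (v r) y)
          have := hK r (hsub (interior_subset hr)) y
          have : (-K + P.gen (v r) y) / 2 ≤ 0 := by linarith
          exact mul_nonpos_of_nonneg_of_nonpos (Real.exp_pos _).le this)
      have := hm h0t htt ht.1
      simp only [] at this
      rwa [(ends ε hε (-K)).1, (ends ε hε (-K)).2] at this
    have hpos := (Real.exp_pos _).trans_le lo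
    have l1 := (Real.log_le_iff_le_exp hpos).2 up
    have l2 := (Real.le_log_iff_exp_le hpos).2 lo
    rw [abs_le]
    unfold viscousHJ
    have e : ε * (-1 / (2 * ε) * v t x) = -(1 / 2) * v t x := by field_simp
    constructor <;> nlinarith [mul_le_mul_of_nonneg_left l1 hε.le,
      mul_le_mul_of_nonneg_left l2 hε.le]
  have lim : Tendsto (fun ε => P.viscousHJ ε t f x) (𝓝[>] 0) (𝓝 (v t x)) := by
    rw [tendsto_iff_dist_tendsto_zero]
    have h0 : Tendsto (fun ε : ℝ => ε * (K * t)) (𝓝[>] 0) (𝓝 0) := by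
      have hc : Continuous fun ε : ℝ => ε * (K * t) := by fun_prop
      exact (hc.tendsto' 0 0 (by simp)).mono_left nhdsWithin_le_nhds
    refine squeeze_zero' (Eventually.of_forall fun _ => dist_nonneg) ?_ h0
    filter_upwards [self_mem_nhdsWithin] with ε hε
    exact bound ε hε
  exact lim.liminf_eq

end MarkovSemigroup

/-! Both implications pass through a dimensional logarithmic Sobolev inequality for the measures
`P_u(x, dy)`.

From (i) to that inequality: for `g = e^f` and `ψ(z) = z log z`, put `Λ(s) = P_s(ψ(P_{u-s} g))(x)`
and `F = log P_{u-s} g`. Then `Λ' = P_s(e^F Γ(F))`, and to second order `Λ'' = 2 P_s(e^F Γ₂(F))`.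
With `p = P_u g(x)`, `X = P_u(L g)(x) / p` and `m = Λ'/p - X` one has `P_s(e^F L F) = -p m`, so
CD(0, n) and a Cauchy–Schwarz argument give `Λ'' ≥ (2/n) p m²`. This says that `θ(s) =
exp(-(2/n)((Λ(s) - Λ(0))/p - s X))` is concave, and comparing `θ(0) = 1` with the tangent at `u` is
the inequality (`CurvatureDimension.one_le_exp_entropy`). Bounding the logarithm by its tangent at a
free point `a > 0` makes it linear (`CurvatureDimension.entropy_le`).

From the inequality to (ii): `q ↦ (1/q) log P_{u(q)}(exp(q v^ε_{τ(q)}))` is differentiated along a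
path of exponents and times. The Hopf–Cole equation for `v^ε` and the relation `τ' = 2 (q u)'` turn
the derivative into an entropy minus an energy, and a suitable `a` cancels the energy. For `1/u`
affine in `q` the remaining bound is an exact derivative up to `O(ε)`, whose integral is the stated
constant. Fatou's lemma then removes `ε` (`op_exp_hamiltonJacobi_le`).

From (ii) to (i): comparison with a subsolution gives `Q_t f ≥ f - (t/2) Γ(f) - C t²`
(`exists_le_hamiltonJacobi`). Taking `q₂ = 1`, `q₁ = 1 + δ`, `u₁ = u + b δ` and differentiating at
`δ = 0` yields a linearized inequality with a free parameter `b` (`entropy_le_of_hypercontractive`).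
With `b` of order `u²`, its expansion at `u = 0` vanishes up to first order, and the coefficient of
`u²`, optimized over `b`, is the curvature bound (`carre2_ge_of_entropy_le`).

All derivatives of curves in the algebra are uniform in space, because a Markov kernel is a
contraction for the supremum norm and so preserves uniform remainders. -/

/-! ### Uniform expansions of curves of functions -/

section Expansions

open Asymptotics

variable {α : Type*}

/-- The curve `s ↦ W s` of functions has derivative `D` at `r` within `S`, uniformly in space. -/
def UDeriv (W : ℝ → α → ℝ) (D : α → ℝ) (S : Set ℝ) (r : ℝ) : Prop :=
  (fun p : ℝ × α => W p.1 p.2 - W r p.2 - (p.1 - r) * D p.2)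
    =o[𝓝[S] r ×ˢ (⊤ : Filter α)] fun p => p.1 - r

/-- The curve `h ↦ W h` of functions has the expansion `k₀ + h k₁ + h² k₂ + o(h²)` as `h → 0⁺`,
uniformly in space. -/
def Jet2 (W : ℝ → α → ℝ) (k₀ k₁ k₂ : α → ℝ) : Prop :=
  (fun p : ℝ × α => W p.1 p.2 - (k₀ p.2 + p.1 * k₁ p.2 + p.1 ^ 2 * k₂ p.2))
    =o[𝓝[>] (0 : ℝ) ×ˢ (⊤ : Filter α)] fun p => p.1 ^ 2

lemma eventually_prod_top {l : Filter ℝ} {p : ℝ × α → Prop} :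
    (∀ᶠ z in l ×ˢ (⊤ : Filter α), p z) ↔ ∀ᶠ s in l, ∀ y, p (s, y) := by
  rw [← principal_univ, eventually_prod_principal_iff]
  simp

lemma uDeriv_iff {W : ℝ → α → ℝ} {D : α → ℝ} {S : Set ℝ} {r : ℝ} :
    UDeriv W D S r ↔ ∀ δ > 0, ∀ᶠ s in 𝓝[S] r, ∀ y,
      |W s y - W r y - (s - r) * D y| ≤ δ * |s - r| := by
  simp only [UDeriv, isLittleO_iff, eventually_prod_top, Real.norm_eq_abs, gt_iff_lt]

lemma jet2_iff {W : ℝ → α → ℝ} {k₀ k₁ k₂ : α → ℝ} :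
    Jet2 W k₀ k₁ k₂ ↔ ∀ δ > 0, ∀ᶠ h in 𝓝[>] (0 : ℝ), ∀ y,
      |W h y - (k₀ y + h * k₁ y + h ^ 2 * k₂ y)| ≤ δ * h ^ 2 := by
  simp only [Jet2, isLittleO_iff, eventually_prod_top, Real.norm_eq_abs, gt_iff_lt, abs_pow, sq_abs]

lemma isBigO_one_of_bound {l : Filter (ℝ × α)} {f : α → ℝ} (hf : ∃ C : ℝ, ∀ x, |f x| ≤ C) :
    (fun p : ℝ × α => f p.2) =O[l] (fun _ => (1 : ℝ)) := by
  obtain ⟨C, hC⟩ := hf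
  exact IsBigO.of_bound C (Eventually.of_forall fun p => by simpa using hC p.2)

lemma tendsto_fst_sub (S : Set ℝ) (r : ℝ) :
    Tendsto (fun p : ℝ × α => p.1 - r) (𝓝[S] r ×ˢ (⊤ : Filter α)) (𝓝 0) := by
  have h : Tendsto (fun s : ℝ => s - r) (𝓝[S] r) (𝓝 0) := by
    have : Continuous fun s : ℝ => s - r := by fun_prop
    exact (this.tendsto' r 0 (by simp)).mono_left nhdsWithin_le_nhds
  exact h.comp tendsto_fst

lemma isBigO_fst_sub_one (S : Set ℝ) (r : ℝ) :
    (fun p : ℝ × α => p.1 - r) =O[𝓝[S] r ×ˢ (⊤ : Filter α)] (fun _ => (1 : ℝ)) :=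
  (tendsto_fst_sub S r).isBigO_one ℝ

lemma isLittleO_sq_fst_sub (S : Set ℝ) (r : ℝ) :
    (fun p : ℝ × α => (p.1 - r) * (p.1 - r)) =o[𝓝[S] r ×ˢ (⊤ : Filter α)] fun p => p.1 - r := by
  have h : (fun p : ℝ × α => p.1 - r) =o[𝓝[S] r ×ˢ (⊤ : Filter α)] (fun _ => (1 : ℝ)) :=
    (isLittleO_one_iff ℝ).2 (tendsto_fst_sub S r)
  simpa using h.mul_isBigO (isBigO_refl (fun p : ℝ × α => p.1 - r) _)

/-! ### Calculus of uniform first derivatives. -/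

namespace UDeriv

variable {W V : ℝ → α → ℝ} {D D' : α → ℝ} {S T : Set ℝ} {r : ℝ}

lemma sub_isBigO (h : UDeriv W D S r) (hD : ∃ C : ℝ, ∀ x, |D x| ≤ C) :
    (fun p : ℝ × α => W p.1 p.2 - W r p.2) =O[𝓝[S] r ×ˢ (⊤ : Filter α)] fun p => p.1 - r := by
  have h1 : (fun p : ℝ × α => (p.1 - r) * D p.2) =O[𝓝[S] r ×ˢ (⊤ : Filter α)]
      fun p => p.1 - r := by
    simpa using (isBigO_refl (fun p : ℝ × α => p.1 - r) _).mul (isBigO_one_of_bound hD)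
  simpa using h.isBigO.add h1

lemma of_scalar {q : ℝ → ℝ} {q' : ℝ} (hq : HasDerivWithinAt q q' S r) :
    UDeriv (fun s (_ : α) => q s) (fun _ => q') S r := by
  rw [hasDerivWithinAt_iff_isLittleO] at hq
  simpa [UDeriv, Function.comp_def] using hq.comp_tendsto (tendsto_fst (g := (⊤ : Filter α)))

lemma const (f : α → ℝ) : UDeriv (fun _ => f) (fun _ => 0) S r := by
  simp [UDeriv]

lemma add (h : UDeriv W D S r) (h' : UDeriv V D' S r) :
    UDeriv (fun s y => W s y + V s y) (fun y => D y + D' y) S r :=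
  (IsLittleO.add h h').congr_left fun p => by ring

lemma mul (h : UDeriv W D S r) (h' : UDeriv V D' S r) (hW : ∃ C : ℝ, ∀ x, |W r x| ≤ C)
    (hV : ∃ C : ℝ, ∀ x, |V r x| ≤ C)
    (hD : ∃ C : ℝ, ∀ x, |D x| ≤ C) (hD' : ∃ C : ℝ, ∀ x, |D' x| ≤ C) :
    UDeriv (fun s y => W s y * V s y) (fun y => D y * V r y + W r y * D' y) S r := by
  have h1 := IsLittleO.mul_isBigO h (isBigO_one_of_bound hV)
  have h2 := (isBigO_one_of_bound hW).mul_isLittleO h'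
  have h3 := ((h.sub_isBigO hD).mul (h'.sub_isBigO hD')).trans_isLittleO
    (isLittleO_sq_fst_sub S r)
  simp only [mul_one, one_mul] at h1 h2
  exact ((h1.add h2).add h3).congr_left fun p => by ring

lemma comp_fun {b : ℝ → ℝ} {b' : ℝ} (h : UDeriv W D T (b r)) (hb : HasDerivWithinAt b b' S r)
    (hm : MapsTo b S T) (hD : ∃ C : ℝ, ∀ x, |D x| ≤ C) :
    UDeriv (fun s => W (b s)) (fun y => b' * D y) S r := by
  have ht : Tendsto (fun p : ℝ × α => (b p.1, p.2)) (𝓝[S] r ×ˢ (⊤ : Filter α))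
      (𝓝[T] (b r) ×ˢ (⊤ : Filter α)) := by
    have : Tendsto b (𝓝[S] r) (𝓝[T] (b r)) :=
      tendsto_nhdsWithin_of_tendsto_nhds_of_eventually_within _ hb.continuousWithinAt
        (eventually_mem_nhdsWithin.mono hm)
    exact this.prodMap tendsto_id
  have h1 := IsLittleO.comp_tendsto h ht
  have h2 := UDeriv.of_scalar (α := α) hb
  have h3 : (fun p : ℝ × α => b p.1 - b r) =O[𝓝[S] r ×ˢ (⊤ : Filter α)] fun p => p.1 - r :=
    h2.sub_isBigO ⟨|b'|, fun _ => le_rfl⟩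
  have h4 := h1.trans_isBigO h3
  have h5 := IsLittleO.mul_isBigO h2 (isBigO_one_of_bound hD)
  simp only [mul_one] at h5
  exact (h4.add h5).congr_left fun p => by simp only [Function.comp]; ring

end UDeriv

/-! ### Taylor bounds with constants uniform on bounded intervals. -/

lemma abs_sub_le_of_hasDerivAt {ψ ψ' : ℝ → ℝ} {x y M : ℝ}
    (h : ∀ z ∈ uIcc x y, HasDerivAt ψ (ψ' z) z) (hM : ∀ z ∈ uIcc x y, |ψ' z| ≤ M) :
    |ψ y - ψ x| ≤ M * |y - x| :=
  (convex_uIcc x y).norm_image_sub_le_of_norm_hasDerivWithin_le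
    (fun z hz => (h z hz).hasDerivWithinAt) hM left_mem_uIcc right_mem_uIcc

lemma abs_le_of_mem_uIcc {x y z C : ℝ} (hx : |x| ≤ C) (hy : |y| ≤ C) (hz : z ∈ uIcc x y) :
    |z| ≤ C := by
  rw [abs_le] at *
  rcases mem_uIcc.1 hz with h | h <;> constructor <;> linarith [h.1, h.2]

lemma abs_sub_le_of_mem_uIcc {x y z : ℝ} (hz : z ∈ uIcc x y) : |z - x| ≤ |y - x| :=
  abs_sub_left_of_mem_uIcc hz

lemma exists_taylor_zero {φ : ℝ → ℝ} (hφ : ContDiff ℝ ∞ φ) (C : ℝ) :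
    ∃ K, 0 ≤ K ∧ ∀ x y, |x| ≤ C → |y| ≤ C → |φ y - φ x| ≤ K * |y - x| := by
  have hc : Continuous (deriv φ) := hφ.continuous_deriv (by simp)
  obtain ⟨K, hK⟩ := (isCompact_Icc (a := -C) (b := C)).exists_bound_of_continuousOn hc.continuousOn
  refine ⟨|K|, abs_nonneg _, fun x y hx hy => abs_sub_le_of_hasDerivAt
    (fun z _ => ((hφ.differentiable (by simp)) z).hasDerivAt) fun z hz => ?_⟩
  exact (hK z (abs_le.1 (abs_le_of_mem_uIcc hx hy hz))).trans (le_abs_self K)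

lemma contDiff_deriv {φ : ℝ → ℝ} (hφ : ContDiff ℝ ∞ φ) : ContDiff ℝ ∞ (deriv φ) :=
  ((contDiff_succ_iff_deriv (n := ∞)).1 (by simpa using hφ)).2.2

/-- The derivative in `z` of the remainder is the remainder of one order less for `deriv φ`, so the
mean value inequality raises the order by one. The same induction step gives the second order bound.
-/
lemma exists_taylor_one {φ : ℝ → ℝ} (hφ : ContDiff ℝ ∞ φ) (C : ℝ) :
    ∃ K, 0 ≤ K ∧ ∀ x y, |x| ≤ C → |y| ≤ C →
      |φ y - φ x - deriv φ x * (y - x)| ≤ K * |y - x| ^ 2 := by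
  obtain ⟨K, hK0, hK⟩ := exists_taylor_zero (contDiff_deriv hφ) C
  refine ⟨K, hK0, fun x y hx hy => ?_⟩
  have := abs_sub_le_of_hasDerivAt (ψ := fun z => φ z - φ x - deriv φ x * (z - x))
    (ψ' := fun z => deriv φ z - deriv φ x) (x := x) (y := y) (M := K * |y - x|)
    (fun z _ => by
      have h1 := (((hφ.differentiable (by simp)) z).hasDerivAt.sub_const (φ x)).sub
        (((hasDerivAt_id z).sub_const x).const_mul (deriv φ x))
      exact h1.congr_deriv (by simp))
    (fun z hz => (hK x z hx (abs_le_of_mem_uIcc hx hy hz)).trans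
      (mul_le_mul_of_nonneg_left (abs_sub_le_of_mem_uIcc hz) hK0))
  simp only [sub_self, mul_zero, sub_zero] at this
  linarith

lemma exists_taylor_two {φ : ℝ → ℝ} (hφ : ContDiff ℝ ∞ φ) (C : ℝ) :
    ∃ K, 0 ≤ K ∧ ∀ x y, |x| ≤ C → |y| ≤ C →
      |φ y - φ x - deriv φ x * (y - x) - deriv (deriv φ) x / 2 * (y - x) ^ 2|
        ≤ K * |y - x| ^ 3 := by
  obtain ⟨K, hK0, hK⟩ := exists_taylor_one (contDiff_deriv hφ) C
  refine ⟨K, hK0, fun x y hx hy => ?_⟩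
  have := abs_sub_le_of_hasDerivAt
    (ψ := fun z => φ z - φ x - deriv φ x * (z - x) - deriv (deriv φ) x / 2 * (z - x) ^ 2)
    (ψ' := fun z => deriv φ z - deriv φ x - deriv (deriv φ) x * (z - x)) (x := x) (y := y)
    (M := K * |y - x| ^ 2)
    (fun z _ => by
      have h1 := ((((hφ.differentiable (by simp)) z).hasDerivAt.sub_const (φ x)).sub
        (((hasDerivAt_id z).sub_const x).const_mul (deriv φ x))).sub
        ((((hasDerivAt_id z).sub_const x).pow 2).const_mul (deriv (deriv φ) x / 2))
      refine h1.congr_deriv ?_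
      simp
      ring)
    (fun z hz => (hK x z hx (abs_le_of_mem_uIcc hx hy hz)).trans
      (mul_le_mul_of_nonneg_left (pow_le_pow_left₀ (abs_nonneg _) (abs_sub_le_of_mem_uIcc hz) 2)
        hK0))
  simp only [sub_self, mul_zero, sub_zero, ne_eq, OfNat.ofNat_ne_zero, not_false_eq_true,
    zero_pow] at this
  linarith

lemma exists_bound_comp {φ : ℝ → ℝ} (hφ : Continuous φ) {f : α → ℝ}
    (hf : ∃ C : ℝ, ∀ x, |f x| ≤ C) : ∃ C : ℝ, ∀ x, |φ (f x)| ≤ C := by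
  obtain ⟨C, hC⟩ := hf
  obtain ⟨K, hK⟩ := (isCompact_Icc (a := -C) (b := C)).exists_bound_of_continuousOn hφ.continuousOn
  exact ⟨K, fun x => hK _ (abs_le.1 (hC x))⟩

lemma UDeriv.comp {W : ℝ → α → ℝ} {D : α → ℝ} {S : Set ℝ} {r : ℝ} (h : UDeriv W D S r)
    {φ : ℝ → ℝ} (hφ : ContDiff ℝ ∞ φ)
    (hW : ∃ C : ℝ, ∀ x, |W r x| ≤ C) (hD : ∃ C : ℝ, ∀ x, |D x| ≤ C) :
    UDeriv (fun s y => φ (W s y)) (fun y => deriv φ (W r y) * D y) S r := by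
  have hO := h.sub_isBigO hD
  have h0 := hO.trans_tendsto (tendsto_fst_sub S r)
  have hb := exists_bound_comp (contDiff_deriv hφ).continuous hW
  obtain ⟨C, hC⟩ := hW
  -- Near `r` the values `W s` stay within distance 1 of `W r`, hence in `[-(C + 1), C + 1]`.
  obtain ⟨K, hK0, hK⟩ := exists_taylor_one hφ (C + 1)
  have h1 : (fun p : ℝ × α => φ (W p.1 p.2) - φ (W r p.2)
      - deriv φ (W r p.2) * (W p.1 p.2 - W r p.2)) =O[𝓝[S] r ×ˢ (⊤ : Filter α)]
      fun p => (W p.1 p.2 - W r p.2) * (W p.1 p.2 - W r p.2) := by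
    refine IsBigO.of_bound K ?_
    filter_upwards [(Metric.tendsto_nhds.1 h0) 1 one_pos] with p hp
    rw [dist_zero_right, Real.norm_eq_abs] at hp
    have := abs_add_le (W p.1 p.2 - W r p.2) (W r p.2)
    rw [sub_add_cancel] at this
    have e := hK (W r p.2) (W p.1 p.2) (by linarith [hC p.2]) (by linarith [hC p.2])
    rw [Real.norm_eq_abs, norm_mul, Real.norm_eq_abs, ← pow_two]
    exact e
  have h2 := (h1.trans (hO.mul hO)).trans_isLittleO (isLittleO_sq_fst_sub S r)
  have h3 := (isBigO_one_of_bound hb).mul_isLittleO h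
  simp only [one_mul] at h3
  exact (h2.add h3).congr_left fun p => by ring

/-! ### Calculus of uniform second order expansions. -/

namespace Jet2

variable {W V : ℝ → α → ℝ} {k₀ k₁ k₂ j₀ j₁ j₂ : α → ℝ}

lemma fst_isBigO_one :
    (fun p : ℝ × α => p.1) =O[𝓝[>] (0 : ℝ) ×ˢ (⊤ : Filter α)] (fun _ => (1 : ℝ)) := by
  simpa using isBigO_fst_sub_one (α := α) (Ioi 0) 0

lemma fst_isLittleO_one :
    (fun p : ℝ × α => p.1) =o[𝓝[>] (0 : ℝ) ×ˢ (⊤ : Filter α)] (fun _ => (1 : ℝ)) := by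
  simpa using (isLittleO_one_iff ℝ).2 (tendsto_fst_sub (α := α) (Ioi 0) 0)

lemma sq_isBigO_fst :
    (fun p : ℝ × α => p.1 ^ 2) =O[𝓝[>] (0 : ℝ) ×ˢ (⊤ : Filter α)] fun p => p.1 := by
  simpa [pow_two] using (isLittleO_sq_fst_sub (α := α) (Ioi 0) 0).isBigO

lemma sub_isBigO (h : Jet2 W k₀ k₁ k₂) (h₁ : ∃ C : ℝ, ∀ x, |k₁ x| ≤ C)
    (h₂ : ∃ C : ℝ, ∀ x, |k₂ x| ≤ C) :
    (fun p : ℝ × α => W p.1 p.2 - k₀ p.2) =O[𝓝[>] (0 : ℝ) ×ˢ (⊤ : Filter α)] fun p => p.1 := by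
  have e1 : (fun p : ℝ × α => p.1 * k₁ p.2) =O[𝓝[>] (0 : ℝ) ×ˢ (⊤ : Filter α)]
      fun p => p.1 := by
    simpa using (isBigO_refl (fun p : ℝ × α => p.1) _).mul (isBigO_one_of_bound h₁)
  have e2 : (fun p : ℝ × α => p.1 ^ 2 * k₂ p.2) =O[𝓝[>] (0 : ℝ) ×ˢ (⊤ : Filter α)]
      fun p => p.1 := by
    simpa using sq_isBigO_fst.mul (isBigO_one_of_bound h₂)
  exact (((h.isBigO.trans sq_isBigO_fst).add e1).add e2).congr_left fun p => by ring

lemma congr (h : Jet2 W k₀ k₁ k₂) (hW : ∀ᶠ s in 𝓝[>] (0 : ℝ), ∀ y, V s y = W s y)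
    (h₀ : ∀ y, j₀ y = k₀ y) (h₁ : ∀ y, j₁ y = k₁ y) (h₂ : ∀ y, j₂ y = k₂ y) :
    Jet2 V j₀ j₁ j₂ := by
  refine IsLittleO.congr' h ?_ EventuallyEq.rfl
  have := (eventually_prod_top (α := α) (p := fun z => V z.1 z.2 = W z.1 z.2)).2 hW
  filter_upwards [this] with p hp
  rw [hp, h₀, h₁, h₂]

lemma const (k : α → ℝ) : Jet2 (fun _ => k) k (fun _ => 0) (fun _ => 0) := by
  simp [Jet2]

lemma fst : Jet2 (fun h (_ : α) => h) (fun _ => 0) (fun _ => 1) (fun _ => 0) := by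
  simp [Jet2]

lemma add (h : Jet2 W k₀ k₁ k₂) (h' : Jet2 V j₀ j₁ j₂) :
    Jet2 (fun s y => W s y + V s y) (fun y => k₀ y + j₀ y) (fun y => k₁ y + j₁ y)
      (fun y => k₂ y + j₂ y) :=
  (IsLittleO.add h h').congr_left fun p => by ring

lemma mul (h : Jet2 W k₀ k₁ k₂) (h' : Jet2 V j₀ j₁ j₂)
    (hk₀ : ∃ C : ℝ, ∀ x, |k₀ x| ≤ C) (hk₁ : ∃ C : ℝ, ∀ x, |k₁ x| ≤ C)
    (hk₂ : ∃ C : ℝ, ∀ x, |k₂ x| ≤ C) (hj₀ : ∃ C : ℝ, ∀ x, |j₀ x| ≤ C)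
    (hj₁ : ∃ C : ℝ, ∀ x, |j₁ x| ≤ C) (hj₂ : ∃ C : ℝ, ∀ x, |j₂ x| ≤ C) :
    Jet2 (fun s y => W s y * V s y) (fun y => k₀ y * j₀ y)
      (fun y => k₁ y * j₀ y + k₀ y * j₁ y)
      (fun y => k₂ y * j₀ y + k₁ y * j₁ y + k₀ y * j₂ y) := by
  have hV : (fun p : ℝ × α => V p.1 p.2) =O[𝓝[>] (0 : ℝ) ×ˢ (⊤ : Filter α)]
      (fun _ => (1 : ℝ)) := by
    simpa using ((h'.sub_isBigO hj₁ hj₂).trans fst_isBigO_one).add (isBigO_one_of_bound hj₀)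
  -- With `K`, `J` the two expansions, the remainder of the product is `(W - K) V + (k₀ + h k₁)(V -
  -- J) + h³ k₁ j₂ + h² k₂ (V - j₀)`, and each term is `o(h²)`.
  have e1 := IsLittleO.mul_isBigO h hV
  have e2 := (isBigO_one_of_bound hk₀).mul_isLittleO h'
  have e3 := (isBigO_one_of_bound hk₁).mul_isLittleO
    ((isBigO_refl (fun p : ℝ × α => p.1) (𝓝[>] (0 : ℝ) ×ˢ (⊤ : Filter α))).mul_isLittleO h')
  have o3 : (fun p : ℝ × α => p.1 * p.1 ^ 2) =o[𝓝[>] (0 : ℝ) ×ˢ (⊤ : Filter α)]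
      fun p => p.1 ^ 2 := by
    simpa using fst_isLittleO_one.mul_isBigO (isBigO_refl (fun p : ℝ × α => p.1 ^ 2) _)
  have e5 := (isBigO_one_of_bound hk₁).mul_isLittleO ((isBigO_one_of_bound hj₂).mul_isLittleO o3)
  have e6 := ((isBigO_one_of_bound hk₂).mul_isLittleO
    (((h'.sub_isBigO hj₁ hj₂).trans_isLittleO fst_isLittleO_one).mul_isBigO
      (isBigO_refl (fun p : ℝ × α => p.1 ^ 2) _)))
  simp only [one_mul, mul_one] at e1 e2 e3 e5 e6
  have e3' := e3.trans_isBigO o3.isBigO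
  exact (((((e1.add e2).add e3').add e5).add e6)).congr_left fun p => by ring

lemma comp (h : Jet2 W k₀ k₁ k₂) {φ : ℝ → ℝ} (hφ : ContDiff ℝ ∞ φ)
    (hk₀ : ∃ C : ℝ, ∀ x, |k₀ x| ≤ C) (hk₁ : ∃ C : ℝ, ∀ x, |k₁ x| ≤ C)
    (hk₂ : ∃ C : ℝ, ∀ x, |k₂ x| ≤ C) :
    Jet2 (fun s y => φ (W s y)) (fun y => φ (k₀ y)) (fun y => deriv φ (k₀ y) * k₁ y)
      (fun y => deriv φ (k₀ y) * k₂ y + deriv (deriv φ) (k₀ y) / 2 * k₁ y ^ 2) := by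
  have hO := h.sub_isBigO hk₁ hk₂
  have hO1 := hO.trans_isLittleO fst_isLittleO_one
  have h0 := (isLittleO_one_iff ℝ).1 hO1
  have hb := exists_bound_comp (contDiff_deriv hφ).continuous hk₀
  have hb' := exists_bound_comp (contDiff_deriv (contDiff_deriv hφ)).continuous hk₀
  have b0 := hk₀
  obtain ⟨C, hC⟩ := b0
  obtain ⟨K, hK0, hK⟩ := exists_taylor_two hφ (C + 1)
  have h1 : (fun p : ℝ × α => φ (W p.1 p.2) - φ (k₀ p.2) - deriv φ (k₀ p.2) * (W p.1 p.2 - k₀ p.2)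
      - deriv (deriv φ) (k₀ p.2) / 2 * (W p.1 p.2 - k₀ p.2) ^ 2)
      =O[𝓝[>] (0 : ℝ) ×ˢ (⊤ : Filter α)]
      fun p => (W p.1 p.2 - k₀ p.2) * (W p.1 p.2 - k₀ p.2) ^ 2 := by
    refine IsBigO.of_bound K ?_
    filter_upwards [(Metric.tendsto_nhds.1 h0) 1 one_pos] with p hp
    rw [dist_zero_right, Real.norm_eq_abs] at hp
    have := abs_add_le (W p.1 p.2 - k₀ p.2) (k₀ p.2)
    rw [sub_add_cancel] at this
    have e := hK (k₀ p.2) (W p.1 p.2) (by linarith [hC p.2]) (by linarith [hC p.2])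
    rw [Real.norm_eq_abs, ← pow_succ', norm_pow, Real.norm_eq_abs]
    exact e
  have h2 := h1.trans_isLittleO (hO1.mul_isBigO (hO.pow 2))
  simp only [one_mul] at h2
  have h3 := (isBigO_one_of_bound hb).mul_isLittleO h
  have hk1O : (fun p : ℝ × α => p.1 * k₁ p.2) =O[𝓝[>] (0 : ℝ) ×ˢ (⊤ : Filter α)]
      fun p => p.1 := by
    simpa using (isBigO_refl (fun p : ℝ × α => p.1) _).mul (isBigO_one_of_bound hk₁)
  have hk2o : (fun p : ℝ × α => p.1 ^ 2 * k₂ p.2) =o[𝓝[>] (0 : ℝ) ×ˢ (⊤ : Filter α)]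
      fun p => p.1 := by
    have := (fst_isLittleO_one.mul_isBigO
      (isBigO_refl (fun p : ℝ × α => p.1) _)).mul_isBigO (isBigO_one_of_bound hk₂)
    simpa [pow_two] using this
  have ho : (fun p : ℝ × α => p.1 ^ 2) =o[𝓝[>] (0 : ℝ) ×ˢ (⊤ : Filter α)] fun p => p.1 := by
    simpa [pow_two] using isLittleO_sq_fst_sub (α := α) (Ioi 0) 0
  have hlin : (fun p : ℝ × α => W p.1 p.2 - k₀ p.2 - p.1 * k₁ p.2)
      =o[𝓝[>] (0 : ℝ) ×ˢ (⊤ : Filter α)] fun p => p.1 :=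
    ((h.trans ho).add hk2o).congr_left fun p => by ring
  -- The quadratic Taylor term may be evaluated on `h k₁` instead of `W - k₀`: the difference of the
  -- squares is the product of an `o(h)` and an `O(h)`.
  have h4 := (isBigO_one_of_bound hb').mul_isLittleO (hlin.mul_isBigO (hO.add hk1O))
  simp only [one_mul, ← pow_two] at h3 h4
  exact ((h2.add h3).add (h4.const_mul_left (1 / 2))).congr_left fun p => by ring

/-- Second order Taylor expansion from a first order expansion of the derivative. -/
lemma of_deriv {W' : ℝ → α → ℝ} {T : ℝ} (hT : 0 < T)
    (hW : ∀ y, ∀ h ∈ Icc 0 T, HasDerivWithinAt (fun s => W s y) (W' h y) (Icc 0 T) h)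
    (hV : ∀ δ > 0, ∀ᶠ h in 𝓝[≥] (0 : ℝ), ∀ y, |W' h y - k₁ y - h * k₂ y| ≤ δ * h) :
    Jet2 W (W 0) k₁ (fun y => k₂ y / 2) := by
  rw [jet2_iff]
  intro δ hδ
  obtain ⟨η, hη, hη'⟩ := mem_nhdsGE_iff_exists_Ico_subset.1 (hV δ hδ)
  have hη : 0 < η := hη
  filter_upwards [Ioo_mem_nhdsGT (lt_min hT hη)] with h hh y
  have hhT : h < T := hh.2.trans_le (min_le_left _ _)
  have hhη : h < η := hh.2.trans_le (min_le_right _ _)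
  have hsub : Icc 0 h ⊆ Icc 0 T := Icc_subset_Icc_right hhT.le
  have := norm_image_sub_le_of_norm_deriv_le_segment'
    (f := fun s => W s y - (s * k₁ y + s ^ 2 * (k₂ y / 2)))
    (f' := fun s => W' s y - k₁ y - s * k₂ y) (a := 0) (b := h) (C := δ * h)
    (fun s hs => by
      have h1 := ((hW y s (hsub hs)).mono hsub).sub
        (((hasDerivWithinAt_id s (Icc 0 h)).mul_const (k₁ y)).add
          (((hasDerivWithinAt_id s (Icc 0 h)).pow 2).mul_const (k₂ y / 2)))
      refine h1.congr_deriv ?_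
      simp
      ring)
    (fun s hs => (hη' ⟨hs.1, hs.2.trans hhη⟩ y).trans (by nlinarith [hs.1, hs.2]))
    h ⟨hh.1.le, le_rfl⟩
  rw [Real.norm_eq_abs] at this
  refine (le_of_eq ?_).trans (this.trans (le_of_eq ?_))
  · congr 1; ring
  · ring

end Jet2

end Expansions

namespace MarkovSemigroup

variable {E : Type*} [MeasurableSpace E] {P : MarkovSemigroup E} {A : Subalgebra ℝ (E → ℝ)}

/-! ### Calculus for the generator and the carré du champ -/

lemma hasDerivWithinAt_gen (hA : P.IsDiffusionAlgebra A) {f : E → ℝ} (hf : f ∈ A) (x : E) :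
    HasDerivWithinAt (fun t => P.op t f x) (P.gen f x) (Ici 0) 0 := by
  have := hasDerivWithinAt_op hA hf le_rfl x
  rwa [op_zero hA (hA.gen_mem f hf)] at this

lemma gen_eq_of_hasDerivWithinAt {f : E → ℝ} {x : E} {c : ℝ}
    (h : HasDerivWithinAt (fun t => P.op t f x) c (Ici 0) 0) : P.gen f x = c :=
  h.derivWithin (uniqueDiffOn_Ici 0 0 self_mem_Ici)

lemma op_add_fun (hA : P.IsDiffusionAlgebra A) {f g : E → ℝ} (hf : f ∈ A) (hg : g ∈ A) {t : ℝ}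
    (ht : 0 ≤ t) (x : E) : P.op t (fun y => f y + g y) x = P.op t f x + P.op t g x :=
  integral_add (hA.integrable hf ht x) (hA.integrable hg ht x)

lemma op_mono (hA : P.IsDiffusionAlgebra A) {f g : E → ℝ} (hf : f ∈ A) (hg : g ∈ A) {t : ℝ}
    (ht : 0 ≤ t) (x : E) (h : ∀ y, f y ≤ g y) : P.op t f x ≤ P.op t g x :=
  integral_mono (hA.integrable hf ht x) (hA.integrable hg ht x) h

lemma op_const (P : MarkovSemigroup E) (c : ℝ) {t : ℝ} (ht : 0 ≤ t) (x : E) :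
    P.op t (fun _ => c) x = c := by
  have := P.isMarkov t ht
  simp [op]

lemma const_mem {α : Type*} (A : Subalgebra ℝ (α → ℝ)) (c : ℝ) : (fun _ => c : α → ℝ) ∈ A :=
  A.algebraMap_mem c

lemma gen_add (hA : P.IsDiffusionAlgebra A) {f g : E → ℝ} (hf : f ∈ A) (hg : g ∈ A) (x : E) :
    P.gen (fun y => f y + g y) x = P.gen f x + P.gen g x :=
  gen_eq_of_hasDerivWithinAt <|
    ((hasDerivWithinAt_gen hA hf x).add (hasDerivWithinAt_gen hA hg x)).congr
      (fun _ ht => op_add_fun hA hf hg ht x) (op_add_fun hA hf hg le_rfl x)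

lemma gen_const_mul (hA : P.IsDiffusionAlgebra A) {f : E → ℝ} (hf : f ∈ A) (c : ℝ) (x : E) :
    P.gen (fun y => c * f y) x = c * P.gen f x :=
  gen_eq_of_hasDerivWithinAt <|
    ((hasDerivWithinAt_gen hA hf x).const_mul c).congr
      (fun _ _ => P.op_smul c f _ x) (P.op_smul c f _ x)

lemma gen_const (P : MarkovSemigroup E) (c : ℝ) (x : E) : P.gen (fun _ => c) x = 0 :=
  gen_eq_of_hasDerivWithinAt <| (hasDerivWithinAt_const (0 : ℝ) (Ici 0) c).congr
    (fun _ ht => P.op_const c ht x) (P.op_const c le_rfl x)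

/-- The generator commutes with the semigroup. -/
lemma gen_op (hA : P.IsDiffusionAlgebra A) {f : E → ℝ} (hf : f ∈ A) {t : ℝ} (ht : 0 ≤ t) :
    P.gen (P.op t f) = P.op t (P.gen f) := by
  ext x
  refine gen_eq_of_hasDerivWithinAt ?_
  have h0 : HasDerivWithinAt (fun s : ℝ => s + t) 1 (Ici 0) 0 :=
    (hasDerivWithinAt_id 0 _).add_const t
  have hm : MapsTo (fun s : ℝ => s + t) (Ici 0) (Ici 0) := fun s hs =>
    mem_Ici.2 (add_nonneg hs ht)
  have h1 : HasDerivWithinAt (fun r => P.op r f x) (P.op t (P.gen f) x) (Ici 0) (0 + t) := by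
    rw [zero_add]; exact hasDerivWithinAt_op hA hf ht x
  have h2 := h1.comp 0 h0 hm
  rw [mul_one] at h2
  exact h2.congr (fun s hs => (op_add hA hf hs ht x).symm) (op_add hA hf le_rfl ht x).symm

lemma gen_mul (P : MarkovSemigroup E) (f g : E → ℝ) (x : E) :
    P.gen (fun y => f y * g y) x = f x * P.gen g x + g x * P.gen f x + 2 * P.carre f g x := by
  simp only [carre]; ring

lemma carre_comm (P : MarkovSemigroup E) (f g : E → ℝ) : P.carre f g = P.carre g f := by
  ext x
  simp only [carre]
  rw [show (fun y => f y * g y) = fun y => g y * f y from funext fun y => mul_comm _ _]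
  ring

lemma carre_add_right (hA : P.IsDiffusionAlgebra A) {f g h : E → ℝ} (hf : f ∈ A) (hg : g ∈ A)
    (hh : h ∈ A) (x : E) : P.carre f (fun y => g y + h y) x = P.carre f g x + P.carre f h x := by
  have e : (fun y => f y * (g y + h y)) = fun y => f y * g y + f y * h y :=
    funext fun y => mul_add _ _ _
  have e1 := gen_add hA (A.mul_mem hf hg) (A.mul_mem hf hh) x
  simp only [Pi.mul_apply] at e1
  change _ = P.gen (fun y => f y * g y) x + P.gen (fun y => f y * h y) x at e1
  simp only [carre]
  rw [e, e1, gen_add hA hg hh]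
  ring

lemma carre_const_mul_right (hA : P.IsDiffusionAlgebra A) {f g : E → ℝ} (hf : f ∈ A) (hg : g ∈ A)
    (c : ℝ) (x : E) : P.carre f (fun y => c * g y) x = c * P.carre f g x := by
  have e : (fun y => f y * (c * g y)) = fun y => c * (f y * g y) :=
    funext fun y => by ring
  have e1 := gen_const_mul hA (A.mul_mem hf hg) c x
  change P.gen (fun y => c * (f y * g y)) x = c * P.gen (fun y => f y * g y) x at e1
  simp only [carre]
  rw [e, e1, gen_const_mul hA hg]
  ring

lemma carre_add_left (hA : P.IsDiffusionAlgebra A) {f g h : E → ℝ} (hf : f ∈ A) (hg : g ∈ A)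
    (hh : h ∈ A) (x : E) : P.carre (fun y => g y + h y) f x = P.carre g f x + P.carre h f x := by
  rw [carre_comm P _ f, carre_comm P _ f, carre_comm P _ f, carre_add_right hA hf hg hh]

lemma carre_const_mul_left (hA : P.IsDiffusionAlgebra A) {f g : E → ℝ} (hf : f ∈ A) (hg : g ∈ A)
    (c : ℝ) (x : E) : P.carre (fun y => c * g y) f x = c * P.carre g f x := by
  rw [carre_comm P _ f, carre_comm P _ f, carre_const_mul_right hA hf hg]

/-- Differentiate at `t = 0` the nonnegative quantity `P_t((f - f(x))²)(x)`, which vanishes at `t =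
0`; its derivative there is `2 Γ(f)(x)`. -/
lemma carre_self_nonneg (hA : P.IsDiffusionAlgebra A) {f : E → ℝ} (hf : f ∈ A) (x : E) :
    0 ≤ P.carre f f x := by
  have h1 := hasDerivWithinAt_gen hA (A.mul_mem hf hf) x
  have h2 := (h1.sub ((hasDerivWithinAt_gen hA hf x).const_mul (2 * f x))).mono Ioi_subset_Ici_self
  rw [hasDerivWithinAt_iff_tendsto_slope' self_notMem_Ioi] at h2
  have h3 := ge_of_tendsto (b := 0) h2 ?_
  · have e : P.gen (f * f) x = f x * P.gen f x + f x * P.gen f x + 2 * P.carre f f x :=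
      P.gen_mul f f x
    rw [e] at h3
    linarith
  filter_upwards [self_mem_nhdsWithin] with t ht
  have ht : 0 < t := ht
  have e0 : P.op 0 (f * f) x = f x * f x := by rw [op_zero hA (A.mul_mem hf hf)]; rfl
  have e1 : 0 ≤ P.op t (fun y => (f * f) y - (2 * f x) * f y + (f x) ^ 2) x :=
    integral_nonneg fun y => by
      simp only [Pi.mul_apply, Pi.zero_apply]
      nlinarith [sq_nonneg (f y - f x)]
  have m2 : (fun y => 2 * f x * f y) ∈ A := A.smul_mem hf (2 * f x)
  rw [op_add_fun hA (f := fun y => (f * f) y - 2 * f x * f y)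
    (A.sub_mem (A.mul_mem hf hf) m2) (const_mem A _) ht.le, op_sub hA (A.mul_mem hf hf) m2 ht.le,
    P.op_smul, P.op_const _ ht.le] at e1
  simp only [slope, vsub_eq_sub, smul_eq_mul, Pi.sub_apply]
  rw [e0, op_zero hA hf]
  refine mul_nonneg (inv_nonneg.2 (by linarith)) ?_
  linarith

/-- Degenerate case of the Cauchy–Schwarz inequality: `Γ(f + s g) ≥ 0` at `x` for every real `s`,
while the term without `s` vanishes. -/
lemma carre_eq_zero_of_self (hA : P.IsDiffusionAlgebra A) {f g : E → ℝ} (hf : f ∈ A) (hg : g ∈ A)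
    {x : E} (h : P.carre f f x = 0) : P.carre f g x = 0 := by
  have key : ∀ s : ℝ, 0 ≤ 2 * s * P.carre f g x + s ^ 2 * P.carre g g x := by
    intro s
    have hsg : (fun y => s * g y) ∈ A := A.smul_mem hg s
    have hfs : (fun y => f y + s * g y) ∈ A := A.add_mem hf hsg
    have := carre_self_nonneg hA hfs x
    rw [carre_add_right hA hfs hf hsg, carre_add_left hA hf hf hsg, carre_add_left hA hsg hf hsg,
      carre_const_mul_left hA hf hg, carre_const_mul_left hA hsg hg, carre_const_mul_right hA hf hg,
      carre_const_mul_right hA hg hg, h, carre_comm P g f] at this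
    linarith
  have hb := carre_self_nonneg hA hg x
  set a := P.carre f g x
  set b := P.carre g g x
  -- The minimizer would be `-a / b`; the shift by 1 also covers `b = 0`.
  have := key (-a / (b + 1))
  have hb1 : 0 < b + 1 := by linarith
  have e : 2 * (-a / (b + 1)) * a + (-a / (b + 1)) ^ 2 * b
      = -(a ^ 2 * (b + 2)) / (b + 1) ^ 2 := by field_simp; ring
  rw [e, le_div_iff₀ (by positivity)] at this
  have : a ^ 2 ≤ 0 := by nlinarith [sq_nonneg a]
  exact pow_eq_zero_iff (two_ne_zero) |>.1 (le_antisymm this (sq_nonneg a))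

/-- The diffusion property gives `L` of both `φ(f)` and `φ(f)²`, which is all that `Γ(φ(f))`
involves. -/
lemma carre_comp_self (hA : P.IsDiffusionAlgebra A) {f : E → ℝ} (hf : f ∈ A) {φ : ℝ → ℝ}
    (hφ : ContDiff ℝ ∞ φ) (x : E) :
    P.carre (fun y => φ (f y)) (fun y => φ (f y)) x = deriv φ (f x) ^ 2 * P.carre f f x := by
  have d1 : ∀ z, HasDerivAt φ (deriv φ z) z := fun z =>
    ((hφ.differentiable (by simp)) z).hasDerivAt
  have d2 : ∀ z, HasDerivAt (deriv φ) (deriv (deriv φ) z) z := fun z =>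
    (((contDiff_deriv hφ).differentiable (by simp)) z).hasDerivAt
  have e1 : deriv (fun z => φ z * φ z) = fun z => deriv φ z * φ z + φ z * deriv φ z :=
    funext fun z => ((d1 z).mul (d1 z)).deriv
  have e2 : deriv (fun z => deriv φ z * φ z + φ z * deriv φ z) (f x)
      = (deriv (deriv φ) (f x) * φ (f x) + deriv φ (f x) * deriv φ (f x))
        + (deriv φ (f x) * deriv φ (f x) + φ (f x) * deriv (deriv φ) (f x)) :=
    (((d2 _).mul (d1 _)).add ((d1 _).mul (d2 _))).deriv
  have h1 := hA.diffusion f hf φ hφ x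
  have h2 := hA.diffusion f hf (fun z => φ z * φ z) (hφ.mul hφ) x
  rw [e1, e2] at h2
  rw [carre, h1, h2]
  ring

/-- The chain rule for the carré du champ. -/
lemma carre_comp (hA : P.IsDiffusionAlgebra A) {f g : E → ℝ} (hf : f ∈ A) (hg : g ∈ A)
    {φ : ℝ → ℝ} (hφ : ContDiff ℝ ∞ φ) (x : E) :
    P.carre (fun y => φ (f y)) g x = deriv φ (f x) * P.carre f g x := by
  set c := deriv φ (f x)
  -- Subtracting the linear part of `φ` at `f x` leaves a function of `f` whose carré du champ
  -- vanishes at `x`, and which is therefore orthogonal to every `g` there.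
  have hψ : ContDiff ℝ ∞ fun z => φ z + (-c) * z := hφ.add (contDiff_const.mul contDiff_id)
  have hd : deriv (fun z => φ z + (-c) * z) (f x) = 0 := by
    have := (((hφ.differentiable (by simp)) (f x)).hasDerivAt.add
      ((hasDerivAt_id (f x)).const_mul (-c))).deriv
    rw [mul_one] at this
    exact this.trans (add_neg_cancel c)
  have h0 : P.carre (fun y => φ (f y) + (-c) * f y) (fun y => φ (f y) + (-c) * f y) x = 0 := by
    have := carre_comp_self hA hf hψ x
    rw [hd] at this
    simpa using this
  have h1 := carre_eq_zero_of_self hA (hA.comp_mem f hf _ hψ) hg h0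
  have hcf : (fun y => -c * f y) ∈ A := A.smul_mem hf (-c)
  rw [carre_add_left hA hg (hA.comp_mem f hf φ hφ) hcf, carre_const_mul_left hA hg hf] at h1
  linarith

/-- The carré du champ is a derivation. -/
lemma carre_mul_right (hA : P.IsDiffusionAlgebra A) {f g h : E → ℝ} (hf : f ∈ A) (hg : g ∈ A)
    (hh : h ∈ A) (x : E) :
    P.carre f (fun y => g y * h y) x = g x * P.carre f h x + h x * P.carre f g x := by
  -- The product rule follows by polarization from the chain rule for squares.
  have sq : ∀ k ∈ A, P.carre f (fun y => k y ^ 2) x = 2 * k x * P.carre f k x := by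
    intro k hk
    rw [carre_comm P f, carre_comp hA hk hf (φ := fun z => z ^ 2) (by fun_prop), carre_comm P k]
    simp
  have hgh : (fun y => g y * h y) ∈ A := A.mul_mem hg hh
  have m1 : (fun y => g y ^ 2) ∈ A := A.pow_mem hg 2
  have m2 : (fun y => h y ^ 2) ∈ A := A.pow_mem hh 2
  have hs : (fun y => g y + h y) ∈ A := A.add_mem hg hh
  have m3 : (fun y => 2 * (g y * h y)) ∈ A := A.smul_mem hgh 2
  have m4 : (fun y => g y ^ 2 + h y ^ 2) ∈ A := A.add_mem m1 m2
  have e := sq _ hs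
  rw [show (fun y => (g y + h y) ^ 2) = fun y => (g y ^ 2 + h y ^ 2) + 2 * (g y * h y) from
    funext fun y => by ring, carre_add_right hA hf m4 m3,
    carre_add_right hA hf m1 m2, carre_const_mul_right hA hf hgh, sq g hg, sq h hh,
    carre_add_right hA hf hg hh] at e
  linarith

lemma exp_mem (hA : P.IsDiffusionAlgebra A) {f : E → ℝ} (hf : f ∈ A) :
    (fun y => Real.exp (f y)) ∈ A := hA.comp_mem f hf Real.exp Real.contDiff_exp

lemma gen_exp (hA : P.IsDiffusionAlgebra A) {f : E → ℝ} (hf : f ∈ A) (x : E) :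
    P.gen (fun y => Real.exp (f y)) x
      = Real.exp (f x) * (P.gen f x + P.carre f f x) := by
  rw [hA.diffusion f hf Real.exp Real.contDiff_exp x]
  simp only [Real.deriv_exp]
  ring

lemma carre_exp_left (hA : P.IsDiffusionAlgebra A) {f g : E → ℝ} (hf : f ∈ A) (hg : g ∈ A)
    (x : E) : P.carre (fun y => Real.exp (f y)) g x = Real.exp (f x) * P.carre f g x := by
  rw [carre_comp hA hf hg Real.contDiff_exp]
  simp only [Real.deriv_exp]

/-- `L(e^f f) = e^f Γ(f) + (1 + f) L e^f`. -/
lemma gen_exp_mul_self (hA : P.IsDiffusionAlgebra A) {f : E → ℝ} (hf : f ∈ A) (x : E) :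
    P.gen (fun y => Real.exp (f y) * f y) x
      = Real.exp (f x) * P.carre f f x + (1 + f x) * P.gen (fun y => Real.exp (f y)) x := by
  rw [gen_mul, carre_exp_left hA hf hf, gen_exp hA hf]
  ring

/-- The second order identity behind the entropic curvature bound, for `g = e^f`. -/
lemma carre2_exp (hA : P.IsDiffusionAlgebra A) {f : E → ℝ} (hf : f ∈ A) (x : E) :
    P.gen (fun y => Real.exp (f y) * P.carre f f y) x
        - P.gen f x * P.gen (fun y => Real.exp (f y)) x
        - 2 * P.carre f (P.gen fun y => Real.exp (f y)) x
        + P.gen (fun y => Real.exp (f y)) x ^ 2 / Real.exp (f x)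
      = 2 * Real.exp (f x) * P.carre2 f x := by
  have hG := carre_mem hA hf hf
  have hL := hA.gen_mem f hf
  have hg := exp_mem hA hf
  have e : (P.gen fun y => Real.exp (f y))
      = fun y => Real.exp (f y) * (P.gen f y + P.carre f f y) := funext (gen_exp hA hf)
  have e1 : P.carre f (fun y => Real.exp (f y) * (P.gen f y + P.carre f f y)) x
      = Real.exp (f x) * (P.carre f (P.gen f) x + P.carre f (P.carre f f) x)
        + (P.gen f x + P.carre f f x) * (Real.exp (f x) * P.carre f f x) := by
    have hLG : (fun y => P.gen f y + P.carre f f y) ∈ A := A.add_mem hL hG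
    rw [carre_mul_right hA hf hg hLG, carre_comm P f (fun y => Real.exp (f y)),
      carre_exp_left hA hf hf]
    rw [carre_add_right hA hf hL hG]
  rw [e, e1, gen_mul, carre_exp_left hA hf hG, gen_exp hA hf, carre2]
  have := (Real.exp_pos (f x)).ne'
  field_simp
  ring

/-! ### Smooth extensions of the logarithm -/

/-- The algebra is stable only under functions smooth on the whole line. As `P_t e^f` is bounded
below by a positive constant, the logarithm may be cut off near 0. -/
lemma exists_contDiff_eq_log {c : ℝ} (hc : 0 < c) :
    ∃ φ : ℝ → ℝ, ContDiff ℝ ∞ φ ∧ ∀ z, c < z → φ z = Real.log z := by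
  refine ⟨fun z => Real.smoothTransition ((2 * z - c) / c) * Real.log z, ?_, fun z hz => ?_⟩
  · rw [contDiff_iff_contDiffAt]
    intro z
    rcases lt_or_ge (c / 4) z with h | h
    · refine ContDiffAt.mul ?_ (Real.contDiffAt_log.2 (by linarith))
      exact (Real.smoothTransition.contDiff.comp (by fun_prop)).contDiffAt
    · refine (contDiffAt_const (c := (0 : ℝ))).congr_of_eventuallyEq ?_
      filter_upwards [Iio_mem_nhds (show z < c / 2 by linarith)] with y hy
      have hy : y < c / 2 := hy
      rw [Real.smoothTransition.zero_of_nonpos, zero_mul]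
      exact div_nonpos_of_nonpos_of_nonneg (by linarith) hc.le
  · simp only
    rw [Real.smoothTransition.one_of_one_le, one_mul]
    rw [le_div_iff₀ hc]
    linarith

lemma log_mem (hA : P.IsDiffusionAlgebra A) {f : E → ℝ} (hf : f ∈ A) {c : ℝ} (hc : 0 < c)
    (h : ∀ x, c ≤ f x) : (fun x => Real.log (f x)) ∈ A := by
  obtain ⟨φ, hφ, hl⟩ := exists_contDiff_eq_log (half_pos hc)
  have := hA.comp_mem f hf φ hφ
  convert this using 2 with x
  exact (hl _ (by linarith [h x])).symm

/-! ### Differentiation of the semigroup along curves -/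

/-- The heat equation already gives the derivative at each point. Uniformity comes from the
boundedness of `L² f`: applied twice, the mean value inequality bounds the remainder by `C |s -
r|²`. -/
lemma uDeriv_op (hA : P.IsDiffusionAlgebra A) {f : E → ℝ} (hf : f ∈ A) {r : ℝ} (hr : 0 ≤ r) :
    UDeriv (fun s => P.op s f) (P.op r (P.gen f)) (Ici 0) r := by
  have hL := hA.gen_mem f hf
  obtain ⟨C, hC⟩ := hA.bounded _ (hA.gen_mem _ hL)
  have hsub : ∀ s, 0 ≤ s → uIcc r s ⊆ Ici 0 := fun s hs z hz => by
    rcases mem_uIcc.1 hz with h | h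
    · exact hr.trans h.1
    · exact hs.trans h.1
  have b1 : ∀ y s, 0 ≤ s → |P.op s (P.gen f) y - P.op r (P.gen f) y| ≤ C * |s - r| := by
    intro y s hs
    exact (convex_uIcc r s).norm_image_sub_le_of_norm_hasDerivWithin_le
      (fun z hz => (hasDerivWithinAt_op hA hL (hsub s hs hz) y).mono (hsub s hs))
      (fun z hz => P.op_le_of_le (hsub s hs hz) y hC) left_mem_uIcc right_mem_uIcc
  have b2 : ∀ y s, 0 ≤ s → |P.op s f y - P.op r f y - (s - r) * P.op r (P.gen f) y|
      ≤ C * |s - r| * |s - r| := by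
    intro y s hs
    have hC0 : 0 ≤ C := (abs_nonneg _).trans (hC y)
    have := (convex_uIcc r s).norm_image_sub_le_of_norm_hasDerivWithin_le
      (f := fun z => P.op z f y - z * P.op r (P.gen f) y)
      (f' := fun z => P.op z (P.gen f) y - 1 * P.op r (P.gen f) y) (C := C * |s - r|)
      (fun z hz => ((hasDerivWithinAt_op hA hf (hsub s hs hz) y).mono (hsub s hs)).sub
        ((hasDerivWithinAt_id z _).mul_const _))
      (fun z hz => by
        rw [one_mul]
        exact (b1 y z (hsub s hs hz)).trans
          (mul_le_mul_of_nonneg_left (abs_sub_le_of_mem_uIcc hz) hC0))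
      left_mem_uIcc right_mem_uIcc
    rw [Real.norm_eq_abs, Real.norm_eq_abs] at this
    refine (le_of_eq ?_).trans this
    congr 1; ring
  rw [uDeriv_iff]
  intro δ hδ
  have hs : ∀ᶠ s in 𝓝[Ici 0] r, C * |s - r| ≤ δ := by
    have hcont : Continuous fun s : ℝ => C * |s - r| := by fun_prop
    have h0 : C * |r - r| < δ := by simpa using hδ
    exact ((hcont.continuousWithinAt (s := Ici 0) (x := r)).eventually
      (gt_mem_nhds h0)).mono fun s hs => hs.le
  filter_upwards [hs, self_mem_nhdsWithin] with s h1 h2 y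
  exact (b2 y s h2).trans (mul_le_mul_of_nonneg_right h1 (abs_nonneg _))

/-- Differentiation of `P_{u(s)} W_s` along an `A`-valued curve `W`. -/
lemma hasDerivWithinAt_op_curve (hA : P.IsDiffusionAlgebra A) {W : ℝ → E → ℝ} {D : E → ℝ}
    {u : ℝ → ℝ} {u' r : ℝ} {S : Set ℝ} (hr : r ∈ S) (hu : HasDerivWithinAt u u' S r)
    (hm : MapsTo u S (Ici 0)) (hW : ∀ s ∈ S, W s ∈ A) (hD : D ∈ A) (hWD : UDeriv W D S r)
    (x : E) :
    HasDerivWithinAt (fun s => P.op (u s) (W s) x)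
      (P.op (u r) D x + u' * P.op (u r) (P.gen (W r)) x) S r := by
  rw [uDeriv_iff] at hWD
  have h3 := (hasDerivWithinAt_op hA (hW r hr) (hm hr) x).comp r hu hm
  have hc := ((hasDerivWithinAt_op hA hD (hm hr) x).comp r hu hm).continuousWithinAt
  rw [hasDerivWithinAt_iff_isLittleO, Asymptotics.isLittleO_iff] at h3 ⊢
  intro c hc0
  have hc3 : 0 < c / 3 := by positivity
  filter_upwards [h3 hc3, (Metric.tendsto_nhds.1 hc) (c / 3) hc3, hWD (c / 3) hc3,
    self_mem_nhdsWithin] with s a1 a2 a3 hs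
  simp only [Function.comp, smul_eq_mul, Real.norm_eq_abs, Real.dist_eq] at a1 a2 ⊢
  have hs0 : 0 ≤ u s := hm hs
  -- The increment splits into the increment of `W` under the kernel at time `u s` (`b1`), the
  -- replacement of `P_{u(s)} D` by `P_{u(r)} D` (`b2`), and the change of time for the fixed
  -- function `W r` (`a1`).
  have b1 := P.op_le_of_le hs0 x a3
  have e1 := op_sub hA (A.sub_mem (hW s hs) (hW r hr)) (A.smul_mem hD (s - r)) hs0 x
  have e2 := op_sub hA (hW s hs) (hW r hr) hs0 x
  have e3 := P.op_smul (s - r) D (u s) x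
  simp only [Pi.sub_apply, Pi.smul_apply, smul_eq_mul] at e1
  change _ = P.op _ (fun y => W s y - W r y) x - P.op _ (fun y => (s - r) * D y) x at e1
  rw [e1, e2, e3] at b1
  have b2 : |(s - r) * (P.op (u s) D x - P.op (u r) D x)| ≤ |s - r| * (c / 3) := by
    rw [abs_mul]; gcongr
  have e : P.op (u s) (W s) x - P.op (u r) (W r) x
      - (s - r) * (P.op (u r) D x + u' * P.op (u r) (P.gen (W r)) x)
      = (P.op (u s) (W s) x - P.op (u s) (W r) x - (s - r) * P.op (u s) D x)
        + ((s - r) * (P.op (u s) D x - P.op (u r) D x)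
        + (P.op (u s) (W r) x - P.op (u r) (W r) x
          - (s - r) * (P.op (u r) (P.gen (W r)) x * u'))) := by ring
  rw [e]
  refine (abs_add_le _ _).trans ?_
  have := abs_add_le ((s - r) * (P.op (u s) D x - P.op (u r) D x))
    (P.op (u s) (W r) x - P.op (u r) (W r) x
          - (s - r) * (P.op (u r) (P.gen (W r)) x * u'))
  exact (add_le_add b1 (this.trans (add_le_add b2 a1))).trans (le_of_eq (by ring))

/-- Second order expansion of `P_h k` at `h = 0⁺`. -/
lemma jet2_op (hA : P.IsDiffusionAlgebra A) {k : E → ℝ} (hk : k ∈ A) :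
    Jet2 (fun h => P.op h k) k (P.gen k) (fun y => P.gen (P.gen k) y / 2) := by
  have hL := hA.gen_mem k hk
  refine (Jet2.of_deriv (W := fun h => P.op h k) (W' := fun h => P.op h (P.gen k))
    (k₂ := P.gen (P.gen k)) (one_pos)
    (fun y h hh => (hasDerivWithinAt_op hA hk hh.1 y).mono fun z hz => hz.1)
    (fun δ hδ => incr_small hA hL hδ)).congr (Eventually.of_forall fun _ _ => rfl)
    (fun y => ?_) (fun _ => rfl) (fun _ => rfl)
  simp only [op_zero hA hk]

/-- Second order expansion of `P_{r-h} k` as `h → 0⁺`. -/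
lemma jet2_op_sub (hA : P.IsDiffusionAlgebra A) {k : E → ℝ} (hk : k ∈ A) {r : ℝ} (hr : 0 < r)
    (x : E) :
    Jet2 (fun h (_ : Unit) => P.op (r - h) k x) (fun _ => P.op r k x)
      (fun _ => -P.op r (P.gen k) x) (fun _ => P.op r (P.gen (P.gen k)) x / 2) := by
  have hL := hA.gen_mem k hk
  have hm : MapsTo (fun h : ℝ => r - h) (Icc 0 r) (Ici 0) := fun h hh => sub_nonneg.2 hh.2
  have hd : ∀ h, HasDerivWithinAt (fun h : ℝ => r - h) (-1) (Icc 0 r) h := fun h => by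
    simpa using (hasDerivWithinAt_id h (Icc 0 r)).const_sub r
  have key : ∀ g ∈ A, ∀ h ∈ Icc 0 r, HasDerivWithinAt (fun s => P.op (r - s) g x)
      (-P.op (r - h) (P.gen g) x) (Icc 0 r) h := fun g hg h hh => by
    exact ((hasDerivWithinAt_op hA hg (hm hh) x).comp h (hd h) hm).congr_deriv (by simp)
  refine (Jet2.of_deriv (W := fun h (_ : Unit) => P.op (r - h) k x)
    (W' := fun h _ => -P.op (r - h) (P.gen k) x) (k₁ := fun _ => -P.op r (P.gen k) x)
    (k₂ := fun _ => P.op r (P.gen (P.gen k)) x) hr (fun _ h hh => key k hk h hh)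
    (fun δ hδ => ?_)).congr (Eventually.of_forall fun _ _ => rfl)
    (fun y => by simp) (fun _ => rfl) (fun _ => rfl)
  have h0 := (key _ hL 0 ⟨le_rfl, hr.le⟩).neg
  rw [hasDerivWithinAt_iff_isLittleO, Asymptotics.isLittleO_iff] at h0
  have hIcc : 𝓝[Icc 0 r] (0 : ℝ) = 𝓝[≥] 0 := nhdsWithin_Icc_eq_nhdsGE hr
  have h1 := h0 hδ
  rw [hIcc] at h1
  filter_upwards [h1, self_mem_nhdsWithin] with h hh h0 _
  have h0 : 0 ≤ h := h0
  simpa [abs_of_nonneg h0] using hh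

end MarkovSemigroup

/-! ### Concavity from one-sided second order expansions. -/

/-- A differentiable function with nonpositive second order coefficients in its left Taylor
expansions lies below its tangent at the right end point. -/
lemma le_tangent_of_left_jet2 {θ θ' : ℝ → ℝ} {u : ℝ} (hu : 0 < u)
    (hd : ∀ r ∈ Icc 0 u, HasDerivWithinAt θ (θ' r) (Icc 0 u) r)
    (hj : ∀ r ∈ Ioo 0 u, ∃ c ≤ 0, Jet2 (fun h (_ : Unit) => θ (r - h)) (fun _ => θ r)
      (fun _ => -θ' r) (fun _ => c)) :
    θ 0 ≤ θ u - u * θ' u := by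
  by_contra! hlt
  set c₀ := θ 0 - (θ u - u * θ' u) with hc₀
  have hc0 : 0 < c₀ := sub_pos.2 hlt
  set δ := c₀ / (4 * u ^ 2) with hδ
  have hδ0 : 0 < δ := by positivity
  have hδu : δ * u ^ 2 = c₀ / 4 := by rw [hδ]; field_simp
  -- `q` compares `θ` with the tangent at `u`, its slope lowered by `κ`, plus the convex
  -- perturbation `δ s (s - u)`. The sizes of `κ` and `δ` give `q 0 > 0`, `q u = 0` and `q' u > 0`,
  -- so `q` has a negative minimum inside the interval; there the left expansion makes `q` decrease
  -- by about `(δ - c) h²`, a contradiction.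
  set κ := c₀ / (2 * u) with hκ
  have hκu : κ * u = c₀ / 2 := by rw [hκ]; field_simp
  set q : ℝ → ℝ := fun s => θ s - (θ u + (s - u) * (θ' u - κ) + δ * (s * (s - u))) with hq
  have hqd : ∀ r ∈ Icc 0 u,
      HasDerivWithinAt q (θ' r - (θ' u - κ + δ * (2 * r - u))) (Icc 0 u) r := by
    intro r hr
    have h1 := (hasDerivWithinAt_id r (Icc 0 u)).sub_const u
    have h2 := (hd r hr).sub (((h1.mul_const (θ' u - κ)).const_add (θ u)).add
      (((hasDerivWithinAt_id r (Icc 0 u)).mul h1).const_mul δ))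
    refine h2.congr_deriv ?_
    simp only [id]
    ring
  have hq0 : 0 < q 0 := by
    simp only [hq]
    nlinarith
  have hqu : q u = 0 := by simp [hq]
  obtain ⟨s₀, hs₀, hs₀q⟩ : ∃ s ∈ Ioo 0 u, q s < 0 := by
    have h1 := ((hqd u ⟨hu.le, le_rfl⟩).mono_of_mem_nhdsWithin (Icc_mem_nhdsLE hu)).mono
      Iio_subset_Iic_self
    rw [hasDerivWithinAt_iff_tendsto_slope' self_notMem_Iio] at h1
    have hpos : 0 < θ' u - (θ' u - κ + δ * (2 * u - u)) := by
      have : 0 < (κ - δ * u) * u := by nlinarith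
      have := (pos_iff_pos_of_mul_pos this).2 hu
      linarith
    obtain ⟨s, hs1, hs2⟩ := ((h1.eventually (lt_mem_nhds hpos)).and (Ioo_mem_nhdsLT hu)).exists
    refine ⟨s, hs2, ?_⟩
    rw [slope_def_field, hqu, sub_zero] at hs1
    have h3 : s - u < 0 := sub_neg.2 hs2.2
    rcases div_pos_iff.1 hs1 with h | h
    · linarith [h.2]
    · exact h.1
  obtain ⟨r, hr, hmin⟩ := isCompact_Icc.exists_isMinOn (nonempty_Icc.2 hu.le)
    (fun r hr => (hqd r hr).continuousWithinAt)
  have hrq : q r < 0 := (hmin ⟨hs₀.1.le, hs₀.2.le⟩).trans_lt hs₀q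
  have hr' : r ∈ Ioo 0 u := by
    refine ⟨lt_of_le_of_ne hr.1 ?_, lt_of_le_of_ne hr.2 ?_⟩
    · rintro rfl; linarith
    · rintro rfl; linarith
  have hnhds : Icc 0 u ∈ 𝓝 r := Icc_mem_nhds hr'.1 hr'.2
  have hzero := (hmin.isLocalMin hnhds).hasDerivAt_eq_zero ((hqd r hr).hasDerivAt hnhds)
  obtain ⟨c, hc, hjet⟩ := hj r hr'
  obtain ⟨h, hh1, hh2⟩ := ((jet2_iff.1 hjet (δ / 2) (half_pos hδ0)).and
    (Ioo_mem_nhdsGT hr'.1)).exists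
  have h1 := (abs_le.1 (hh1 ())).2
  have h2 : q r ≤ q (r - h) := hmin ⟨by linarith [hh2.2], by linarith [hh2.1, hr'.2]⟩
  simp only [hq] at h2
  have h3 : 0 < δ * h ^ 2 := mul_pos hδ0 (pow_pos hh2.1 2)
  have h4 : c * h ^ 2 ≤ 0 := mul_nonpos_of_nonpos_of_nonneg hc (sq_nonneg h)
  have h5 : h * θ' r = h * (θ' u - κ + δ * (2 * r - u)) := by rw [sub_eq_zero.1 hzero]
  nlinarith

/-! ### Entropy along the semigroup and the dimensional logarithmic Sobolev inequality. -/

namespace MarkovSemigroup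

variable {E : Type*} [MeasurableSpace E] {P : MarkovSemigroup E} {A : Subalgebra ℝ (E → ℝ)}

/-- Second order expansion of `P_{r-h} W_h` as `h → 0⁺`. -/
lemma jet2_op_sub_curve (hA : P.IsDiffusionAlgebra A) {W : ℝ → E → ℝ} {j₀ j₁ j₂ : E → ℝ}
    (hj : Jet2 W j₀ j₁ j₂) (hW : ∀ h, 0 ≤ h → W h ∈ A) (h₀ : j₀ ∈ A) (h₁ : j₁ ∈ A) (h₂ : j₂ ∈ A)
    {r : ℝ} (hr : 0 < r) (x : E) :
    Jet2 (fun h (_ : Unit) => P.op (r - h) (W h) x) (fun _ => P.op r j₀ x)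
      (fun _ => -P.op r (P.gen j₀) x + P.op r j₁ x)
      (fun _ => P.op r (P.gen (P.gen j₀)) x / 2 - P.op r (P.gen j₁) x + P.op r j₂ x) := by
  -- Scalar expansions are uniform expansions over `Unit`, so the same calculus serves; its
  -- boundedness conditions are then trivial.
  have b : ∀ c : ℝ, ∃ C : ℝ, ∀ _ : Unit, |c| ≤ C := fun c => ⟨|c|, fun _ => le_rfl⟩
  have e1 := (Jet2.fst (α := Unit)).mul (jet2_op_sub hA h₁ hr x) (b _) (b _) (b _) (b _) (b _) (b _)
  have e2 := (Jet2.fst (α := Unit)).mul ((Jet2.fst (α := Unit)).mul (jet2_op_sub hA h₂ hr x)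
    (b _) (b _) (b _) (b _) (b _) (b _)) (b _) (b _) (b _) (b _) (b _) (b _)
  have e3 := ((jet2_op_sub hA h₀ hr x).add e1).add e2
  -- The remainder of `W h` is uniformly `o(h²)`, and the contraction `P_{r-h}` keeps it so.
  have hrem : Jet2 (fun h (_ : Unit) => P.op (r - h) (W h) x
      - (P.op (r - h) j₀ x + h * P.op (r - h) j₁ x + h * (h * P.op (r - h) j₂ x)))
      (fun _ => 0) (fun _ => 0) (fun _ => 0) := by
    rw [jet2_iff] at hj ⊢
    intro δ hδ
    filter_upwards [hj δ hδ, Ioo_mem_nhdsGT hr] with h hh hhr _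
    have hs : 0 ≤ r - h := by linarith [hhr.2]
    have m1 : (fun y => h * j₁ y) ∈ A := A.smul_mem h₁ h
    have m2 : (fun y => h ^ 2 * j₂ y) ∈ A := A.smul_mem h₂ (h ^ 2)
    have m01 : (fun y => j₀ y + h * j₁ y) ∈ A := A.add_mem h₀ m1
    have m : (fun y => j₀ y + h * j₁ y + h ^ 2 * j₂ y) ∈ A := A.add_mem m01 m2
    have := P.op_le_of_le hs x hh
    rw [op_sub hA (hW h hhr.1.le) m hs, op_add_fun hA m01 m2 hs, op_add_fun hA h₀ m1 hs,
      P.op_smul, P.op_smul] at this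
    convert this using 2
    ring
  refine (hrem.add e3).congr (Eventually.of_forall fun h _ => ?_) (fun _ => ?_) (fun _ => ?_)
    (fun _ => ?_) <;> ring

lemma gen_mul_gen_exp (hA : P.IsDiffusionAlgebra A) {F : E → ℝ} (hF : F ∈ A) (x : E) :
    P.gen (fun y => (1 + F y) * P.gen (fun z => Real.exp (F z)) y) x
      = (1 + F x) * P.gen (P.gen fun z => Real.exp (F z)) x
        + P.gen F x * P.gen (fun z => Real.exp (F z)) x
        + 2 * P.carre F (P.gen fun z => Real.exp (F z)) x := by
  have hL := hA.gen_mem _ (exp_mem hA hF)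
  have hFL : (fun y => F y * P.gen (fun z => Real.exp (F z)) y) ∈ A := A.mul_mem hF hL
  rw [show (fun y => (1 + F y) * P.gen (fun z => Real.exp (F z)) y)
    = fun y => P.gen (fun z => Real.exp (F z)) y + F y * P.gen (fun z => Real.exp (F z)) y from
    funext fun y => by ring, gen_add hA hL hFL, gen_mul]
  ring

lemma gen_gen_exp_mul_self (hA : P.IsDiffusionAlgebra A) {F : E → ℝ} (hF : F ∈ A) (x : E) :
    P.gen (P.gen fun y => Real.exp (F y) * F y) x
      = P.gen (fun y => Real.exp (F y) * P.carre F F y) x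
        + P.gen (fun y => (1 + F y) * P.gen (fun z => Real.exp (F z)) y) x := by
  have hL := hA.gen_mem _ (exp_mem hA hF)
  have m1 : (fun y => Real.exp (F y) * P.carre F F y) ∈ A :=
    A.mul_mem (exp_mem hA hF) (carre_mem hA hF hF)
  have m2 : (fun y => (1 + F y) * P.gen (fun z => Real.exp (F z)) y) ∈ A :=
    A.mul_mem (A.add_mem (const_mem A 1) hF) hL
  rw [← gen_add hA m1 m2]
  congr 1
  exact funext (gen_exp_mul_self hA hF)

/-- With `g = e^F` and `ψ(z) = z log z`, so that `ψ'(g) = 1 + F` and `ψ''(g) = 1/g`, the left side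
is the integrand of the `h²` coefficient of `P_{r-h} ψ(P_h g)`: half of `L² ψ(g)`, minus `L(ψ'(g) L
g)`, plus the second order term of `ψ(P_h g)`. -/
lemma entropy_second_order (hA : P.IsDiffusionAlgebra A) {F : E → ℝ} (hF : F ∈ A) (x : E) :
    P.gen (P.gen fun y => Real.exp (F y) * F y) x / 2
        - P.gen (fun y => (1 + F y) * P.gen (fun z => Real.exp (F z)) y) x
        + ((1 + F x) * (P.gen (P.gen fun z => Real.exp (F z)) x / 2)
          + 1 / Real.exp (F x) / 2 * P.gen (fun z => Real.exp (F z)) x ^ 2)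
      = Real.exp (F x) * P.carre2 F x := by
  have e1 := carre2_exp hA hF x
  rw [gen_gen_exp_mul_self hA hF, gen_mul_gen_exp hA hF]
  have := (Real.exp_pos (F x)).ne'
  field_simp at e1 ⊢
  linarith

/-- The measure `P_t` at a point charges positive functions. -/
lemma op_exp_pos (hA : P.IsDiffusionAlgebra A) {f : E → ℝ} (hf : f ∈ A) {t : ℝ} (ht : 0 ≤ t)
    (x : E) : 0 < P.op t (fun y => Real.exp (f y)) x := by
  obtain ⟨C, hC⟩ := hA.bounded f hf
  have := op_mono hA (const_mem A (Real.exp (-C))) (exp_mem hA hf) ht x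
    fun y => Real.exp_le_exp.2 (abs_le.1 (hC y)).1
  rw [P.op_const _ ht] at this
  exact (Real.exp_pos _).trans_le this

lemma exists_le_op_exp (hA : P.IsDiffusionAlgebra A) {f : E → ℝ} (hf : f ∈ A) :
    ∃ c > 0, ∀ t, 0 ≤ t → ∀ x, c ≤ P.op t (fun y => Real.exp (f y)) x := by
  obtain ⟨C, hC⟩ := hA.bounded f hf
  refine ⟨Real.exp (-C), Real.exp_pos _, fun t ht x => ?_⟩
  have := op_mono hA (const_mem A (Real.exp (-C))) (exp_mem hA hf) ht x
    fun y => Real.exp_le_exp.2 (abs_le.1 (hC y)).1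
  rwa [P.op_const _ ht] at this

lemma deriv_eq_inv_of_eq_log {φ : ℝ → ℝ} {c : ℝ}
    (h : ∀ z, c < z → φ z = Real.log z) {z : ℝ} (hz : c < z) : deriv φ z = 1 / z := by
  have e : φ =ᶠ[𝓝 z] Real.log := by
    filter_upwards [Ioi_mem_nhds hz] with y hy using h y hy
  rw [e.deriv_eq, Real.deriv_log, one_div]

lemma deriv_mul_of_eq_log {φ : ℝ → ℝ} {c : ℝ} (hc : 0 < c)
    (h : ∀ z, c < z → φ z = Real.log z) {z : ℝ} (hz : c < z) :
    deriv (fun z => z * φ z) z = 1 + Real.log z := by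
  have e : (fun z => z * φ z) =ᶠ[𝓝 z] fun z => z * Real.log z := by
    filter_upwards [Ioi_mem_nhds hz] with y hy
    rw [h y hy]
  rw [e.deriv_eq, Real.deriv_mul_log (by linarith), add_comm]

lemma deriv_deriv_mul_of_eq_log {φ : ℝ → ℝ} {c : ℝ} (hc : 0 < c)
    (h : ∀ z, c < z → φ z = Real.log z) {z : ℝ} (hz : c < z) :
    deriv (deriv fun z => z * φ z) z = 1 / z := by
  have e : (deriv fun z => z * φ z) =ᶠ[𝓝 z] fun z => 1 + Real.log z := by
    filter_upwards [Ioi_mem_nhds hz] with y hy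
    exact deriv_mul_of_eq_log hc h hy
  rw [e.deriv_eq, deriv_const_add, Real.deriv_log, one_div]

/-- The entropy `s ↦ P_s(ψ(P_{u-s} g))`, `ψ(z) = z log z`, is differentiable. -/
lemma hasDerivWithinAt_entropy (hA : P.IsDiffusionAlgebra A) {f : E → ℝ} (hf : f ∈ A) {u r : ℝ}
    (hr : r ∈ Icc 0 u) {F : E → ℝ} (hF : F ∈ A)
    (hFG : ∀ y, Real.exp (F y) = P.op (u - r) (fun y => Real.exp (f y)) y) (x : E) :
    HasDerivWithinAt (fun s => P.op s (fun y => P.op (u - s) (fun y => Real.exp (f y)) y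
        * Real.log (P.op (u - s) (fun y => Real.exp (f y)) y)) x)
      (P.op r (fun y => Real.exp (F y) * P.carre F F y) x) (Icc 0 u) r := by
  obtain ⟨c, hc, hcG⟩ := exists_le_op_exp hA hf
  obtain ⟨φ, hφ, hlog⟩ := exists_contDiff_eq_log (half_pos hc)
  have hg := exp_mem hA hf
  have hur : 0 ≤ u - r := sub_nonneg.2 hr.2
  have hψ : ContDiff ℝ ∞ fun z => z * φ z := contDiff_id.mul hφ
  have hm : MapsTo (fun s : ℝ => u - s) (Icc 0 u) (Ici 0) := fun s hs => sub_nonneg.2 hs.2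
  have hd : HasDerivWithinAt (fun s : ℝ => u - s) (-1) (Icc 0 u) r := by
    simpa using (hasDerivWithinAt_id r (Icc 0 u)).const_sub u
  have hLg := hA.op_mem _ (hA.gen_mem _ hg) _ hur
  have hLg' : (fun y => -1 * P.op (u - r) (P.gen fun y => Real.exp (f y)) y) ∈ A :=
    A.smul_mem hLg (-1)
  have hU := ((uDeriv_op hA hg hur).comp_fun hd hm (hA.bounded _ hLg)).comp hψ
    (hA.bounded _ (hA.op_mem _ hg _ hur)) (hA.bounded _ hLg')
  have hEF := exp_mem hA hF
  have eG : P.op (u - r) (fun y => Real.exp (f y)) = fun y => Real.exp (F y) :=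
    funext fun y => (hFG y).symm
  have hLG : P.op (u - r) (P.gen fun y => Real.exp (f y)) = P.gen fun y => Real.exp (F y) := by
    rw [← gen_op hA hg hur, eG]
  have hlt : ∀ t, 0 ≤ t → ∀ y, c / 2 < P.op t (fun y => Real.exp (f y)) y := fun t ht y =>
    (half_lt_self hc).trans_le (hcG t ht y)
  have m1 : (fun y => (1 + F y) * P.gen (fun z => Real.exp (F z)) y) ∈ A :=
    A.mul_mem (A.add_mem (const_mem A 1) hF) (hA.gen_mem _ hEF)
  have m1' : (fun y => -1 * ((1 + F y) * P.gen (fun z => Real.exp (F z)) y)) ∈ A :=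
    A.smul_mem m1 (-1)
  have m2 : (fun y => Real.exp (F y) * P.carre F F y) ∈ A := A.mul_mem hEF (carre_mem hA hF hF)
  have eD : (fun y => deriv (fun z => z * φ z) (P.op (u - r) (fun y => Real.exp (f y)) y)
      * (-1 * P.op (u - r) (P.gen fun y => Real.exp (f y)) y))
      = fun y => -1 * ((1 + F y) * P.gen (fun z => Real.exp (F z)) y) := by
    ext y
    rw [deriv_mul_of_eq_log (half_pos hc) hlog (hlt _ hur y), hLG, eG, Real.log_exp]
    ring
  rw [eD] at hU
  have main := hasDerivWithinAt_op_curve hA hr (hasDerivWithinAt_id r (Icc 0 u))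
    (fun s hs => hs.1) (fun s hs => hA.comp_mem _ (hA.op_mem _ hg _ (hm hs)) _ hψ) m1' hU x
  refine (main.congr_deriv ?_).congr_of_mem (fun s hs => ?_) hr
  · have e2 : (fun y => P.op (u - r) (fun y => Real.exp (f y)) y
        * φ (P.op (u - r) (fun y => Real.exp (f y)) y)) = fun y => Real.exp (F y) * F y := by
      ext y
      rw [hlog _ (hlt _ hur y), eG, Real.log_exp]
    -- The term `(1 + F) L e^F` cancels against the derivative of `ψ(P_{u-s} g)` in `s`, leaving
    -- only `e^F Γ(F)`.
    have e3 : P.gen (fun y => Real.exp (F y) * F y)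
        = fun y => Real.exp (F y) * P.carre F F y
          + (1 + F y) * P.gen (fun z => Real.exp (F z)) y := funext (gen_exp_mul_self hA hF)
    simp only [id]
    rw [e2, e3, op_add_fun hA m2 m1 hr.1, P.op_smul]
    ring
  · simp only [id]
    congr 1
    ext y
    rw [hlog _ (hlt _ (hm hs) y)]

/-- Left second order expansion of the entropy `s ↦ P_s(ψ(P_{u-s} g))`. -/
lemma jet2_entropy (hA : P.IsDiffusionAlgebra A) {f : E → ℝ} (hf : f ∈ A) {u r : ℝ}
    (hr : r ∈ Ioo 0 u) {F : E → ℝ} (hF : F ∈ A)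
    (hFG : ∀ y, Real.exp (F y) = P.op (u - r) (fun y => Real.exp (f y)) y) (x : E) :
    Jet2 (fun h (_ : Unit) => P.op (r - h) (fun y => P.op (u - (r - h)) (fun y => Real.exp (f y)) y
        * Real.log (P.op (u - (r - h)) (fun y => Real.exp (f y)) y)) x)
      (fun _ => P.op r (fun y => P.op (u - r) (fun y => Real.exp (f y)) y
        * Real.log (P.op (u - r) (fun y => Real.exp (f y)) y)) x)
      (fun _ => -P.op r (fun y => Real.exp (F y) * P.carre F F y) x)
      (fun _ => P.op r (fun y => Real.exp (F y) * P.carre2 F y) x) := by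
  obtain ⟨c, hc, hcG⟩ := exists_le_op_exp hA hf
  obtain ⟨φ, hφ, hlog⟩ := exists_contDiff_eq_log (half_pos hc)
  have hg := exp_mem hA hf
  have hur : 0 ≤ u - r := sub_nonneg.2 hr.2.le
  have hψ : ContDiff ℝ ∞ fun z => z * φ z := contDiff_id.mul hφ
  have hEF := exp_mem hA hF
  have eG : P.op (u - r) (fun y => Real.exp (f y)) = fun y => Real.exp (F y) :=
    funext fun y => (hFG y).symm
  -- To the left of `r` the entropy is `P_{r-h} ψ(P_h e^F)`: going left makes the inner semigroup
  -- start from the function `e^F` of the algebra, where the expansion at `0⁺` is available.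
  have eGh : ∀ h, 0 ≤ h → P.op (u - (r - h)) (fun y => Real.exp (f y))
      = P.op h fun y => Real.exp (F y) := by
    intro h hh
    ext y
    rw [← eG, ← op_add hA hg hh hur]
    congr 1
    ring
  have hlt : ∀ t, 0 ≤ t → ∀ y, c / 2 < P.op t (fun y => Real.exp (f y)) y := fun t ht y =>
    (half_lt_self hc).trans_le (hcG t ht y)
  have hltF : ∀ y, c / 2 < Real.exp (F y) := fun y => by
    rw [hFG]; exact hlt _ hur y
  have hL := hA.gen_mem _ hEF
  have hLL := hA.gen_mem _ hL
  have hLL2 : (fun y => P.gen (P.gen fun y => Real.exp (F y)) y / 2) ∈ A := by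
    have := A.smul_mem hLL (1 / 2)
    convert this using 2 with y
    simp
    ring
  have hj := (jet2_op hA hEF).comp hψ (hA.bounded _ hEF) (hA.bounded _ hL) (hA.bounded _ hLL2)
  have j0 : (fun y => Real.exp (F y) * φ (Real.exp (F y))) = fun y => Real.exp (F y) * F y := by
    ext y; rw [hlog _ (hltF y), Real.log_exp]
  have d1 : ∀ y, deriv (fun z => z * φ z) (Real.exp (F y)) = 1 + F y := fun y => by
    rw [deriv_mul_of_eq_log (half_pos hc) hlog (hltF y), Real.log_exp]
  have d2 : ∀ y, deriv (deriv fun z => z * φ z) (Real.exp (F y)) = 1 / Real.exp (F y) := fun y =>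
    deriv_deriv_mul_of_eq_log (half_pos hc) hlog (hltF y)
  rw [j0] at hj
  simp only [d1, d2] at hj
  have m0 : (fun y => Real.exp (F y) * F y) ∈ A := A.mul_mem hEF hF
  have m1 : (fun y => (1 + F y) * P.gen (fun z => Real.exp (F z)) y) ∈ A :=
    A.mul_mem (A.add_mem (const_mem A 1) hF) hL
  have m2 : (fun y => Real.exp (F y) * P.carre F F y) ∈ A := A.mul_mem hEF (carre_mem hA hF hF)
  have hinv : (fun y => 1 / Real.exp (F y) / 2) ∈ A := by
    have := hA.comp_mem F hF (fun z => Real.exp (-z) / 2) (by fun_prop)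
    convert this using 2 with y
    rw [Real.exp_neg, one_div]
  have m3 : (fun y => (1 + F y) * (P.gen (P.gen fun z => Real.exp (F z)) y / 2)
      + 1 / Real.exp (F y) / 2 * P.gen (fun z => Real.exp (F z)) y ^ 2) ∈ A :=
    A.add_mem (A.mul_mem (A.add_mem (const_mem A 1) hF) hLL2) (A.mul_mem hinv (A.pow_mem hL 2))
  have main := jet2_op_sub_curve hA hj
    (fun h hh => hA.comp_mem _ (hA.op_mem _ hEF _ hh) _ hψ) m0 m1 m3 hr.1 x
  have e3 : P.gen (fun y => Real.exp (F y) * F y)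
      = fun y => Real.exp (F y) * P.carre F F y
        + (1 + F y) * P.gen (fun z => Real.exp (F z)) y := funext (gen_exp_mul_self hA hF)
  refine main.congr ?_ (fun _ => ?_) (fun _ => ?_) (fun _ => ?_)
  · filter_upwards [self_mem_nhdsWithin] with h hh _
    have hh : 0 < h := hh
    congr 1
    ext y
    rw [eGh h hh.le]
    rw [hlog]
    rw [← eGh h hh.le]
    exact hlt _ (by linarith) y
  · rw [eG]
    simp only [Real.log_exp]
  · rw [e3, op_add_fun hA m2 m1 hr.1.le]
    ring
  · have hLL0 := hA.gen_mem _ (hA.gen_mem _ m0)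
    have hLm1 := hA.gen_mem _ m1
    have q1 : (fun y => 1 / 2 * P.gen (P.gen fun y => Real.exp (F y) * F y) y) ∈ A :=
      A.smul_mem hLL0 (1 / 2)
    have q2 : (fun y => 1 / 2 * P.gen (P.gen fun y => Real.exp (F y) * F y) y
        - P.gen (fun y => (1 + F y) * P.gen (fun z => Real.exp (F z)) y) y) ∈ A :=
      A.sub_mem q1 hLm1
    rw [show P.op r (P.gen (P.gen fun y => Real.exp (F y) * F y)) x / 2
      = 1 / 2 * P.op r (P.gen (P.gen fun y => Real.exp (F y) * F y)) x by ring, ← P.op_smul,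
      ← op_sub hA q1 hLm1 hr.1.le, ← op_add_fun hA q2 m3 hr.1.le]
    congr 1
    ext y
    rw [← entropy_second_order hA hF y]
    ring

/-- The dimensional logarithmic Sobolev inequality for the kernel `P_u`, under `CD(0, n)`. -/
lemma CurvatureDimension.one_le_exp_entropy (hA : P.IsDiffusionAlgebra A) {n : ℝ} (hn : 0 < n)
    (hCD : P.CurvatureDimension A 0 n) {f : E → ℝ} (hf : f ∈ A) {u : ℝ} (hu : 0 < u) (x : E)
    {p X : ℝ} (hp : p = P.op u (fun y => Real.exp (f y)) x)
    (hX : X = P.op u (P.gen fun y => Real.exp (f y)) x / p) :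
    1 ≤ Real.exp (-(2 / n) * ((P.op u (fun y => Real.exp (f y) * f y) x - p * Real.log p) / p
        - u * X))
      * (1 + 2 * u / n * (P.op u (fun y => Real.exp (f y) * P.carre f f y) x / p - X)) := by
  obtain ⟨c, hc, hcG⟩ := exists_le_op_exp hA hf
  have hg := exp_mem hA hf
  have hp0 : 0 < p := hp ▸ op_exp_pos hA hf hu.le x
  set F : ℝ → E → ℝ := fun r y => Real.log (P.op (u - r) (fun y => Real.exp (f y)) y) with hFdef
  have hFA : ∀ r ≤ u, F r ∈ A := fun r hr =>
    log_mem hA (hA.op_mem _ hg _ (sub_nonneg.2 hr)) hc (hcG _ (sub_nonneg.2 hr))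
  have hFG : ∀ r ≤ u, ∀ y, Real.exp (F r y) = P.op (u - r) (fun y => Real.exp (f y)) y :=
    fun r hr y => Real.exp_log (hc.trans_le (hcG _ (sub_nonneg.2 hr) y))
  set Λ : ℝ → ℝ := fun s => P.op s (fun y => P.op (u - s) (fun y => Real.exp (f y)) y
    * Real.log (P.op (u - s) (fun y => Real.exp (f y)) y)) x with hΛ
  set ℓ : ℝ → ℝ := fun r => P.op r (fun y => Real.exp (F r y) * P.carre (F r) (F r) y) x with hℓ
  have hΛd : ∀ r ∈ Icc 0 u, HasDerivWithinAt Λ (ℓ r) (Icc 0 u) r := fun r hr =>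
    hasDerivWithinAt_entropy hA hf hr (hFA r hr.2) (hFG r hr.2) x
  set θ : ℝ → ℝ := fun s => Real.exp (-(2 / n) * ((Λ s - Λ 0) / p - s * X)) with hθ
  have hθd : ∀ r ∈ Icc 0 u,
      HasDerivWithinAt θ (-(2 / n) * (ℓ r / p - X) * θ r) (Icc 0 u) r := by
    intro r hr
    have h1 := (((((hΛd r hr).sub_const (Λ 0)).div_const p).sub
      ((hasDerivWithinAt_id r (Icc 0 u)).mul_const X)).const_mul (-(2 / n))).exp
    refine h1.congr_deriv ?_
    simp only [hθ, Pi.sub_apply, id]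
    ring
  have b : ∀ c : ℝ, ∃ C : ℝ, ∀ _ : Unit, |c| ≤ C := fun c => ⟨|c|, fun _ => le_rfl⟩
  have hjet : ∀ r ∈ Ioo 0 u, ∃ c ≤ 0, Jet2 (fun h (_ : Unit) => θ (r - h)) (fun _ => θ r)
      (fun _ => -(-(2 / n) * (ℓ r / p - X) * θ r)) (fun _ => c) := by
    intro r hr
    have hFr := hFA r hr.2.le
    have hEF := exp_mem hA hFr
    set μ := P.op r (fun y => Real.exp (F r y) * P.carre2 (F r) y) x with hμ
    set m := ℓ r / p - X with hm
    have hJ := jet2_entropy hA hf hr hFr (hFG r hr.2.le) x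
    have hJ1 := ((hJ.mul (Jet2.const fun _ => 1 / p) (b _) (b _) (b _) (b _) (b _) (b _)).add
      (Jet2.fst.mul (Jet2.const fun _ => X) (b _) (b _) (b _) (b _) (b _) (b _))).add
      (Jet2.const fun _ => -Λ 0 / p - r * X)
    have hJ2 := hJ1.comp (φ := fun z => Real.exp (-(2 / n) * z)) (by fun_prop) (b _) (b _) (b _)
    have dd : ∀ k : ℝ, deriv (fun z => k * Real.exp (-(2 / n) * z))
        = fun z => k * (-(2 / n)) * Real.exp (-(2 / n) * z) := by
      intro k
      ext z
      have h1 := (((hasDerivAt_id z).const_mul (-(2 / n))).exp).const_mul k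
      rw [mul_one] at h1
      exact h1.deriv.trans (by simp only [id]; ring)
    have d1 : deriv (fun z => Real.exp (-(2 / n) * z))
        = fun z => -(2 / n) * Real.exp (-(2 / n) * z) := by
      simpa using dd 1
    have d2 := dd (-(2 / n))
    rw [← d1] at d2
    rw [d2] at hJ2
    simp only [d1] at hJ2
    have hθr : Real.exp (-(2 / n) * (Λ r * (1 / p) + 0 * X + (-Λ 0 / p - r * X))) = θ r := by
      simp only [hθ]
      congr 1
      ring
    -- This is half of the formal `θ''`, as `m' = 2 μ / p`. Its sign is the inequality `m² / n ≤ μ /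
    -- p`.
    refine ⟨2 / n * θ r * (m ^ 2 / n - μ / p), ?_, hJ2.congr
      (Eventually.of_forall fun h _ => ?_) (fun _ => ?_) (fun _ => ?_) (fun _ => ?_)⟩
    · have hLF := hA.gen_mem _ hFr
      have mG : (fun y => Real.exp (F r y) * P.carre (F r) (F r) y) ∈ A :=
        A.mul_mem hEF (carre_mem hA hFr hFr)
      have mL : (fun y => Real.exp (F r y) * P.gen (F r) y) ∈ A := A.mul_mem hEF hLF
      have e1 : P.op r (fun y => Real.exp (F r y)) x = p := by
        rw [show (fun y => Real.exp (F r y)) = P.op (u - r) (fun y => Real.exp (f y)) from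
          funext (hFG r hr.2.le), ← op_add hA hg hr.1.le (sub_nonneg.2 hr.2.le), hp,
          add_sub_cancel]
      have e2 : P.op r (fun y => Real.exp (F r y) * P.gen (F r) y) x = -(p * m) := by
        have h1 : (fun y => Real.exp (F r y) * P.gen (F r) y)
            = fun y => P.gen (fun y => Real.exp (F r y)) y
              - Real.exp (F r y) * P.carre (F r) (F r) y := by
          ext y
          rw [gen_exp hA hFr]
          ring
        have h2 : P.op r (P.gen fun y => Real.exp (F r y)) x = p * X := by
          rw [show (fun y => Real.exp (F r y)) = P.op (u - r) (fun y => Real.exp (f y)) from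
            funext (hFG r hr.2.le), gen_op hA hg (sub_nonneg.2 hr.2.le),
            ← op_add hA (hA.gen_mem _ hg) hr.1.le (sub_nonneg.2 hr.2.le), add_sub_cancel, hX]
          field_simp
        rw [h1, op_sub hA (hA.gen_mem _ hEF) mG hr.1.le, h2, hm]
        field_simp
        simp only [hℓ]
        ring
      have mC : (fun y => Real.exp (F r y) * P.carre2 (F r) y) ∈ A := by
        refine A.mul_mem hEF (A.smul_mem (A.sub_mem (hA.gen_mem _ (carre_mem hA hFr hFr))
          (A.smul_mem (carre_mem hA hFr hLF) 2)) (1 / 2))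
      have q1 : (fun y => (1 / n * (2 * -m)) * (Real.exp (F r y) * P.gen (F r) y)) ∈ A :=
        A.smul_mem mL _
      have q2 : (fun y => (1 / n * m ^ 2) * Real.exp (F r y)) ∈ A := A.smul_mem hEF _
      -- Cauchy–Schwarz for the weight `e^F`, in the linear form `(L F + m)² ≥ 0`. Since `P_r(e^F L
      -- F) = -p m`, the integrated lower bound is exactly `p m² / n`.
      have h3 := op_mono hA (A.sub_mem q1 q2) mC hr.1.le x fun y => by
        have h4 := hCD (F r) hFr y
        rw [zero_mul, zero_add] at h4
        have h5 : 1 / n * (2 * -m) * P.gen (F r) y - 1 / n * m ^ 2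
            ≤ 1 / n * P.gen (F r) y ^ 2 := by
          have : 0 ≤ 1 / n * (P.gen (F r) y + m) ^ 2 := by positivity
          linarith
        have := mul_le_mul_of_nonneg_left (h5.trans h4) (Real.exp_pos (F r y)).le
        simp only [Pi.sub_apply]
        linarith
      have h6 := op_sub hA q1 q2 hr.1.le x
      change P.op r _ x ≤ _ at h3
      rw [show P.op r ((fun y => (1 / n * (2 * -m)) * (Real.exp (F r y) * P.gen (F r) y))
        - fun y => (1 / n * m ^ 2) * Real.exp (F r y)) x = _ from h6, P.op_smul, P.op_smul, e1,
        e2] at h3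
      have h7 : m ^ 2 / n ≤ μ / p := by
        rw [le_div_iff₀ hp0]
        refine le_trans (le_of_eq ?_) h3
        ring
      have hθ0 : 0 < θ r := Real.exp_pos _
      refine mul_nonpos_of_nonneg_of_nonpos (by positivity) (by linarith)
    · simp only [hθ]
      congr 1
      simp only [hΛ]
      ring
    · exact hθr.symm
    · rw [hθr, hm]
      ring
    · rw [hθr, hm, hμ]
      ring
  have key := le_tangent_of_left_jet2 hu hθd hjet
  have eF : F u = f := by
    ext y
    simp only [hFdef]
    rw [sub_self, op_zero hA hg, Real.log_exp]
  have e0 : θ 0 = 1 := by simp [hθ]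
  have eΛu : Λ u = P.op u (fun y => Real.exp (f y) * f y) x := by
    simp only [hΛ, sub_self, op_zero hA hg, Real.log_exp]
  have eΛ0 : Λ 0 = p * Real.log p := by
    have hm : (fun y => P.op u (fun y => Real.exp (f y)) y
        * Real.log (P.op u (fun y => Real.exp (f y)) y)) ∈ A := by
      have := A.mul_mem (hA.op_mem _ hg _ hu.le) (hFA 0 hu.le)
      simp only [hFdef, sub_zero] at this
      exact this
    simp only [hΛ, sub_zero]
    rw [op_zero hA hm, hp]
  have eθu : θ u = Real.exp (-(2 / n) * ((P.op u (fun y => Real.exp (f y) * f y) x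
      - p * Real.log p) / p - u * X)) := by
    simp only [hθ, eΛu, eΛ0]
  have eℓ : ℓ u = P.op u (fun y => Real.exp (f y) * P.carre f f y) x := by
    simp only [hℓ, eF]
  rw [e0, eθu, eℓ] at key
  refine key.trans (le_of_eq ?_)
  ring

/-- The dimensional logarithmic Sobolev inequality, linearized. -/
lemma CurvatureDimension.entropy_le (hA : P.IsDiffusionAlgebra A) {n : ℝ} (hn : 0 < n)
    (hCD : P.CurvatureDimension A 0 n) {f : E → ℝ} (hf : f ∈ A) {u : ℝ} (hu : 0 < u) (x : E)
    {p X Y : ℝ} (hp : p = P.op u (fun y => Real.exp (f y)) x)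
    (hX : X = P.op u (P.gen fun y => Real.exp (f y)) x / p)
    (hY : Y = P.op u (fun y => Real.exp (f y) * P.carre f f y) x / p) {a : ℝ} (ha : 0 < a) :
    P.op u (fun y => Real.exp (f y) * f y) x / p - Real.log p ≤
      u * X + n / 2 * (Real.log a + (1 + 2 * u / n * (Y - X)) / a - 1) := by
  have hp0 : 0 < p := hp ▸ op_exp_pos hA hf hu.le x
  have h1 := hCD.one_le_exp_entropy hA hn hf hu x hp hX
  rw [← hY] at h1
  set z := 1 + 2 * u / n * (Y - X)
  set y := (P.op u (fun y => Real.exp (f y) * f y) x - p * Real.log p) / p - u * X with hy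
  have hz : Real.exp (2 / n * y) ≤ z := by
    have := mul_le_mul_of_nonneg_left h1 (Real.exp_pos (2 / n * y)).le
    rwa [mul_one, ← mul_assoc, ← Real.exp_add, neg_mul, add_neg_cancel, Real.exp_zero,
      one_mul] at this
  have hz0 := (Real.exp_pos _).trans_le hz
  have h2 := (Real.le_log_iff_exp_le hz0).2 hz
  -- Tangent line of the logarithm at `a`. Leaving `a` free allows the coefficient of `Y` to be
  -- prescribed later.
  have h3 := Real.log_le_sub_one_of_pos (div_pos hz0 ha)
  rw [Real.log_div hz0.ne' ha.ne'] at h3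
  have h4 : y ≤ n / 2 * (Real.log a + z / a - 1) := by
    have h5 : 2 / n * y ≤ Real.log a + z / a - 1 := by linarith
    have := mul_le_mul_of_nonneg_left h5 (by positivity : 0 ≤ n / 2)
    refine le_trans (le_of_eq ?_) this
    field_simp
  have h6 : P.op u (fun y => Real.exp (f y) * f y) x / p - Real.log p = y + u * X := by
    rw [hy]; field_simp; ring
  rw [h6]
  linarith

end MarkovSemigroup

namespace MarkovSemigroup

variable {E : Type*} [MeasurableSpace E] {P : MarkovSemigroup E} {A : Subalgebra ℝ (E → ℝ)}

/-! ### The viscous Hamilton–Jacobi semigroup -/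

lemma neg_div_mem {α : Type*} {A : Subalgebra ℝ (α → ℝ)} {f : α → ℝ} (hf : f ∈ A) (ε : ℝ) : (fun y => -f y / (2 * ε)) ∈ A := by
  have := A.smul_mem hf (-1 / (2 * ε))
  convert this using 2 with y
  simp
  ring

lemma viscousHJ_mem (hA : P.IsDiffusionAlgebra A) {f : E → ℝ} (hf : f ∈ A) {ε s : ℝ}
    (hε : 0 < ε) (hs : 0 ≤ s) : P.viscousHJ ε s f ∈ A := by
  obtain ⟨c, hc, hcG⟩ := exists_le_op_exp hA (neg_div_mem hf ε)
  have h0 := mul_nonneg hε.le hs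
  exact A.smul_mem (log_mem hA (hA.op_mem _ (exp_mem hA (neg_div_mem hf ε)) _ h0) hc (hcG _ h0))
    (-2 * ε)

lemma viscousHJ_zero (hA : P.IsDiffusionAlgebra A) {f : E → ℝ} (hf : f ∈ A) {ε : ℝ}
    (hε : 0 < ε) : P.viscousHJ ε 0 f = f := by
  ext x
  rw [viscousHJ, mul_zero, op_zero hA (exp_mem hA (neg_div_mem hf ε)), Real.log_exp]
  field_simp

lemma abs_viscousHJ_le (hA : P.IsDiffusionAlgebra A) {f : E → ℝ} (hf : f ∈ A) {C : ℝ}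
    (hC : ∀ x, |f x| ≤ C) {ε s : ℝ} (hε : 0 < ε) (hs : 0 ≤ s) (x : E) :
    |P.viscousHJ ε s f x| ≤ C := by
  have h0 := mul_nonneg hε.le hs
  have hm := exp_mem hA (neg_div_mem hf ε)
  have e2 : (0 : ℝ) < 2 * ε := by positivity
  have lo := op_mono hA (const_mem A (Real.exp (-C / (2 * ε)))) hm h0 x fun y =>
    Real.exp_le_exp.2 ((div_le_div_iff_of_pos_right e2).2 (by linarith [(abs_le.1 (hC y)).2]))
  have up := op_mono hA hm (const_mem A (Real.exp (C / (2 * ε)))) h0 x fun y =>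
    Real.exp_le_exp.2 ((div_le_div_iff_of_pos_right e2).2 (by linarith [(abs_le.1 (hC y)).1]))
  rw [P.op_const _ h0] at lo up
  have hpos := (Real.exp_pos _).trans_le lo
  have l1 := (Real.le_log_iff_exp_le hpos).2 lo
  have l2 := (Real.log_le_iff_le_exp hpos).2 up
  rw [div_le_iff₀ e2] at l1
  rw [le_div_iff₀ e2] at l2
  rw [viscousHJ, abs_le]
  constructor <;> linarith

/-- The viscous Hamilton–Jacobi equation. -/
lemma uDeriv_viscousHJ (hA : P.IsDiffusionAlgebra A) {f : E → ℝ} (hf : f ∈ A) {ε r : ℝ}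
    (hε : 0 < ε) (hr : 0 ≤ r) :
    UDeriv (fun s => P.viscousHJ ε s f)
      (fun y => ε * P.gen (P.viscousHJ ε r f) y
        - 1 / 2 * P.carre (P.viscousHJ ε r f) (P.viscousHJ ε r f) y) (Ici 0) r := by
  obtain ⟨c, hc, hcG⟩ := exists_le_op_exp hA (neg_div_mem hf ε)
  obtain ⟨φ, hφ, hlog⟩ := exists_contDiff_eq_log (half_pos hc)
  have hm := exp_mem hA (neg_div_mem hf ε)
  have hεr := mul_nonneg hε.le hr
  have hlt : ∀ t, 0 ≤ t → ∀ y, c / 2 < P.op t (fun y => Real.exp (-f y / (2 * ε))) y :=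
    fun t ht y => (half_lt_self hc).trans_le (hcG t ht y)
  have hd : HasDerivWithinAt (fun s : ℝ => ε * s) ε (Ici 0) r := by
    simpa using (hasDerivWithinAt_id r (Ici (0 : ℝ))).const_mul ε
  have hmaps : MapsTo (fun s : ℝ => ε * s) (Ici 0) (Ici 0) := fun s hs => mul_nonneg hε.le hs
  have hLw := hA.op_mem _ (hA.gen_mem _ hm) _ hεr
  have hψ : ContDiff ℝ ∞ fun z => -2 * ε * φ z := contDiff_const.mul hφ
  have hU := ((uDeriv_op hA hm hεr).comp_fun hd hmaps (hA.bounded _ hLw)).comp hψ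
    (hA.bounded _ (hA.op_mem _ hm _ hεr)) (hA.bounded _ (A.smul_mem hLw ε))
  have hv := viscousHJ_mem hA hf hε hr
  -- Hopf–Cole transform: `e^{-v/(2ε)}` solves the heat equation at speed `ε`. Computing its
  -- generator by the diffusion property gives the nonlinear equation for `v`.
  have hwv : P.op (ε * r) (fun y => Real.exp (-f y / (2 * ε)))
      = fun y => Real.exp (-1 / (2 * ε) * P.viscousHJ ε r f y + 0) := by
    ext y
    have e : -1 / (2 * ε) * P.viscousHJ ε r f y + 0
        = Real.log (P.op (ε * r) (fun y => Real.exp (-f y / (2 * ε))) y) := by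
      rw [viscousHJ]; field_simp; ring
    rw [e, Real.exp_log (hc.trans_le (hcG _ hεr y))]
  refine (uDeriv_iff.2 fun δ hδ => ?_)
  filter_upwards [uDeriv_iff.1 hU δ hδ, self_mem_nhdsWithin] with s hs hs0 y
  have hs0 : 0 ≤ s := hs0
  have h1 := hs y
  have e1 : deriv (fun z => -2 * ε * φ z) (P.op (ε * r) (fun y => Real.exp (-f y / (2 * ε))) y)
      * (ε * P.op (ε * r) (P.gen fun y => Real.exp (-f y / (2 * ε))) y)
      = ε * P.gen (P.viscousHJ ε r f) y
        - 1 / 2 * P.carre (P.viscousHJ ε r f) (P.viscousHJ ε r f) y := by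
    rw [deriv_const_mul_field, deriv_eq_inv_of_eq_log hlog (hlt _ hεr y), ← gen_op hA hm hεr, hwv,
      gen_exp_affine hA hv]
    have := (Real.exp_pos (-1 / (2 * ε) * P.viscousHJ ε r f y + 0)).ne'
    field_simp
    ring
  rw [e1, hlog _ (hlt _ hεr y), hlog _ (hlt _ (mul_nonneg hε.le hs0) y)] at h1
  exact h1

/-! ### Hypercontractivity along a path of exponents and times. -/

/-- Monotonicity along the hypercontractive flow, infinitesimal form. -/
lemma CurvatureDimension.hasDerivWithinAt_log_op_exp (hA : P.IsDiffusionAlgebra A) {n : ℝ}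
    (hn : 0 < n) (hCD : P.CurvatureDimension A 0 n) {f : E → ℝ} (hf : f ∈ A) {ε : ℝ} (hε : 0 < ε)
    {S : Set ℝ} {u τ : ℝ → ℝ} {u' τ' q : ℝ} (hq : q ∈ S) (hq0 : 0 < q)
    (hu0 : ∀ s ∈ S, 0 < u s) (hτ0 : ∀ s ∈ S, 0 ≤ τ s)
    (hu : HasDerivWithinAt u u' S q) (hτ : HasDerivWithinAt τ τ' S q)
    (hτu : τ' = 2 * (u q + q * u')) (hτpos : 0 < τ') (x : E) :
    ∃ d ≤ n / 2 * (1 / q ^ 2) * (Real.log (u q / (τ' * (q * ε + 1 / 2)))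
        + 1 / (u q / (τ' * (q * ε + 1 / 2))) - 1),
      HasDerivWithinAt (fun s => 1 / s * Real.log
        (P.op (u s) (fun y => Real.exp (s * P.viscousHJ ε (τ s) f y)) x)) d S q := by
  have hvA : ∀ s ∈ S, P.viscousHJ ε (τ s) f ∈ A := fun s hs => viscousHJ_mem hA hf hε (hτ0 s hs)
  have hv := hvA q hq
  set v := P.viscousHJ ε (τ q) f with hvdef
  have hLv := hA.gen_mem v hv
  have hGv := carre_mem hA hv hv
  set D : E → ℝ := fun y => ε * P.gen v y - 1 / 2 * P.carre v v y with hD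
  have hDA : D ∈ A := A.sub_mem (A.smul_mem hLv ε) (A.smul_mem hGv (1 / 2))
  have hDA' : (fun y => τ' * D y) ∈ A := A.smul_mem hDA τ'
  have hvU := (uDeriv_viscousHJ hA hf hε (hτ0 q hq)).comp_fun hτ (fun s hs => hτ0 s hs)
    (hA.bounded _ hDA)
  have hsU := UDeriv.of_scalar (α := E) (hasDerivWithinAt_id q S)
  have bc : ∀ c : ℝ, ∃ C : ℝ, ∀ _ : E, |c| ≤ C := fun c => ⟨|c|, fun _ => le_rfl⟩
  have hp := hsU.mul hvU (bc _) (hA.bounded _ hv) (bc _) (hA.bounded _ hDA')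
  simp only [id] at hp
  set F : E → ℝ := fun y => q * v y with hF
  have hFA : F ∈ A := A.smul_mem hv q
  have hD1 : (fun y => 1 * v y + q * (τ' * D y)) ∈ A :=
    A.add_mem (A.smul_mem hv 1) (A.smul_mem hDA' q)
  have hE := hp.comp Real.contDiff_exp (hA.bounded _ hFA) (hA.bounded _ hD1)
  simp only [Real.deriv_exp] at hE
  have hg := exp_mem hA hFA
  have hmain := hasDerivWithinAt_op_curve hA hq hu (fun s hs => (hu0 s hs).le)
    (fun s hs => exp_mem hA (A.smul_mem (hvA s hs) s)) (A.mul_mem hg hD1) hE x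
  have hLg := hA.gen_mem _ hg
  have mF : (fun y => Real.exp (F y) * F y) ∈ A := A.mul_mem hg hFA
  have mG : (fun y => Real.exp (F y) * P.carre F F y) ∈ A := A.mul_mem hg (carre_mem hA hFA hFA)
  have hup := hu0 q hq
  set p := P.op (u q) (fun y => Real.exp (F y)) x with hpdef
  have hp0 : 0 < p := op_exp_pos hA hFA hup.le x
  set X := P.op (u q) (P.gen fun y => Real.exp (F y)) x / p with hX
  set Y := P.op (u q) (fun y => Real.exp (F y) * P.carre F F y) x / p with hY
  set Z := P.op (u q) (fun y => Real.exp (F y) * F y) x / p with hZ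
  -- With `F = q v`, the identity `e^F L F = L e^F - e^F Γ(F)` removes `L v`, so that only the
  -- entropy term `Z`, the drift `X` and the energy `Y` remain.
  have eD : P.op (u q) ((fun y => Real.exp (F y)) * fun y => 1 * v y + q * (τ' * D y)) x
      = (1 / q * Z + τ' * ε * X - τ' * (ε + 1 / (2 * q)) * Y) * p := by
    have e1 : ((fun y => Real.exp (F y)) * fun y => 1 * v y + q * (τ' * D y))
        = fun y => (1 / q * (Real.exp (F y) * F y)
          + τ' * ε * P.gen (fun y => Real.exp (F y)) y)
          - τ' * (ε + 1 / (2 * q)) * (Real.exp (F y) * P.carre F F y) := by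
      ext y
      have e2 : P.gen F y = q * P.gen v y := gen_const_mul hA hv q y
      have e3 : P.carre F F y = q * (q * P.carre v v y) := by
        rw [hF, carre_const_mul_left hA hFA hv, carre_const_mul_right hA hv hv]
      simp only [Pi.mul_apply]
      rw [gen_exp hA hFA, e2, e3]
      simp only [hF, hD]
      field_simp
      ring
    have m1 : (fun y => 1 / q * (Real.exp (F y) * F y)) ∈ A := A.smul_mem mF (1 / q)
    have m2 : (fun y => τ' * ε * P.gen (fun y => Real.exp (F y)) y) ∈ A := A.smul_mem hLg _
    have m3 : (fun y => τ' * (ε + 1 / (2 * q)) * (Real.exp (F y) * P.carre F F y)) ∈ A :=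
      A.smul_mem mG _
    have m12 : (fun y => 1 / q * (Real.exp (F y) * F y)
        + τ' * ε * P.gen (fun y => Real.exp (F y)) y) ∈ A := A.add_mem m1 m2
    rw [e1, op_sub hA m12 m3 hup.le, op_add_fun hA m1 m2 hup.le, P.op_smul, P.op_smul, P.op_smul,
      hX, hY, hZ]
    field_simp
  have hXp : P.op (u q) (P.gen fun y => Real.exp (F y)) x = X * p := by rw [hX]; field_simp
  have hinv : HasDerivWithinAt (fun s : ℝ => 1 / s) (-(q ^ 2)⁻¹) S q := by
    simpa using hasDerivWithinAt_inv hq0.ne' S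
  have hfin := hinv.mul (hmain.log hp0.ne')
  refine ⟨_, ?_, hfin⟩
  -- This `a` makes `u/a`, the coefficient of `Y` in the logarithmic Sobolev inequality, equal to
  -- that of the energy in the derivative, so `Y` cancels.
  have ha : 0 < u q / (τ' * (q * ε + 1 / 2)) := by positivity
  have hent := hCD.entropy_le hA hn hFA hup x hpdef hX hY ha
  rw [← hZ] at hent
  set a := u q / (τ' * (q * ε + 1 / 2)) with hadef
  have hua : u q * (1 / a) = τ' * (q * ε + 1 / 2) := by
    rw [hadef]; field_simp
  have hlhs : -(q ^ 2)⁻¹ * Real.log p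
      + 1 / q * ((P.op (u q) ((fun y => Real.exp (F y)) * fun y => 1 * v y + q * (τ' * D y)) x
        + u' * P.op (u q) (P.gen fun y => Real.exp (F y)) x) / p)
      = 1 / q ^ 2 * (Z - Real.log p + q * (τ' * ε) * X - τ' * (q * ε + 1 / 2) * Y + q * u' * X) := by
    rw [eD, hXp]
    field_simp
    ring
  refine (le_of_eq hlhs).trans ?_
  have hrhs : n / 2 * (1 / q ^ 2) * (Real.log a + 1 / a - 1)
      = 1 / q ^ 2 * (n / 2 * (Real.log a + 1 / a - 1)) := by ring
  rw [hrhs]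
  refine mul_le_mul_of_nonneg_left ?_ (by positivity)
  have e5 : n / 2 * (Real.log a + (1 + 2 * u q / n * (Y - X)) / a - 1)
      = n / 2 * (Real.log a + 1 / a - 1) + u q * (1 / a) * (Y - X) := by
    field_simp
    ring
  rw [e5, hua] at hent
  -- The relation `τ' = 2 (u + q u')` is what cancels the drift term.
  have e6 : u q * X - τ' / 2 * X + q * u' * X = 0 := by rw [hτu]; ring
  linarith

/-- The dimensional hypercontractivity bound, for the viscous Hamilton–Jacobi semigroup. -/
lemma CurvatureDimension.log_op_exp_viscousHJ_le (hA : P.IsDiffusionAlgebra A) {n : ℝ}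
    (hn : 0 < n) (hCD : P.CurvatureDimension A 0 n) {f : E → ℝ} (hf : f ∈ A)
    {q₁ q₂ u₁ u₂ t : ℝ} (hq₂ : 0 < q₂) (hq : q₂ < q₁) (hu₁ : 0 < u₁) (hu₂ : 0 < u₂) (ht : 0 < t)
    (htu : t = 2 * (u₁ * q₁ - u₂ * q₂)) (x : E) :
    ∃ C : ℝ, ∀ ε > 0, 1 / q₁ * Real.log (P.op u₁ (fun y => Real.exp (q₁ * P.viscousHJ ε t f y)) x)
      ≤ 1 / q₂ * Real.log (P.op u₂ (fun y => Real.exp (q₂ * f y)) x)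
        + n / 2 * (1 / q₂ * Real.log u₁ - 1 / q₁ * Real.log u₂
          + (1 / q₂ - 1 / q₁) * Real.log ((q₁ - q₂) / (u₁ * q₁ - u₂ * q₂))) + ε * C := by
  have hq₁ : 0 < q₁ := hq₂.trans hq
  have hk : 0 < u₁ * q₁ - u₂ * q₂ := by linarith
  have hqq : 0 < q₁ - q₂ := sub_pos.2 hq
  -- `α + β q` is the affine function with values `1/u₂` at `q₂` and `1/u₁` at `q₁`. The path is its
  -- inverse, and then `τ' = 2 α u²`, positive because `t > 0` forces `α > 0`.
  set α := (u₁ * q₁ - u₂ * q₂) / ((q₁ - q₂) * (u₁ * u₂)) with hα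
  have hα0 : 0 < α := by positivity
  set β := (1 / u₁ - 1 / u₂) / (q₁ - q₂) with hβ
  have hl2 : α + β * q₂ = 1 / u₂ := by
    rw [hα, hβ]; field_simp; ring
  have hl1 : α + β * q₁ = 1 / u₁ := by
    rw [hα, hβ]; field_simp; ring
  -- An affine function is bounded below by the smaller of its end values. This keeps `u` positive
  -- and gives `u ≤ u₁ + u₂`.
  have hlow : ∀ q ∈ Icc q₂ q₁, 1 / (u₁ + u₂) ≤ α + β * q := by
    intro q hq
    have b1 : 1 / (u₁ + u₂) ≤ 1 / u₁ := one_div_le_one_div_of_le hu₁ (by linarith)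
    have b2 : 1 / (u₁ + u₂) ≤ 1 / u₂ := one_div_le_one_div_of_le hu₂ (by linarith)
    rcases le_total 0 β with h | h
    · nlinarith [hq.1]
    · nlinarith [hq.2]
  have hm0 : 0 < 1 / (u₁ + u₂) := by positivity
  set u : ℝ → ℝ := fun q => (α + β * q)⁻¹ with hu
  set τ : ℝ → ℝ := fun q => 2 * (q * u q - u₂ * q₂) with hτ
  have hupos : ∀ q ∈ Icc q₂ q₁, 0 < u q := fun q hq => inv_pos.2 (hm0.trans_le (hlow q hq))
  have hule : ∀ q ∈ Icc q₂ q₁, u q ≤ u₁ + u₂ := fun q hq => by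
    have := one_div_le_one_div_of_le hm0 (hlow q hq)
    simpa [hu] using this
  have hmul : ∀ q ∈ Icc q₂ q₁, u q * (α + β * q) = 1 := fun q hq =>
    inv_mul_cancel₀ (hm0.trans_le (hlow q hq)).ne'
  have hu2 : u q₂ = u₂ := by simp only [hu, hl2]; simp
  have hu1 : u q₁ = u₁ := by simp only [hu, hl1]; simp
  have hτ0 : ∀ q ∈ Icc q₂ q₁, 0 ≤ τ q := by
    intro q hq
    have h1 := hmul q hq
    have h2 : u₂ * (α + β * q₂) = 1 := by rw [hl2]; field_simp
    have h3 := hupos q hq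
    have e : q * u q - u₂ * q₂ = u q * u₂ * (α * (q - q₂)) := by
      have e1 : q * u q = q * u q * (u₂ * (α + β * q₂)) := by rw [h2, mul_one]
      have e2 : u₂ * q₂ = u₂ * q₂ * (u q * (α + β * q)) := by rw [h1, mul_one]
      rw [e1, e2]
      ring
    have : 0 ≤ u q * u₂ * (α * (q - q₂)) :=
      mul_nonneg (mul_nonneg h3.le hu₂.le) (mul_nonneg hα0.le (sub_nonneg.2 hq.1))
    simp only [hτ]
    linarith
  have hud : ∀ q ∈ Icc q₂ q₁, HasDerivWithinAt u (-(β * u q ^ 2)) (Icc q₂ q₁) q := by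
    intro q hq
    have h1 := (((hasDerivWithinAt_id q (Icc q₂ q₁)).const_mul β).const_add α).inv
      (hm0.trans_le (hlow q hq)).ne'
    refine h1.congr_deriv ?_
    simp only [hu, id]
    field_simp
  have hτd : ∀ q ∈ Icc q₂ q₁, HasDerivWithinAt τ (2 * (u q + q * -(β * u q ^ 2)))
      (Icc q₂ q₁) q := by
    intro q hq
    have h1 := (((hasDerivWithinAt_id q (Icc q₂ q₁)).mul (hud q hq)).sub_const (u₂ * q₂)).const_mul 2
    refine h1.congr_deriv ?_
    simp only [id]
    ring
  have hτ' : ∀ q ∈ Icc q₂ q₁, 2 * (u q + q * -(β * u q ^ 2)) = 2 * (α * u q ^ 2) := by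
    intro q hq
    have h1 := hmul q hq
    have : u q = u q ^ 2 * (α + β * q) := by rw [pow_two, mul_assoc, h1, mul_one]
    linear_combination 2 * this
  -- The viscous error in the derivative is at most `ε n α u(q) / q`; it is bounded with `u ≤ u₁ +
  -- u₂` and `q ≥ q₂`, then integrated over an interval of length `q₁ - q₂`.
  refine ⟨n * α * (u₁ + u₂) / q₂ * (q₁ - q₂), fun ε hε => ?_⟩
  set C := n * α * (u₁ + u₂) / q₂ with hC
  set H : ℝ → ℝ := fun s => 1 / s * Real.log
    (P.op (u s) (fun y => Real.exp (s * P.viscousHJ ε (τ s) f y)) x) with hH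
  have hder : ∀ q ∈ Icc q₂ q₁, ∃ d ≤ 0, HasDerivWithinAt
      (fun s => H s - n / 2 * (1 / s * Real.log (α * u s)) - ε * C * s) d (Icc q₂ q₁) q := by
    intro q hq
    have hq0 : 0 < q := hq₂.trans_le hq.1
    have hu0 := hupos q hq
    have hαu : 0 < α * u q := mul_pos hα0 hu0
    obtain ⟨d, hd, hHd⟩ := hCD.hasDerivWithinAt_log_op_exp hA hn hf hε hq hq0 hupos hτ0 (hud q hq)
      (hτd q hq) rfl (by rw [hτ' q hq]; positivity) x
    rw [hτ' q hq] at hd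
    have hB := (((hasDerivWithinAt_inv hq0.ne' (Icc q₂ q₁)).mul
      (((hud q hq).const_mul α).log hαu.ne')).const_mul (n / 2))
    have hfin := (hHd.sub hB).sub ((hasDerivWithinAt_id q (Icc q₂ q₁)).const_mul (ε * C))
    refine ⟨_, ?_, hfin.congr_of_mem (fun s _ => ?_) hq⟩
    · have ea : u q / (2 * (α * u q ^ 2) * (q * ε + 1 / 2)) = 1 / (α * u q * (1 + 2 * ε * q)) := by
        field_simp
        ring
      rw [ea] at hd
      have hlog : Real.log (1 / (α * u q * (1 + 2 * ε * q))) ≤ -Real.log (α * u q) := by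
        rw [one_div, Real.log_inv, neg_le_neg_iff]
        refine Real.log_le_log hαu ?_
        have : 0 < 2 * ε * q := by positivity
        nlinarith
      have hd2 : d ≤ n / 2 * (1 / q ^ 2) * (-Real.log (α * u q) + α * u q * (1 + 2 * ε * q) - 1) := by
        refine hd.trans (mul_le_mul_of_nonneg_left ?_ (by positivity))
        rw [one_div_one_div]
        linarith
      -- By this identity, at `ε = 0` the bound `-log(α u) + α u - 1`, with its factor `n / (2 q²)`,
      -- is exactly the derivative of `(n/2)(1/q) log(α u)`.
      have hαβ : α * u q = 1 - β * q * u q := by linarith [hmul q hq]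
      have e1 : n / 2 * (-(q ^ 2)⁻¹ * Real.log (α * u q)
          + q⁻¹ * (α * -(β * u q ^ 2) / (α * u q)))
          = n / 2 * (1 / q ^ 2) * (-Real.log (α * u q) - β * q * u q) := by
        field_simp
        ring
      have e2 : n / 2 * (1 / q ^ 2) * (-Real.log (α * u q) + α * u q * (1 + 2 * ε * q) - 1)
          - n / 2 * (1 / q ^ 2) * (-Real.log (α * u q) - β * q * u q) = ε * (n * α * u q / q) := by
        have : n / 2 * (1 / q ^ 2) * (-Real.log (α * u q) + α * u q * (1 + 2 * ε * q) - 1)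
          - n / 2 * (1 / q ^ 2) * (-Real.log (α * u q) - β * q * u q)
          = n / 2 * (1 / q ^ 2) * (α * u q - (1 - β * q * u q)) + ε * (n * α * u q / q) := by
          field_simp
          ring
        rw [this, hαβ]
        ring
      have e3 : n * α * u q / q ≤ C := by
        rw [hC]
        refine div_le_div₀ (by positivity) ?_ hq₂ hq.1
        exact mul_le_mul_of_nonneg_left (hule q hq) (by positivity)
      have e4 := mul_le_mul_of_nonneg_left e3 hε.le
      refine (sub_le_sub_right (sub_le_sub_left (le_of_eq e1.symm) _) _).trans ?_
      linarith
    · simp only [hH, Pi.sub_apply, Pi.mul_apply, one_div, id]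
  choose! d hd0 hd using hder
  have hanti := antitoneOn_of_hasDerivWithinAt_nonpos (convex_Icc q₂ q₁)
    (fun r hr => (hd r hr).continuousWithinAt)
    (fun r hr => (hd r (interior_subset hr)).mono interior_subset)
    (fun r hr => hd0 r (interior_subset hr))
  have hle := hanti (left_mem_Icc.2 hq.le) (right_mem_Icc.2 hq.le) hq.le
  have hτ2 : τ q₂ = 0 := by simp only [hτ, hu2]; ring
  have hτ1 : τ q₁ = t := by simp only [hτ, hu1, htu]; ring
  simp only [hH, hu1, hu2, hτ1, hτ2, viscousHJ_zero hA hf hε] at hle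
  have eα1 : Real.log (α * u₁) = -Real.log ((q₁ - q₂) / (u₁ * q₁ - u₂ * q₂)) - Real.log u₂ := by
    rw [← Real.log_inv, ← Real.log_div (by positivity) (by positivity)]
    congr 1
    rw [hα]; field_simp
  have eα2 : Real.log (α * u₂) = -Real.log ((q₁ - q₂) / (u₁ * q₁ - u₂ * q₂)) - Real.log u₁ := by
    rw [← Real.log_inv, ← Real.log_div (by positivity) (by positivity)]
    congr 1
    rw [hα]; field_simp
  rw [eα1, eα2] at hle
  linarith

/-- The logarithm of the hypercontractivity constant. -/
lemma hypercontractive_const_eq_exp {n q₁ q₂ u₁ u₂ p : ℝ} (hq : q₂ < q₁) (hu₁ : 0 < u₁)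
    (hu₂ : 0 < u₂) (hk : 0 < u₁ * q₁ - u₂ * q₂) (hp : 0 < p) :
    p ^ (1 / q₂) * (u₁ ^ (1 / q₂) / u₂ ^ (1 / q₁) *
        ((q₁ - q₂) / (u₁ * q₁ - u₂ * q₂)) ^ (1 / q₂ - 1 / q₁)) ^ (n / 2)
      = Real.exp (1 / q₂ * Real.log p + n / 2 * (1 / q₂ * Real.log u₁ - 1 / q₁ * Real.log u₂
          + (1 / q₂ - 1 / q₁) * Real.log ((q₁ - q₂) / (u₁ * q₁ - u₂ * q₂)))) := by
  have hqq : 0 < q₁ - q₂ := sub_pos.2 hq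
  have h1 : 0 < (q₁ - q₂) / (u₁ * q₁ - u₂ * q₂) := by positivity
  rw [Real.rpow_def_of_pos hp, Real.rpow_def_of_pos hu₁, Real.rpow_def_of_pos hu₂,
    Real.rpow_def_of_pos h1, ← Real.exp_sub, ← Real.exp_add, ← Real.exp_mul, ← Real.exp_add]
  congr 1
  ring

lemma isBoundedUnder_viscousHJ (hA : P.IsDiffusionAlgebra A) {f : E → ℝ} (hf : f ∈ A) {t : ℝ}
    (ht : 0 ≤ t) (x : E) :
    (𝓝[>] (0 : ℝ)).IsBoundedUnder (· ≤ ·) (fun ε => P.viscousHJ ε t f x) ∧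
      (𝓝[>] (0 : ℝ)).IsBoundedUnder (· ≥ ·) (fun ε => P.viscousHJ ε t f x) := by
  obtain ⟨C, hC⟩ := hA.bounded f hf
  constructor
  · refine isBoundedUnder_of_eventually_le (a := C) ?_
    filter_upwards [self_mem_nhdsWithin] with ε hε
    exact (abs_le.1 (abs_viscousHJ_le hA hf hC hε ht x)).2
  · refine isBoundedUnder_of_eventually_ge (a := -C) ?_
    filter_upwards [self_mem_nhdsWithin] with ε hε
    exact (abs_le.1 (abs_viscousHJ_le hA hf hC hε ht x)).1

/-- Fatou's lemma for the vanishing viscosity limit. -/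
lemma op_exp_hamiltonJacobi_le (hA : P.IsDiffusionAlgebra A) {f : E → ℝ} (hf : f ∈ A)
    {q u t R C : ℝ} (hq : 0 < q) (hu : 0 ≤ u) (ht : 0 ≤ t) (x : E)
    (h : ∀ ε > 0, P.op u (fun y => Real.exp (q * P.viscousHJ ε t f y)) x
      ≤ Real.exp (R + ε * C)) :
    P.op u (fun y => Real.exp (q * P.hamiltonJacobi t f y)) x ≤ Real.exp R := by
  by_cases hi : Integrable (fun y => Real.exp (q * P.hamiltonJacobi t f y)) (P.kernel u x)
  -- Without integrability the integral takes its default value 0, and the bound is trivial.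
  swap
  · rw [op, integral_undef hi]
    exact (Real.exp_pos _).le
  set e : ℕ → ℝ := fun k => 1 / ((k : ℝ) + 1) with he
  have he0 : ∀ k, 0 < e k := fun k => by positivity
  have het : Tendsto e atTop (𝓝[>] 0) :=
    tendsto_nhdsWithin_iff.2 ⟨tendsto_one_div_add_atTop_nhds_zero_nat, Eventually.of_forall he0⟩
  have hm : ∀ k, (fun y => Real.exp (q * P.viscousHJ (e k) t f y)) ∈ A := fun k =>
    exp_mem hA (A.smul_mem (viscousHJ_mem hA hf (he0 k) ht) q)
  have hpt : ∀ y, ENNReal.ofReal (Real.exp (q * P.hamiltonJacobi t f y))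
      ≤ liminf (fun k => ENNReal.ofReal (Real.exp (q * P.viscousHJ (e k) t f y))) atTop := by
    intro y
    obtain ⟨b1, b2⟩ := isBoundedUnder_viscousHJ hA hf ht y
    have hmono : Monotone fun z : ℝ => ENNReal.ofReal (Real.exp (q * z)) := fun a b hab =>
      ENNReal.ofReal_le_ofReal (Real.exp_le_exp.2 (mul_le_mul_of_nonneg_left hab hq.le))
    have hc : Continuous fun z : ℝ => ENNReal.ofReal (Real.exp (q * z)) :=
      ENNReal.continuous_ofReal.comp (by fun_prop)
    have := hmono.map_liminf_of_continuousAt (F := 𝓝[>] (0 : ℝ))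
      (fun ε => P.viscousHJ ε t f y) hc.continuousAt b1.isCoboundedUnder_ge b2
    rw [hamiltonJacobi]
    refine (le_of_eq this).trans ?_
    -- Fatou's lemma needs a sequence; along `ε = 1/(k+1)` the lower limit can only grow, which is
    -- the favourable direction.
    exact (liminf_le_liminf_of_le het).trans (le_of_eq (liminf_comp _ e atTop).symm)
  have key : ENNReal.ofReal (P.op u (fun y => Real.exp (q * P.hamiltonJacobi t f y)) x)
      ≤ ENNReal.ofReal (Real.exp R) := by
    rw [op, ofReal_integral_eq_lintegral_ofReal hi
      (Eventually.of_forall fun y => (Real.exp_pos _).le)]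
    refine (lintegral_mono hpt).trans ((lintegral_liminf_le fun k =>
      ENNReal.measurable_ofReal.comp (hA.measurable _ (hm k))).trans ?_)
    have e1 : ∀ k, ∫⁻ y, ENNReal.ofReal (Real.exp (q * P.viscousHJ (e k) t f y)) ∂(P.kernel u x)
        ≤ ENNReal.ofReal (Real.exp (R + e k * C)) := fun k => by
      rw [← ofReal_integral_eq_lintegral_ofReal (hA.integrable (hm k) hu x)
        (Eventually.of_forall fun y => (Real.exp_pos _).le)]
      exact ENNReal.ofReal_le_ofReal (h _ (he0 k))
    refine (liminf_le_liminf (Eventually.of_forall e1)).trans (le_of_eq ?_)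
    refine Tendsto.liminf_eq ?_
    have hc : Continuous fun z : ℝ => ENNReal.ofReal (Real.exp (R + z * C)) :=
      ENNReal.continuous_ofReal.comp (by fun_prop)
    exact (hc.tendsto' 0 _ (by simp)).comp (tendsto_nhdsWithin_iff.1 het).1
  exact (ENNReal.ofReal_le_ofReal_iff (Real.exp_pos _).le).1 key

/-- The curvature-dimension criterion implies dimensional hypercontractivity. -/
theorem CurvatureDimension.hypercontractive (hA : P.IsDiffusionAlgebra A) {n : ℝ} (hn : 0 < n)
    (hCD : P.CurvatureDimension A 0 n) {q₁ q₂ u₁ u₂ t : ℝ} (hq₂ : 0 < q₂) (hq : q₂ < q₁)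
    (hu₁ : 0 < u₁) (hu₂ : 0 < u₂) (ht : 0 < t) (htu : t = 2 * (u₁ * q₁ - u₂ * q₂)) {f : E → ℝ}
    (hf : f ∈ A) (x : E) :
    (P.op u₁ (fun y => Real.exp (q₁ * P.hamiltonJacobi t f y)) x) ^ (1 / q₁) ≤
      (P.op u₂ (fun y => Real.exp (q₂ * f y)) x) ^ (1 / q₂) *
        (u₁ ^ (1 / q₂) / u₂ ^ (1 / q₁) *
          ((q₁ - q₂) / (u₁ * q₁ - u₂ * q₂)) ^ (1 / q₂ - 1 / q₁)) ^ (n / 2) := by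
  have hq₁ : 0 < q₁ := hq₂.trans hq
  have hk : 0 < u₁ * q₁ - u₂ * q₂ := by linarith
  have hp : 0 < P.op u₂ (fun y => Real.exp (q₂ * f y)) x :=
    op_exp_pos hA (A.smul_mem hf q₂) hu₂.le x
  rw [hypercontractive_const_eq_exp hq hu₁ hu₂ hk hp]
  obtain ⟨C, hC⟩ := hCD.log_op_exp_viscousHJ_le hA hn hf hq₂ hq hu₁ hu₂ ht htu x
  set R := 1 / q₂ * Real.log (P.op u₂ (fun y => Real.exp (q₂ * f y)) x)
    + n / 2 * (1 / q₂ * Real.log u₁ - 1 / q₁ * Real.log u₂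
      + (1 / q₂ - 1 / q₁) * Real.log ((q₁ - q₂) / (u₁ * q₁ - u₂ * q₂))) with hR
  have h1 := op_exp_hamiltonJacobi_le hA hf hq₁ hu₁.le ht.le x (R := q₁ * R) (C := q₁ * C)
    fun ε hε => by
      have hpos : 0 < P.op u₁ (fun y => Real.exp (q₁ * P.viscousHJ ε t f y)) x :=
        op_exp_pos hA (A.smul_mem (viscousHJ_mem hA hf hε ht.le) q₁) hu₁.le x
      rw [← Real.log_le_iff_le_exp hpos]
      have := mul_le_mul_of_nonneg_left (hC ε hε) hq₁.le
      rw [← mul_assoc, mul_one_div_cancel hq₁.ne', one_mul] at this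
      linarith
  have h0 : 0 ≤ P.op u₁ (fun y => Real.exp (q₁ * P.hamiltonJacobi t f y)) x :=
    integral_nonneg fun y => (Real.exp_pos _).le
  refine (Real.rpow_le_rpow h0 h1 (by positivity)).trans (le_of_eq ?_)
  rw [← Real.exp_mul]
  congr 1
  field_simp

end MarkovSemigroup

/-! ### Tools for the converse implication. -/

lemma UDeriv.smul_const {α : Type*} {q : ℝ → ℝ} {q' r : ℝ} {S : Set ℝ} {f : α → ℝ}
    (hq : HasDerivWithinAt q q' S r) (hf : ∃ C : ℝ, ∀ x, |f x| ≤ C) :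
    UDeriv (fun s y => q s * f y) (fun y => q' * f y) S r := by
  have := (UDeriv.of_scalar (α := α) hq).mul (UDeriv.const f) ⟨|q r|, fun _ => le_rfl⟩ hf
    ⟨|q'|, fun _ => le_rfl⟩ ⟨0, fun _ => by simp⟩
  simpa using this

lemma Jet2.eval {α : Type*} {W : ℝ → α → ℝ} {k₀ k₁ k₂ : α → ℝ} (h : Jet2 W k₀ k₁ k₂) (x : α) :
    Jet2 (fun h (_ : Unit) => W h x) (fun _ => k₀ x) (fun _ => k₁ x) (fun _ => k₂ x) := by
  rw [jet2_iff] at h ⊢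
  exact fun δ hδ => (h δ hδ).mono fun s hs _ => hs x

lemma Jet2.nonpos {W : ℝ → ℝ} {k : ℝ}
    (h : Jet2 (fun s (_ : Unit) => W s) (fun _ => 0) (fun _ => 0) (fun _ => k))
    (hW : ∀ᶠ s in 𝓝[>] (0 : ℝ), W s ≤ 0) : k ≤ 0 := by
  by_contra! hk
  obtain ⟨s, ⟨h1, h2⟩, h3⟩ :=
    (((jet2_iff.1 h (k / 2) (half_pos hk)).and hW).and self_mem_nhdsWithin).exists
  have h3 : 0 < s := h3
  have h4 := (abs_le.1 (h1 ())).1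
  have : 0 < k * s ^ 2 := by positivity
  linarith

lemma deriv_deriv_eq_log {φ : ℝ → ℝ} {c : ℝ} (h : ∀ z, c < z → φ z = Real.log z) {z : ℝ}
    (hz : c < z) : deriv (deriv φ) z = -(z ^ 2)⁻¹ := by
  have e : deriv φ =ᶠ[𝓝 z] fun z => z⁻¹ := by
    filter_upwards [Ioi_mem_nhds hz] with y hy
    rw [MarkovSemigroup.deriv_eq_inv_of_eq_log h hy, one_div]
  rw [e.deriv_eq, deriv_inv]

/-- By continuity and density, the lower limit over real `ε` is determined by rational `ε`, hence by
countably many functions. -/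
lemma eventually_le_nhdsGT_iff_rat {F : ℝ → ℝ} (hF : ContinuousOn F (Ioi 0)) (a : ℝ) :
    (∀ᶠ ε in 𝓝[>] (0 : ℝ), a ≤ F ε) ↔
      ∀ᶠ q : ℚ in comap ((↑) : ℚ → ℝ) (𝓝[>] 0), a ≤ F q := by
  constructor
  · exact fun h => tendsto_comap.eventually h
  · intro h
    rw [eventually_comap] at h
    obtain ⟨η, hη, hs⟩ := mem_nhdsGT_iff_exists_Ioo_subset.1 h
    filter_upwards [Ioo_mem_nhdsGT hη] with ε hε
    have hcl : ε ∈ closure (Ioo 0 η ∩ range ((↑) : ℚ → ℝ)) :=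
      Rat.denseRange_cast.open_subset_closure_inter isOpen_Ioo hε
    have hc : ContinuousWithinAt F (Ioo 0 η ∩ range ((↑) : ℚ → ℝ)) ε :=
      (hF ε hε.1).mono fun z hz => hz.1.1
    have := mem_closure_iff_nhdsWithin_neBot.1 hcl
    refine ge_of_tendsto hc ?_
    filter_upwards [self_mem_nhdsWithin] with z hz
    obtain ⟨q, rfl⟩ := hz.2
    exact hs hz.1 q rfl

namespace MarkovSemigroup

variable {E : Type*} [MeasurableSpace E] {P : MarkovSemigroup E} {A : Subalgebra ℝ (E → ℝ)}

/-! ### Regularity and lower bounds for the Hamilton–Jacobi semigroup -/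

lemma continuousOn_viscousHJ (hA : P.IsDiffusionAlgebra A) {f : E → ℝ} (hf : f ∈ A) {t : ℝ}
    (ht : 0 ≤ t) (x : E) : ContinuousOn (fun ε => P.viscousHJ ε t f x) (Ioi 0) := by
  have key : ContinuousOn
      (fun ε => P.op (ε * t) (fun y => Real.exp (-1 / (2 * ε) * f y)) x) (Ioi 0) := by
    intro ε hε
    have hε : 0 < ε := hε
    have hq : DifferentiableWithinAt ℝ (fun s : ℝ => -1 / (2 * s)) (Ioi 0) ε := by
      have : DifferentiableAt ℝ (fun s : ℝ => -1 / (2 * s)) ε :=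
        DifferentiableAt.div (by fun_prop) (by fun_prop) (by positivity)
      exact this.differentiableWithinAt
    have hU := (UDeriv.smul_const hq.hasDerivWithinAt (hA.bounded f hf)).comp Real.contDiff_exp
      (hA.bounded _ (A.smul_mem hf (-1 / (2 * ε)))) (hA.bounded _ (A.smul_mem hf _))
    simp only [Real.deriv_exp] at hU
    have hu : HasDerivWithinAt (fun s : ℝ => s * t) (1 * t) (Ioi 0) ε :=
      (hasDerivWithinAt_id ε _).mul_const t
    have hm : ∀ s : ℝ, (fun y => Real.exp (s * f y)) ∈ A := fun s => exp_mem hA (A.smul_mem hf s)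
    exact (hasDerivWithinAt_op_curve hA hε hu
      (fun s (hs : 0 < s) => mul_nonneg hs.le ht) (fun s _ => hm _)
      (A.mul_mem (hm _) (A.smul_mem hf _)) hU x).continuousWithinAt
  have e : ∀ ε : ℝ, (fun y => Real.exp (-1 / (2 * ε) * f y))
      = fun y => Real.exp (-f y / (2 * ε)) := fun ε => by
    ext y
    congr 1
    ring
  simp only [e] at key
  refine ContinuousOn.mul (by fun_prop) (ContinuousOn.log key fun ε hε => ?_)
  have hε : 0 < ε := hε
  exact (op_exp_pos hA (neg_div_mem hf ε) (mul_nonneg hε.le ht) x).ne'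

/-- Together with the bound on `Q_t f`, this makes `e^{q Q_t f}` integrable. The converse needs it:
with the default value 0 of the integral, hypercontractivity would carry no information. -/
lemma measurable_hamiltonJacobi (hA : P.IsDiffusionAlgebra A) {f : E → ℝ} (hf : f ∈ A) {t : ℝ}
    (ht : 0 ≤ t) : Measurable (P.hamiltonJacobi t f) := by
  have h1 : P.hamiltonJacobi t f
      = fun x => liminf (fun q : ℚ => P.viscousHJ (max (q : ℝ) 0) t f x)
        (comap ((↑) : ℚ → ℝ) (𝓝[>] 0)) := by
    ext x
    simp only [hamiltonJacobi, liminf_eq]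
    congr 1
    ext a
    rw [mem_ofPred_eq, mem_ofPred_eq, eventually_le_nhdsGT_iff_rat (continuousOn_viscousHJ hA hf ht x)]
    have hpos : ∀ᶠ q : ℚ in comap ((↑) : ℚ → ℝ) (𝓝[>] 0), (0 : ℝ) < q :=
      tendsto_comap.eventually self_mem_nhdsWithin
    refine eventually_congr (hpos.mono fun q hq => ?_)
    rw [max_eq_left hq.le]
  rw [h1]
  -- Measurability is required for every index, not only eventually; truncating at 0 gives the zero
  -- function for nonpositive rationals.
  have hm : ∀ q : ℚ, Measurable fun x => P.viscousHJ (max (q : ℝ) 0) t f x := by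
    intro q
    rcases le_or_gt (q : ℝ) 0 with h | h
    · rw [max_eq_right h]
      simp [viscousHJ]
    · rw [max_eq_left h.le]
      exact hA.measurable _ (viscousHJ_mem hA hf h ht)
  obtain ⟨b, hb⟩ := ((𝓝[>] (0 : ℝ)).comap ((↑) : ℚ → ℝ)).exists_antitone_basis
  exact Measurable.liminf' hm ⟨hb.toHasBasis, to_countable _⟩ fun _ => to_countable _

lemma abs_hamiltonJacobi_le (hA : P.IsDiffusionAlgebra A) {f : E → ℝ} (hf : f ∈ A) {C : ℝ}
    (hC : ∀ x, |f x| ≤ C) {t : ℝ} (ht : 0 ≤ t) (x : E) : |P.hamiltonJacobi t f x| ≤ C := by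
  obtain ⟨b1, b2⟩ := isBoundedUnder_viscousHJ hA hf ht x
  have h : ∀ᶠ ε in 𝓝[>] (0 : ℝ), |P.viscousHJ ε t f x| ≤ C := by
    filter_upwards [self_mem_nhdsWithin] with ε hε
    exact abs_viscousHJ_le hA hf hC hε ht x
  rw [abs_le]
  constructor
  · exact le_liminf_of_le b1.isCoboundedUnder_ge (h.mono fun ε hε => (abs_le.1 hε).1)
  · refine liminf_le_of_frequently_le (h.mono fun ε hε => (abs_le.1 hε).2).frequently b2

/-- Subsolutions of the Hamilton–Jacobi equation lie below `Q_t f`. -/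
lemma le_hamiltonJacobi_of_subsolution (hA : P.IsDiffusionAlgebra A) {w dw : ℝ → E → ℝ} {t K : ℝ}
    (ht : 0 ≤ t) (hw : ∀ s ∈ Icc 0 t, w s ∈ A) (hdw : ∀ s ∈ Icc 0 t, dw s ∈ A)
    (hU : ∀ s ∈ Icc 0 t, UDeriv w (dw s) (Icc 0 t) s)
    (hsub : ∀ s ∈ Icc 0 t, ∀ y, dw s y + 1 / 2 * P.carre (w s) (w s) y ≤ 0)
    (hK : ∀ s ∈ Icc 0 t, ∀ y, |P.gen (w s) y| ≤ K) (x : E) :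
    w t x ≤ P.hamiltonJacobi t (w 0) x := by
  have h0t : (0 : ℝ) ∈ Icc 0 t := ⟨le_rfl, ht⟩
  have htt : t ∈ Icc 0 t := ⟨ht, le_rfl⟩
  have hw0 := hw 0 h0t
  have key : ∀ ε > 0, w t x - ε * (K * t) ≤ P.viscousHJ ε t (w 0) x := by
    intro ε hε
    set k := -1 / (2 * ε) with hk
    -- The Hopf–Cole transform of a subsolution, interpolated by the semigroup. The factor `e^{K s /
    -- 2}` absorbs the missing viscosity term `ε L w`, so the curve increases, at a cost of only `ε
    -- K t` in the comparison with `v^ε`.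
    have hd : ∀ r ∈ Icc 0 t, HasDerivWithinAt
        (fun s => P.op (ε * (t - s)) (fun y => Real.exp (k * w s y + K / 2 * s)) x)
        (P.op (ε * (t - r)) (fun y => Real.exp (k * w r y + K / 2 * r)
          * (k * dw r y + K / 2 - ε * (k * P.gen (w r) y + k ^ 2 * P.carre (w r) (w r) y))) x)
        (Icc 0 t) r := by
      intro r hr
      have bc : ∀ c : ℝ, ∃ C : ℝ, ∀ _ : E, |c| ≤ C := fun c => ⟨|c|, fun _ => le_rfl⟩
      have hwr := hw r hr
      have hdr := hdw r hr
      have u1 := (UDeriv.const (S := Icc 0 t) (r := r) (fun _ : E => k)).mul (hU r hr) (bc _)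
        (hA.bounded _ hwr) (bc 0) (hA.bounded _ hdr)
      have u2 := UDeriv.of_scalar (α := E) ((hasDerivWithinAt_id r (Icc 0 t)).const_mul (K / 2))
      have u3 : UDeriv (fun s y => k * w s y + K / 2 * s) (fun y => k * dw r y + K / 2)
          (Icc 0 t) r := by simpa using u1.add u2
      have m1 : (fun y => k * w r y + K / 2 * r) ∈ A :=
        A.add_mem (A.smul_mem hwr k) (const_mem A _)
      have m2 : (fun y => k * dw r y + K / 2) ∈ A :=
        A.add_mem (A.smul_mem hdr k) (const_mem A _)
      have u4 := u3.comp Real.contDiff_exp (hA.bounded _ m1) (hA.bounded _ m2)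
      simp only [Real.deriv_exp] at u4
      have hin : HasDerivWithinAt (fun s : ℝ => ε * (t - s)) (-ε) (Icc 0 t) r := by
        simpa using ((hasDerivWithinAt_id r (Icc 0 t)).const_sub t).const_mul ε
      have hs0 : 0 ≤ ε * (t - r) := mul_nonneg hε.le (sub_nonneg.2 hr.2)
      have mE := exp_affine_mem hA hwr k (K / 2 * r)
      have mD : (fun y => Real.exp (k * w r y + K / 2 * r) * (k * dw r y + K / 2)) ∈ A :=
        A.mul_mem mE m2
      have main := hasDerivWithinAt_op_curve hA hr hin
        (fun s hs => mul_nonneg hε.le (sub_nonneg.2 hs.2))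
        (fun s hs => exp_affine_mem hA (hw s hs) k (K / 2 * s)) mD u4 x
      refine main.congr_deriv ?_
      have mL : (fun y => ε * P.gen (fun y => Real.exp (k * w r y + K / 2 * r)) y) ∈ A :=
        A.smul_mem (hA.gen_mem _ mE) ε
      rw [neg_mul, ← P.op_smul, ← sub_eq_add_neg, ← op_sub hA mD mL hs0]
      congr 1
      ext y
      rw [gen_exp_affine hA hwr]
      ring
    have hm := monotoneOn_of_hasDerivWithinAt_nonneg (convex_Icc 0 t)
      (fun r hr => (hd r hr).continuousWithinAt)
      (fun r hr => (hd r (interior_subset hr)).mono interior_subset)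
      (fun r hr => integral_nonneg fun y => by
        have h1 := hsub r (interior_subset hr) y
        have h2 := (abs_le.1 (hK r (interior_subset hr) y)).1
        refine mul_nonneg (Real.exp_pos _).le ?_
        have e : k * dw r y + K / 2 - ε * (k * P.gen (w r) y + k ^ 2 * P.carre (w r) (w r) y)
            = 1 / (2 * ε) * -(dw r y + 1 / 2 * P.carre (w r) (w r) y)
              + 1 / 2 * (K + P.gen (w r) y) := by
          rw [hk]; field_simp; ring
        rw [e]
        have : 0 ≤ 1 / (2 * ε) := by positivity
        exact add_nonneg (mul_nonneg this (by linarith)) (by linarith))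
    have hle := hm h0t htt ht
    simp only [sub_zero, sub_self, mul_zero, add_zero] at hle
    rw [op_zero hA (exp_affine_mem hA (hw t htt) k _)] at hle
    have e : (fun y => Real.exp (k * w 0 y)) = fun y => Real.exp (-w 0 y / (2 * ε)) := by
      ext y
      congr 1
      rw [hk]; ring
    rw [e] at hle
    have hpos := op_exp_pos hA (neg_div_mem hw0 ε) (mul_nonneg hε.le ht) x
    have hlog := (Real.log_le_iff_le_exp hpos).2 hle
    rw [viscousHJ]
    have e2 : w t x - ε * (K * t) = -2 * ε * (k * w t x + K / 2 * t) := by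
      rw [hk]; field_simp; ring
    rw [e2]
    exact mul_le_mul_of_nonpos_left hlog (by linarith)
  have lim : Tendsto (fun ε : ℝ => w t x - ε * (K * t)) (𝓝[>] 0) (𝓝 (w t x)) := by
    have hc : Continuous fun ε : ℝ => w t x - ε * (K * t) := by fun_prop
    exact (hc.tendsto' 0 _ (by simp)).mono_left nhdsWithin_le_nhds
  obtain ⟨b1, b2⟩ := isBoundedUnder_viscousHJ hA hw0 ht x
  rw [hamiltonJacobi, ← lim.liminf_eq]
  refine liminf_le_liminf ?_ lim.isBoundedUnder_ge b1.isCoboundedUnder_ge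
  filter_upwards [self_mem_nhdsWithin] with ε hε using key ε hε

lemma carre_const_right (hA : P.IsDiffusionAlgebra A) {f : E → ℝ} (hf : f ∈ A) (c : ℝ) (x : E) :
    P.carre f (fun _ => c) x = 0 := by
  rw [carre, gen_const, show (fun y => f y * c) = fun y => c * f y from
    funext fun y => mul_comm _ _, gen_const_mul hA hf]
  ring

/-- A first order lower bound for `Q_t f`. -/
lemma exists_le_hamiltonJacobi (hA : P.IsDiffusionAlgebra A) {f : E → ℝ} (hf : f ∈ A) :
    ∃ C : ℝ, ∀ t ∈ Icc (0 : ℝ) 1, ∀ x,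
      f x - t / 2 * P.carre f f x - C * t ^ 2 ≤ P.hamiltonJacobi t f x := by
  have hG := carre_mem hA hf hf
  set G := P.carre f f with hGdef
  obtain ⟨C₁, h₁⟩ := hA.bounded _ (carre_mem hA hf hG)
  obtain ⟨C₂, h₂⟩ := hA.bounded _ (carre_mem hA hG hG)
  obtain ⟨K₁, k₁⟩ := hA.bounded _ (hA.gen_mem _ hf)
  obtain ⟨K₂, k₂⟩ := hA.bounded _ (hA.gen_mem _ hG)
  -- For `w_s = f - (s/2) Γ(f) - C s²`, the first order terms of `∂_s w + Γ(w)/2` cancel, leaving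
  -- `-2 C s - (s/2) Γ(f, Γ(f)) + (s²/8) Γ(Γ(f))`. This is nonpositive for `s ≤ 1` with the present
  -- `C`.
  set C := |C₁| + |C₂| with hC
  refine ⟨C, fun t ht x => ?_⟩
  set w : ℝ → E → ℝ := fun s y => f y + (-(s / 2) * G y + -(C * s ^ 2)) with hw
  have mG : ∀ s : ℝ, (fun y => -(s / 2) * G y) ∈ A := fun s => A.smul_mem hG _
  have mc : ∀ c : ℝ, (fun _ => c : E → ℝ) ∈ A := const_mem A
  have mGc : ∀ s : ℝ, (fun y => -(s / 2) * G y + -(C * s ^ 2)) ∈ A := fun s =>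
    A.add_mem (mG s) (mc _)
  have mw : ∀ s, w s ∈ A := fun s => A.add_mem hf (mGc s)
  have := le_hamiltonJacobi_of_subsolution hA (w := w)
    (dw := fun s y => -(1 / 2) * G y + -(2 * C * s)) (t := t) (K := K₁ + K₂) ht.1
    (fun s _ => mw s) (fun s _ => A.add_mem (A.smul_mem hG _) (mc _)) (fun s hs => ?_)
    (fun s hs y => ?_) (fun s hs y => ?_) x
  · have e0 : w 0 = f := by ext y; simp [hw]
    rw [e0] at this
    refine le_trans (le_of_eq ?_) this
    simp only [hw]
    ring
  · have d1 : HasDerivWithinAt (fun s : ℝ => -(s / 2)) (-(1 / 2)) (Icc 0 t) s :=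
      ((hasDerivWithinAt_id s _).div_const 2).neg
    have d2 : HasDerivWithinAt (fun s : ℝ => -(C * s ^ 2)) (-(2 * C * s)) (Icc 0 t) s := by
      refine ((((hasDerivWithinAt_id s (Icc 0 t)).pow 2).const_mul C).neg).congr_deriv ?_
      simp
      ring
    have hU := (UDeriv.const f).add ((UDeriv.smul_const d1 (hA.bounded _ hG)).add
      (UDeriv.of_scalar (α := E) d2))
    simp only [zero_add] at hU
    exact hU
  · have e : P.carre (w s) (w s) y = G y - s * P.carre f G y + s ^ 2 / 4 * P.carre G G y := by
      have r : ∀ h ∈ A, P.carre h (w s) y = P.carre h f y + -(s / 2) * P.carre h G y := by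
        intro h hh
        rw [hw, carre_add_right hA hh hf (mGc s), carre_add_right hA hh (mG s) (mc _),
          carre_const_mul_right hA hh hG, carre_const_right hA hh]
        ring
      rw [r _ (mw s), carre_comm P (w s) f, carre_comm P (w s) G, r f hf, r G hG,
        carre_comm P G f]
      ring
    rw [e]
    have a1 := (abs_le.1 ((h₁ y).trans (le_abs_self C₁))).1
    have a2 := (abs_le.1 ((h₂ y).trans (le_abs_self C₂))).2
    have s0 := hs.1
    have s1 : s ≤ 1 := hs.2.trans ht.2
    have b1 : s * -|C₁| ≤ s * P.carre f G y := mul_le_mul_of_nonneg_left a1 s0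
    have b2 : s ^ 2 * P.carre G G y ≤ s * |C₂| := by
      have : s ^ 2 * P.carre G G y ≤ s ^ 2 * |C₂| := mul_le_mul_of_nonneg_left a2 (sq_nonneg s)
      have h3 : s ^ 2 ≤ s := by nlinarith
      exact this.trans (mul_le_mul_of_nonneg_right h3 (abs_nonneg _))
    have p1 := mul_nonneg s0 (abs_nonneg C₁)
    have p2 := mul_nonneg s0 (abs_nonneg C₂)
    simp only [hC]
    linarith
  · have e : P.gen (w s) y = P.gen f y + -(s / 2) * P.gen G y := by
      rw [hw, gen_add hA hf (mGc s), gen_add hA (mG s) (mc _), gen_const_mul hA hG, gen_const]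
      ring
    rw [e]
    refine (abs_add_le _ _).trans (add_le_add (k₁ y) ?_)
    rw [abs_mul, abs_neg, abs_of_nonneg (by linarith [hs.1] : 0 ≤ s / 2)]
    have := abs_nonneg (P.gen G y)
    have s1 : s ≤ 1 := hs.2.trans ht.2
    nlinarith [k₂ y]

/-! ### From hypercontractivity to the curvature-dimension criterion -/

/-- Dimensional hypercontractivity, with `q₂ = 1` and `q₁ → 1`, implies the linearized logarithmic
Sobolev inequality. -/
lemma entropy_le_of_hypercontractive (hA : P.IsDiffusionAlgebra A) {n : ℝ} {f : E → ℝ}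
    (hf : f ∈ A) {x : E}
    (h : ∀ q₁ u₁ u₂ t : ℝ, 1 < q₁ → 0 < u₁ → 0 < u₂ → 0 < t → t = 2 * (u₁ * q₁ - u₂ * 1) →
      (P.op u₁ (fun y => Real.exp (q₁ * P.hamiltonJacobi t f y)) x) ^ (1 / q₁) ≤
        (P.op u₂ (fun y => Real.exp (1 * f y)) x) ^ (1 / (1 : ℝ)) *
          (u₁ ^ (1 / (1 : ℝ)) / u₂ ^ (1 / q₁) *
            ((q₁ - 1) / (u₁ * q₁ - u₂ * 1)) ^ (1 / 1 - 1 / q₁)) ^ (n / 2))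
    {u b : ℝ} (hu : 0 < u) (hub : 0 < u + b) :
    (P.op u (fun y => Real.exp (f y) * (f y - (u + b) * P.carre f f y)) x
        + b * P.op u (P.gen fun y => Real.exp (f y)) x) / P.op u (fun y => Real.exp (f y)) x
      ≤ Real.log (P.op u (fun y => Real.exp (f y)) x)
        + n / 2 * (Real.log u + b / u - Real.log (u + b)) := by
  obtain ⟨C, hC⟩ := exists_le_hamiltonJacobi hA hf
  obtain ⟨M, hM⟩ := hA.bounded f hf
  have hG := carre_mem hA hf hf
  -- `T δ = u₁ q₁ - u₂ q₂` for `q₁ = 1 + δ`, `u₁ = u + b δ`, `q₂ = 1`, `u₂ = u`, so that the time is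
  -- `t = 2 T δ`.
  set T : ℝ → ℝ := fun δ => (u + b) * δ + b * δ ^ 2 with hT
  have hsmall : ∀ᶠ δ in 𝓝[≥] (0 : ℝ), 0 < u + b * δ ∧ 0 < u + b + b * δ ∧ 2 * T δ < 1 := by
    have c1 : ContinuousWithinAt (fun δ : ℝ => u + b * δ) (Ici 0) 0 := by fun_prop
    have c2 : ContinuousWithinAt (fun δ : ℝ => u + b + b * δ) (Ici 0) 0 := by fun_prop
    have c3 : ContinuousWithinAt (fun δ : ℝ => 2 * T δ) (Ici 0) 0 := by
      simp only [hT]; fun_prop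
    exact (c1.eventually (lt_mem_nhds (by simpa using hu))).and
      ((c2.eventually (lt_mem_nhds (by simpa using hub))).and
        (c3.eventually (gt_mem_nhds (by simp [hT]))))
  obtain ⟨δ₀, hδ₀, hS⟩ := mem_nhdsGE_iff_exists_Ico_subset.1 hsmall
  have hδ₀ : 0 < δ₀ := hδ₀
  set S := Ico 0 δ₀ with hSdef
  have h0S : (0 : ℝ) ∈ S := ⟨le_rfl, hδ₀⟩
  -- `1 + δ` times the lower bound of `Q_{2T} f`. Unlike `Q_t f`, it lies in the algebra and can be
  -- differentiated at `δ = 0`.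
  set W : ℝ → E → ℝ := fun δ y =>
    (1 + δ) * f y + (-((1 + δ) * T δ) * P.carre f f y + -((1 + δ) * (C * (2 * T δ) ^ 2))) with hW
  have mc : ∀ c : ℝ, (fun _ => c : E → ℝ) ∈ A := const_mem A
  have mW : ∀ δ, W δ ∈ A := fun δ =>
    A.add_mem (A.smul_mem hf _) (A.add_mem (A.smul_mem hG _) (mc _))
  have hid := hasDerivWithinAt_id (0 : ℝ) S
  have dT : HasDerivWithinAt T (u + b) S 0 := by
    refine ((hid.const_mul (u + b)).add ((hid.pow 2).const_mul b)).congr_deriv ?_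
    simp
  have d1 : HasDerivWithinAt (fun δ : ℝ => 1 + δ) 1 S 0 := hid.const_add 1
  have hT0 : T 0 = 0 := by simp [hT]
  have d2 : HasDerivWithinAt (fun δ : ℝ => -((1 + δ) * T δ)) (-(u + b)) S 0 := by
    refine ((d1.mul dT).neg).congr_deriv ?_
    simp [hT0]
  have d3 : HasDerivWithinAt (fun δ : ℝ => -((1 + δ) * (C * (2 * T δ) ^ 2))) 0 S 0 := by
    refine ((d1.mul (((dT.const_mul 2).pow 2).const_mul C)).neg).congr_deriv ?_
    simp [hT0]
  have hUW : UDeriv W (fun y => 1 * f y + (-(u + b) * P.carre f f y + 0)) S 0 :=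
    (UDeriv.smul_const d1 (hA.bounded _ hf)).add ((UDeriv.smul_const d2 (hA.bounded _ hG)).add
      (UDeriv.of_scalar (α := E) d3))
  have hW0 : W 0 = f := by ext y; simp [hW, hT0]
  have mD : (fun y => 1 * f y + (-(u + b) * P.carre f f y + 0)) ∈ A :=
    A.add_mem (A.smul_mem hf _) (A.add_mem (A.smul_mem hG _) (mc 0))
  have hUE := hUW.comp Real.contDiff_exp (hA.bounded _ (mW 0)) (hA.bounded _ mD)
  simp only [Real.deriv_exp, hW0] at hUE
  have hu' : HasDerivWithinAt (fun δ : ℝ => u + b * δ) b S 0 := by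
    simpa using (hid.const_mul b).const_add u
  have hg := exp_mem hA hf
  have hmain := hasDerivWithinAt_op_curve hA h0S hu' (fun δ hδ => (hS hδ).1.le)
    (fun δ _ => exp_mem hA (mW δ)) (A.mul_mem hg mD) hUE x
  simp only [hW0, mul_zero, add_zero] at hmain
  set p := P.op u (fun y => Real.exp (f y)) x with hpdef
  have hp : 0 < p := op_exp_pos hA hf hu.le x
  have hlog := hmain.log (by simp only [hW0, mul_zero, add_zero]; exact hp.ne')
  simp only [hW0, mul_zero, add_zero] at hlog
  have r1 := d1.mul_const (Real.log p)
  have r2 := d1.mul (hu'.log (by simpa using hu.ne'))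
  have hub' : HasDerivWithinAt (fun δ : ℝ => u + b + b * δ) b S 0 := by
    simpa using (hid.const_mul b).const_add (u + b)
  have r3 := hid.mul (hub'.log (by simpa using hub.ne'))
  -- This is the difference of the two sides of hypercontractivity in logarithmic form. It vanishes
  -- at `δ = 0` and is nonpositive for small `δ > 0`, so its right derivative at 0 is nonpositive.
  have hfin := hlog.sub (r1.add (((r2.sub_const (Real.log u)).sub r3).const_mul (n / 2)))
  have hneg : ∀ δ ∈ Ioo 0 δ₀, Real.log (P.op (u + b * δ) (fun y => Real.exp (W δ y)) x)
      ≤ (1 + δ) * Real.log p + n / 2 * ((1 + δ) * Real.log (u + b * δ) - Real.log u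
        - δ * Real.log (u + b + b * δ)) := by
    intro δ hδ
    obtain ⟨s1, s2, s3⟩ := hS ⟨hδ.1.le, hδ.2⟩
    have hδ0 := hδ.1
    have hTδ : T δ = δ * (u + b + b * δ) := by simp only [hT]; ring
    have hT1 : 0 < T δ := by rw [hTδ]; positivity
    have hk : (u + b * δ) * (1 + δ) - u * 1 = T δ := by simp only [hT]; ring
    have hle := h (1 + δ) (u + b * δ) u (2 * T δ) (by linarith) s1 hu (by linarith) (by rw [hk])
    simp only [one_mul] at hle
    rw [hypercontractive_const_eq_exp (by linarith) s1 hu (by rw [hk]; exact hT1) hp, hk] at hle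
    have := P.isMarkov (u + b * δ) s1.le
    have hint : Integrable (fun y => Real.exp ((1 + δ) * P.hamiltonJacobi (2 * T δ) f y))
        (P.kernel (u + b * δ) x) := by
      refine Integrable.of_bound (Real.measurable_exp.comp
        ((measurable_hamiltonJacobi hA hf (by linarith)).const_mul _)).aestronglyMeasurable
        (Real.exp ((1 + δ) * M)) (Eventually.of_forall fun y => ?_)
      rw [Real.norm_eq_abs, abs_of_pos (Real.exp_pos _), Real.exp_le_exp]
      exact mul_le_mul_of_nonneg_left
        (abs_le.1 (abs_hamiltonJacobi_le hA hf hM (by linarith) y)).2 (by linarith)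
    have hWQ : P.op (u + b * δ) (fun y => Real.exp (W δ y)) x
        ≤ P.op (u + b * δ) (fun y => Real.exp ((1 + δ) * P.hamiltonJacobi (2 * T δ) f y)) x := by
      refine integral_mono (hA.integrable (exp_mem hA (mW δ)) s1.le x) hint fun y => ?_
      refine Real.exp_le_exp.2 ?_
      have := mul_le_mul_of_nonneg_left (hC (2 * T δ) ⟨by linarith, s3.le⟩ y)
        (by linarith : 0 ≤ 1 + δ)
      refine le_trans (le_of_eq ?_) this
      simp only [hW]
      ring
    have hWpos := op_exp_pos hA (mW δ) s1.le x
    have h5 := (Real.rpow_le_rpow hWpos.le hWQ (by positivity)).trans hle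
    rw [Real.rpow_def_of_pos hWpos, Real.exp_le_exp] at h5
    have h6 := mul_le_mul_of_nonneg_left h5 (by linarith : 0 ≤ 1 + δ)
    have e1 : (1 + δ) * (Real.log (P.op (u + b * δ) (fun y => Real.exp (W δ y)) x) * (1 / (1 + δ)))
        = Real.log (P.op (u + b * δ) (fun y => Real.exp (W δ y)) x) := by
      field_simp
    rw [e1] at h6
    -- `T δ` is divisible by `δ`, so the quotient, singular in form, has the regular value `1 / (u +
    -- b + b δ)`.
    have e2 : Real.log ((1 + δ - 1) / T δ) = -Real.log (u + b + b * δ) := by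
      rw [← Real.log_inv]
      congr 1
      rw [hTδ]
      field_simp
      ring
    rw [e2] at h6
    refine h6.trans (le_of_eq ?_)
    field_simp
    ring
  have hd := hfin.mono (Ioo_subset_Ico_self : Ioo 0 δ₀ ⊆ S)
  rw [hasDerivWithinAt_iff_tendsto_slope' (by simp)] at hd
  have : (𝓝[Ioo 0 δ₀] (0 : ℝ)).NeBot := by
    rw [nhdsWithin_Ioo_eq_nhdsGT hδ₀]; infer_instance
  have hnonpos := le_of_tendsto (b := 0) hd ?_
  · simp only [add_zero, mul_zero, id, one_mul, zero_mul] at hnonpos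
    have e : (fun y => Real.exp (f y) * (f y - (u + b) * P.carre f f y))
        = (fun y => Real.exp (f y)) * fun y => f y + -(u + b) * P.carre f f y := by
      ext y
      simp only [Pi.mul_apply]
      ring
    rw [e]
    linarith
  · filter_upwards [self_mem_nhdsWithin] with δ hδ
    have h1 := hneg δ hδ
    rw [slope_def_field]
    refine div_nonpos_of_nonpos_of_nonneg ?_ (by linarith [hδ.1])
    simp only [Pi.sub_apply, Pi.add_apply, Pi.mul_apply, id, hW0, mul_zero, add_zero, one_mul,
      zero_mul, sub_self, ← hpdef]
    linarith

/-- The linearized logarithmic Sobolev inequality for small times implies the curvature-dimension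
bound. -/
lemma carre2_ge_of_entropy_le (hA : P.IsDiffusionAlgebra A) {n : ℝ} (hn : 0 < n) {f : E → ℝ}
    (hf : f ∈ A) {x : E}
    (h : ∀ u b : ℝ, 0 < u → 0 < u + b →
      (P.op u (fun y => Real.exp (f y) * (f y - (u + b) * P.carre f f y)) x
          + b * P.op u (P.gen fun y => Real.exp (f y)) x) / P.op u (fun y => Real.exp (f y)) x
        ≤ Real.log (P.op u (fun y => Real.exp (f y)) x)
          + n / 2 * (Real.log u + b / u - Real.log (u + b))) :
    1 / n * P.gen f x ^ 2 ≤ P.carre2 f x := by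
  have hg := exp_mem hA hf
  have hG := carre_mem hA hf hf
  have mF : (fun y => Real.exp (f y) * f y) ∈ A := A.mul_mem hg hf
  have mN : (fun y => Real.exp (f y) * P.carre f f y) ∈ A := A.mul_mem hg hG
  have mL := hA.gen_mem _ hg
  obtain ⟨c₀, hc₀, hc₀G⟩ := exists_le_op_exp hA hf
  obtain ⟨φ, hφ, hlog⟩ := exists_contDiff_eq_log (half_pos hc₀)
  -- `χ` stands for the logarithm at `1 - c u`, which exceeds `1/2` for small `u`.
  obtain ⟨χ, hχ, hχlog⟩ := exists_contDiff_eq_log (one_half_pos (α := ℝ))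
  have hgc : c₀ / 2 < Real.exp (f x) := by
    have := hc₀G 0 le_rfl x
    rw [op_zero hA hg] at this
    linarith
  -- With `b = -c u²`, the second order coefficient is `e^f (-Γ₂(f) - c L f - n c² / 4)`. This `c`
  -- maximizes it, the maximum being `e^f ((L f)² / n - Γ₂(f))`.
  set c := -(2 / n) * P.gen f x with hc
  have b : ∀ c : ℝ, ∃ C : ℝ, ∀ _ : Unit, |c| ≤ C := fun c => ⟨|c|, fun _ => le_rfl⟩
  have jF := (jet2_op hA mF).eval x
  have jN := (jet2_op hA mN).eval x
  have jL := (jet2_op hA mL).eval x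
  have jp := (jet2_op hA hg).eval x
  have jplogp := jp.comp (φ := fun z => z * φ z) (contDiff_id.mul hφ) (b _) (b _) (b _)
  have ju := Jet2.fst (α := Unit)
  have jz := (Jet2.const fun _ : Unit => c).mul ju (b _) (b _) (b _) (b _) (b _) (b _)
  have j1z := (Jet2.const fun _ : Unit => (1 : ℝ)).add
    ((Jet2.const fun _ : Unit => (-1 : ℝ)).mul jz (b _) (b _) (b _) (b _) (b _) (b _))
  have jl := j1z.comp hχ (b _) (b _) (b _)
  have jk := jp.mul ((Jet2.const fun _ : Unit => n / 2).mul (jl.add jz)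
    (b _) (b _) (b _) (b _) (b _) (b _)) (b _) (b _) (b _) (b _) (b _) (b _)
  have juN := (ju.mul j1z (b _) (b _) (b _) (b _) (b _) (b _)).mul jN
    (b _) (b _) (b _) (b _) (b _) (b _)
  have juL := (ju.mul jz (b _) (b _) (b _) (b _) (b _) (b _)).mul jL
    (b _) (b _) (b _) (b _) (b _) (b _)
  have jm := fun {W : ℝ → Unit → ℝ} {k₀ k₁ k₂ : ℝ}
    (hj : Jet2 W (fun _ => k₀) (fun _ => k₁) (fun _ => k₂)) =>
    (Jet2.const fun _ : Unit => (-1 : ℝ)).mul hj (b _) (b _) (b _) (b _) (b _) (b _)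
  have total := (((jF.add (jm juN)).add (jm juL)).add (jm jplogp)).add jk
  have hc1 : χ (1 + -1 * (c * 0)) = 0 := by
    rw [hχlog _ (by norm_num)]; simp
  have hc2 : deriv χ (1 + -1 * (c * 0)) = 1 := by
    rw [deriv_eq_inv_of_eq_log hχlog (by norm_num)]; simp
  have hc3 : deriv (deriv χ) (1 + -1 * (c * 0)) = -1 := by
    rw [deriv_deriv_eq_log hχlog (by norm_num)]; simp
  have d1 : deriv (fun z => z * φ z) (Real.exp (f x)) = 1 + f x := by
    rw [deriv_mul_of_eq_log (half_pos hc₀) hlog hgc, Real.log_exp]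
  have d2 : deriv (deriv fun z => z * φ z) (Real.exp (f x)) = 1 / Real.exp (f x) :=
    deriv_deriv_mul_of_eq_log (half_pos hc₀) hlog hgc
  have hsmall : ∀ᶠ u in 𝓝[>] (0 : ℝ), c * u < 1 / 2 := by
    have hcont : ContinuousWithinAt (fun u : ℝ => c * u) (Ioi 0) 0 := by fun_prop
    exact hcont.eventually (gt_mem_nhds (by simp))
  have hfinal := total.congr (V := fun u (_ : Unit) =>
      P.op u (fun y => Real.exp (f y) * f y) x
        - u * (1 - c * u) * P.op u (fun y => Real.exp (f y) * P.carre f f y) x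
        - u * (c * u) * P.op u (P.gen fun y => Real.exp (f y)) x
        - P.op u (fun y => Real.exp (f y)) x * Real.log (P.op u (fun y => Real.exp (f y)) x)
        + P.op u (fun y => Real.exp (f y)) x * (n / 2 * (Real.log (1 - c * u) + c * u)))
    (j₀ := fun _ => 0) (j₁ := fun _ => 0)
    (j₂ := fun _ => Real.exp (f x) * (1 / n * P.gen f x ^ 2 - P.carre2 f x)) ?_ ?_ ?_ ?_
  · have hle := hfinal.nonpos ?_
    · have hE := Real.exp_pos (f x)
      have := nonpos_of_mul_nonpos_right hle hE
      linarith
    filter_upwards [hsmall, self_mem_nhdsWithin] with u hu1 hu0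
    have hu0 : 0 < u := hu0
    have h1z : 0 < 1 - c * u := by linarith
    -- With this `b`, the singular terms `log u` and `log(u + b)` combine into `-log(1 - c u)`,
    -- which has a regular expansion at 0.
    have hub : u + -(u * (c * u)) = u * (1 - c * u) := by ring
    have key := h u (-(u * (c * u))) hu0 (by rw [hub]; positivity)
    have hp := op_exp_pos hA hf hu0.le x
    rw [div_le_iff₀ hp, hub, Real.log_mul hu0.ne' h1z.ne'] at key
    have e1 : P.op u (fun y => Real.exp (f y) * (f y - u * (1 - c * u) * P.carre f f y)) x
        = P.op u (fun y => Real.exp (f y) * f y) x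
          - u * (1 - c * u) * P.op u (fun y => Real.exp (f y) * P.carre f f y) x := by
      have m2 : (fun y => u * (1 - c * u) * (Real.exp (f y) * P.carre f f y)) ∈ A :=
        A.smul_mem mN _
      rw [← P.op_smul, ← op_sub hA mF m2 hu0.le]
      congr 1
      ext y
      ring
    have e2 : -(u * (c * u)) / u = -(c * u) := by field_simp
    rw [e1, e2] at key
    linarith
  · filter_upwards [hsmall, self_mem_nhdsWithin] with u hu1 hu0 _
    have hu0 : 0 < u := hu0
    have hpc : c₀ / 2 < P.op u (fun y => Real.exp (f y)) x := by
      linarith [hc₀G u hu0.le x]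
    rw [hlog _ hpc, hχlog _ (by linarith)]
    rw [show 1 + -1 * (c * u) = 1 - c * u by ring]
    ring
  · intro _
    rw [hc1, hlog _ hgc, Real.log_exp]
    ring
  · intro _
    rw [hc1, hc2, d1, gen_exp_mul_self hA hf]
    ring
  · intro _
    rw [hc1, hc2, hc3, d1, d2]
    have e1 := entropy_second_order hA hf x
    have e2 := gen_gen_exp_mul_self hA hf x
    have e3 := gen_exp hA hf x
    have hE := (Real.exp_pos (f x)).ne'
    have e4 : Real.exp (f x) * P.carre2 f x
        = P.gen (fun y => Real.exp (f y) * P.carre f f y) x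
          - P.gen (P.gen fun y => Real.exp (f y) * f y) x / 2
          + ((1 + f x) * (P.gen (P.gen fun z => Real.exp (f z)) x / 2)
          + 1 / Real.exp (f x) / 2 * P.gen (fun z => Real.exp (f z)) x ^ 2) := by
      linarith
    rw [mul_sub, e4]
    have e5 : Real.exp (f x) * (1 / n * P.gen f x ^ 2)
        = -(Real.exp (f x) * (c * P.gen f x)) - n / 4 * c ^ 2 * Real.exp (f x) := by
      rw [hc]; field_simp; ring
    have e6 : c * P.gen (fun y => Real.exp (f y)) x
        = Real.exp (f x) * (c * P.gen f x) + c * (Real.exp (f x) * P.carre f f x) := by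
      rw [e3]; ring
    rw [e5]
    linear_combination e6

end MarkovSemigroup

/-! ### The equivalence. -/

theorem mainTheorem3 {E : Type*} [MeasurableSpace E] (P : MarkovSemigroup E)
    (A : Subalgebra ℝ (E → ℝ)) (hA : P.IsDiffusionAlgebra A) (n : ℝ) (hn : 1 ≤ n) :
    P.CurvatureDimension A 0 n ↔
      ∀ q₁ q₂ u₁ u₂ t : ℝ, 0 < q₂ → q₂ < q₁ → 0 < u₁ → 0 < u₂ → 0 < t →
        t = 2 * (u₁ * q₁ - u₂ * q₂) →
        ∀ f ∈ A, ∀ x,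
          (P.op u₁ (fun y => Real.exp (q₁ * P.hamiltonJacobi t f y)) x) ^ (1 / q₁) ≤
            (P.op u₂ (fun y => Real.exp (q₂ * f y)) x) ^ (1 / q₂) *
              (u₁ ^ (1 / q₂) / u₂ ^ (1 / q₁) *
                ((q₁ - q₂) / (u₁ * q₁ - u₂ * q₂)) ^ (1 / q₂ - 1 / q₁)) ^ (n / 2) := by
  have hn0 : 0 < n := by linarith
  constructor
  · intro hCD q₁ q₂ u₁ u₂ t hq₂ hq hu₁ hu₂ ht htu f hf x
    exact hCD.hypercontractive hA hn0 hq₂ hq hu₁ hu₂ ht htu hf x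
  · intro h f hf x
    rw [zero_mul, zero_add]
    -- Hypercontractivity enters only through `q₂ = 1` and `q₁` close to 1.
    exact MarkovSemigroup.carre2_ge_of_entropy_le hA hn0 hf fun u b hu hub =>
      MarkovSemigroup.entropy_le_of_hypercontractive hA hf
        (fun q₁ u₁ u₂ t hq hu₁ hu₂ ht htu => h q₁ 1 u₁ u₂ t one_pos hq hu₁ hu₂ ht htu f hf x)
        hu hub
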